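/- Let $n\ge 1$ and consider graphs on the vertex set $[n+1]=\{1,\dots,n+1\}$, with edges written $(i,j)$, $i<j$. A graph is noncrossing if there are no $i<j<k<l$ with edges $(i,k)$ and $(j,l)$, and alternating if there are no $i<j<k$ with edges $(i,j)$ and $(j,k)$. The transitive closure $\overline G$ of $G$ has an edge $(i,j)$ whenever $G$ has a path from $i$ to $j$ with increasing vertices. *Reduced forms.* Let $\beta$ be a central variable and $x_{ij}$ ($1\le i<j\le n+1$) be variables over $\mathbb Q[\beta]$. The reduction rule replaces, in one term, a factor $x_{ij}x_{jk}$ ($i<j<k$) by $x_{ik}x_{ij}+x_{jk}x_{ik}+\beta x_{ik}$. In the commutative case (subdivision algebra $\mathcal S(A_n)$) all variables commute; in the noncommutative case (quasi-classical Yang–Baxter algebra $\mathcal B(A_n)$) only $x_{ij}$ and $x_{kl}$ with $i,j,k,l$ distinct may be commuted, and the rule applies to adjacent variables. A reduced form of a monomial is a polynomial obtained from it by successive reductions, with the allowed commutations in between, until no reduction is possible (also after commutations). Noncommutative polynomials are considered up to the allowed commutations. For a graph $G$ put $m^{\mathcal S}[G]=\prod_{(i,j)\in E(G)}x_{ij}$;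 if the edges of $G$ are labelled $1,\dots,k$, let $m^{\mathcal B}[G]$ be the product of the variables $x_{ij}$ in the order of the labels. *Good trees.* An edge-labelled tree on $[n+1]$, with $n$ edges labelled $1,\dots,n$, is good if it is noncrossing and, writing $(i,j)_a$ for an edge $(i,j)$ labelled $a$: edges $(i,j)_a,(j,k)_b$ with $i<j<k$ have $a<b$; edges $(i,j)_a,(i,k)_b$ with $j<k$ have $a>b$; edges $(i,j)_a,(k,j)_b$ with $i<k$ have $a>b$. *Pseudo-components.* For a noncrossing tree $T$ let $P$ be the path from its minimal to its maximal vertex. Write $T\setminus P$ as an edge-disjoint union of the least possible number of trees $T_1,\dots,T_k$ such that every vertex of $P$ lying on some $T_l$ is the minimal or the maximal vertex of $T_l$. The pseudo-components of $T$ are $P$ and, recursively, the pseudo-components of $T_1,\dots,T_k$. A pseudo-component is on $[i,j]$, $i<j$, if its endpoints are $i$ and $j$; it is then a left pseudo-component if $T$ has no edge $(s,i)$ with $s<i$, and a right pseudo-component if $T$ has no edge $(j,s)$ with $j<s$. *Forests.* Call a noncrossing alternating spanning forest $F$ of $\overline T$ admissible if it contains the edge $(1,n+1)$, at least one edge $(i_1,j)$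 with $i_1\le i$ for each right pseudo-component of $T$ on $[i,j]$, and at least one edge $(i,j_1)$ with $j\le j_1$ for each left pseudo-component of $T$ on $[i,j]$. Let $f_{T,k}$ be the number of admissible forests with $k$ edges and $f_T$ the number of noncrossing alternating spanning trees of $\overline T$. For a forest $F$ order the edges lexicographically: $(i_1,j_1)$ precedes $(i_2,j_2)$ if $j_1>j_2$, or $j_1=j_2$ and $i_1>i_2$; let $x^F$ be the noncommutative product of the variables $x_{ij}$, $(i,j)\in E(F)$, in this order. **Theorem.** (Commutative part.) Let $T$ be a noncrossing tree on $[n+1]$. Then $m^{\mathcal S}[T]$ has a reduced form, and every reduced form $P^{\mathcal S}_n$ of $m^{\mathcal S}[T]$ satisfies $$P^{\mathcal S}_n(x_{ij}=1)=\sum_{m=0}^{n-1}f_{T,n-m}\,\beta^m,\qquad P^{\mathcal S}_n(x_{ij}=1,\beta=0)=f_T .$$ (Noncommutative part.) Let $T$ be a good tree on $[n+1]$. Then $m^{\mathcal B}[T]$ has exactly one reduced form (up to the allowed commutations), namely $$P^{\mathcal B}_n=\sum_F\beta^{\,n-|E(F)|}x^F,$$ where $F$ runs over all admissible forests of $\overline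 T$. In particular $P^{\mathcal B}_n(x_{ij},\beta=0)=\sum_{T_0}x^{T_0}$, where $T_0$ runs over all noncrossing alternating spanning trees of $\overline T$. -/

import Mathlib

namespace RootPolytope

/-! Graphs on the vertex set `[n+1]` are modelled on `Fin (n + 1)`; the vertices `1` and `n + 1` are
`0` and `Fin.last n`.  An edge is a pair `i < j`, and a graph is given by its finite set of edges. -/

/-- The possible edges `(i, j)`, `i < j`, on the vertex set `[n+1]`; they also index the variables
`x_{ij}`. -/
abbrev Edge (n : ℕ) : Type := {e : Fin (n + 1) × Fin (n + 1) // e.1 < e.2}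

/-- The smaller endpoint. -/
abbrev src {n : ℕ} (e : Edge n) : Fin (n + 1) := e.1.1

/-- The larger endpoint. -/
abbrev tgt {n : ℕ} (e : Edge n) : Fin (n + 1) := e.1.2

/-- The edge `(i, j)`. -/
abbrev edge {n : ℕ} (i j : Fin (n + 1)) (h : i < j) : Edge n := ⟨(i, j), h⟩

/-- The simple graph on `[n+1]` with the given edge set. -/
def toGraph {n : ℕ} (G : Finset (Edge n)) : SimpleGraph (Fin (n + 1)) :=
  SimpleGraph.fromRel fun i j => ∃ e ∈ G, src e = i ∧ tgt e = j

/-- A graph is noncrossing if there are no `i < j < k < l` with edges `(i, k)` and `(j, l)`. -/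
def Noncrossing {n : ℕ} (G : Finset (Edge n)) : Prop :=
  ∀ e ∈ G, ∀ f ∈ G, ¬ (src e < src f ∧ src f < tgt e ∧ tgt e < tgt f)

/-- A graph is alternating if there are no `i < j < k` with edges `(i, j)` and `(j, k)`. -/
def Alternating {n : ℕ} (G : Finset (Edge n)) : Prop :=
  ∀ e ∈ G, ∀ f ∈ G, tgt e ≠ src f

open Classical in
/-- The transitive closure: `(i, j)` is an edge if there is an increasing path of `G` from `i`
to `j`. -/
noncomputable def closure {n : ℕ} (G : Finset (Edge n)) : Finset (Edge n) :=
  Finset.univ.filter fun e =>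
    Relation.TransGen (fun a b => ∃ f ∈ G, src f = a ∧ tgt f = b) (src e) (tgt e)

/-- `T` is a tree on the whole vertex set `[n+1]`. -/
def IsSpanningTree {n : ℕ} (T : Finset (Edge n)) : Prop := (toGraph T).IsTree

/-- `F` is a noncrossing alternating spanning forest of the transitive closure of `T`. -/
def IsNCASpanningForest {n : ℕ} (T F : Finset (Edge n)) : Prop :=
  F ⊆ closure T ∧ (toGraph F).IsAcyclic ∧ Noncrossing F ∧ Alternating F

/-- `F` is a noncrossing alternating spanning tree of the transitive closure of `T`. -/
def IsNCASpanningTree {n : ℕ} (T F : Finset (Edge n)) : Prop :=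
  F ⊆ closure T ∧ IsSpanningTree F ∧ Noncrossing F ∧ Alternating F

/-! ### Pseudo-components -/

/-- The endpoints of the edges of `G`. -/
def verts {n : ℕ} (G : Finset (Edge n)) : Set (Fin (n + 1)) :=
  {v | ∃ e ∈ G, src e = v ∨ tgt e = v}

/-- `G` is (the edge set of) a tree with at least one edge, on the set of endpoints of its edges. -/
def IsSubtree {n : ℕ} (G : Finset (Edge n)) : Prop :=
  G.Nonempty ∧ (toGraph G).IsAcyclic ∧
    ∀ u ∈ verts G, ∀ v ∈ verts G, (toGraph G).Reachable u v

/-- `P` is the edge set of a simple path with endpoints `i` and `j`. -/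
def IsPathOn {n : ℕ} (P : Finset (Edge n)) (i j : Fin (n + 1)) : Prop :=
  ∃ p : (toGraph P).Walk i j, p.IsPath ∧ ∀ e ∈ P, s(src e, tgt e) ∈ p.edges

/-- `P` is the edge set of the path of the tree `T` from its minimal to its maximal vertex. -/
def IsMainPath {n : ℕ} (T P : Finset (Edge n)) : Prop :=
  P ⊆ T ∧ ∃ i j, IsLeast (verts T) i ∧ IsGreatest (verts T) j ∧ IsPathOn P i j

/-- `D` decomposes `T \ P` as an edge-disjoint union of trees, such that every vertex of `P` that
lies on one of these trees is its minimal or its maximal vertex. -/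
structure IsDecomposition {n : ℕ} (T P : Finset (Edge n)) (D : Finset (Finset (Edge n))) :
    Prop where
  isSubtree : ∀ S ∈ D, IsSubtree S
  disjoint : ∀ S ∈ D, ∀ S' ∈ D, S ≠ S' → Disjoint S S'
  union : D.biUnion id = T \ P
  extremal : ∀ S ∈ D, ∀ v ∈ verts P ∩ verts S, IsLeast (verts S) v ∨ IsGreatest (verts S) v

/-- A decomposition into the least possible number of trees. -/
def IsMinDecomposition {n : ℕ} (T P : Finset (Edge n)) (D : Finset (Finset (Edge n))) : Prop :=
  IsDecomposition T P D ∧ ∀ D', IsDecomposition T P D' → D.card ≤ D'.card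

/-- `Q` is a pseudo-component of the noncrossing tree `T`: either it is the path from the minimal
to the maximal vertex, or it is a pseudo-component of one of the trees into which the rest of `T`
decomposes. -/
inductive IsPseudoComponent {n : ℕ} : Finset (Edge n) → Finset (Edge n) → Prop
  | path {T P : Finset (Edge n)} (hP : IsMainPath T P) : IsPseudoComponent T P
  | step {T P S Q : Finset (Edge n)} {D : Finset (Finset (Edge n))} (hP : IsMainPath T P)
      (hD : IsMinDecomposition T P D) (hS : S ∈ D) (hQ : IsPseudoComponent S Q) :
      IsPseudoComponent T Q

/-- `T` has a left pseudo-component on `[i, j]`. -/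
def HasLeftPseudoComponent {n : ℕ} (T : Finset (Edge n)) (i j : Fin (n + 1)) : Prop :=
  i < j ∧ (∃ Q, IsPseudoComponent T Q ∧ IsPathOn Q i j) ∧ ∀ e ∈ T, tgt e ≠ i

/-- `T` has a right pseudo-component on `[i, j]`. -/
def HasRightPseudoComponent {n : ℕ} (T : Finset (Edge n)) (i j : Fin (n + 1)) : Prop :=
  i < j ∧ (∃ Q, IsPseudoComponent T Q ∧ IsPathOn Q i j) ∧ ∀ e ∈ T, src e ≠ j

/-- The noncrossing alternating spanning forests `F` of the transitive closure of `T` that contain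
the edge `(1, n+1)`, some edge `(i₁, j)` with `i₁ ≤ i` for each right pseudo-component of `T` on
`[i, j]`, and some edge `(i, j₁)` with `j ≤ j₁` for each left pseudo-component of `T` on
`[i, j]`. -/
structure IsAdmissible {n : ℕ} (T F : Finset (Edge n)) : Prop where
  forest : IsNCASpanningForest T F
  root : ∃ e ∈ F, src e = 0 ∧ tgt e = Fin.last n
  right : ∀ i j, HasRightPseudoComponent T i j → ∃ e ∈ F, src e ≤ i ∧ tgt e = j
  left : ∀ i j, HasLeftPseudoComponent T i j → ∃ e ∈ F, src e = i ∧ j ≤ tgt e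

open Classical in
/-- The finite set of all admissible forests. -/
noncomputable def admissibleForests {n : ℕ} (T : Finset (Edge n)) : Finset (Finset (Edge n)) :=
  Finset.univ.filter fun F => IsAdmissible T F

/-- `f_{T,k}`: the number of admissible forests with `k` edges. -/
noncomputable def numForests {n : ℕ} (T : Finset (Edge n)) (k : ℕ) : ℕ :=
  ((admissibleForests T).filter fun F => F.card = k).card

open Classical in
/-- The finite set of noncrossing alternating spanning trees of the transitive closure of `T`. -/
noncomputable def ncaTrees {n : ℕ} (T : Finset (Edge n)) : Finset (Finset (Edge n)) :=
  Finset.univ.filter fun F => IsNCASpanningTree T F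

/-! ### Edge-labelled graphs

A graph with `k` edges labelled `1, …, k` is the list of its (distinct) edges in the order of their
labels. -/

/-- A good forest, as a list of edges in the order of their labels. -/
structure IsGoodForest {n : ℕ} (L : List (Edge n)) : Prop where
  nodup : L.Nodup
  acyclic : (toGraph L.toFinset).IsAcyclic
  consecutive : ∀ a b : Fin L.length, tgt (L.get a) = src (L.get b) → a < b
  same_src : ∀ a b : Fin L.length,
    src (L.get a) = src (L.get b) → tgt (L.get a) < tgt (L.get b) → b < a
  same_tgt : ∀ a b : Fin L.length,
    tgt (L.get a) = tgt (L.get b) → src (L.get a) < src (L.get b) → b < a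
  noncrossing : Noncrossing L.toFinset

/-- A good tree: a good forest that is a tree on `[n+1]`. -/
def IsGoodTree {n : ℕ} (L : List (Edge n)) : Prop :=
  IsGoodForest L ∧ IsSpanningTree L.toFinset

/-- Weak version of the lexicographic order on edges: `(i₁, j₁)` is less than `(i₂, j₂)` if
`j₁ > j₂`, or `j₁ = j₂` and `i₁ > i₂`. -/
def lexLE {n : ℕ} (e f : Edge n) : Prop :=
  tgt f < tgt e ∨ (tgt e = tgt f ∧ src f ≤ src e)

instance {n : ℕ} : DecidableRel (lexLE (n := n)) := fun e f => by
  unfold lexLE; infer_instance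

instance {n : ℕ} : IsTrans (Edge n) lexLE := ⟨fun a b c h h' => by
  unfold lexLE at *; grind⟩

instance {n : ℕ} : Std.Antisymm (lexLE (n := n)) := ⟨fun a b h h' => by
  have h1 : tgt a = tgt b := by unfold lexLE at *; grind
  have h2 : src a = src b := by unfold lexLE at *; grind
  exact Subtype.ext (Prod.ext h2 h1)⟩

instance {n : ℕ} : Std.Total (lexLE (n := n)) := ⟨fun a b => by
  unfold lexLE; grind⟩

/-- The edges of `F` in the order of the lexicographic edge-labels. -/
def lexLabelling {n : ℕ} (F : Finset (Edge n)) : List (Edge n) := F.sort lexLE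

/-! ### Reduced forms in the commutative case

Polynomials in commuting variables `x_{ij}` over `ℚ[β]`, where `β` is `Polynomial.X`.  In the course
of a reduction a polynomial is kept as the multiset of its terms `β^b m` (each with coefficient
`1`, like terms not being collected), where the monomial `m` is the multiset of its variables. -/

/-- One application of the reduction rule
`x_{ij} x_{jk} → x_{ik} x_{ij} + x_{jk} x_{ik} + β x_{ik}` to one term. -/
inductive SReduction {n : ℕ} :
    Multiset (ℕ × Multiset (Edge n)) → Multiset (ℕ × Multiset (Edge n)) → Prop
  | mk (i j k : Fin (n + 1)) (hij : i < j) (hjk : j < k) (b : ℕ) (m : Multiset (Edge n))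
      (R : Multiset (ℕ × Multiset (Edge n))) :
      SReduction
        ((b, edge i j hij ::ₘ edge j k hjk ::ₘ m) ::ₘ R)
        ((b, edge i k (hij.trans hjk) ::ₘ edge i j hij ::ₘ m) ::ₘ
          (b, edge j k hjk ::ₘ edge i k (hij.trans hjk) ::ₘ m) ::ₘ
          (b + 1, edge i k (hij.trans hjk) ::ₘ m) ::ₘ R)

/-- The polynomial with the given terms. -/
noncomputable def sPoly {n : ℕ} (A : Multiset (ℕ × Multiset (Edge n))) :
    MvPolynomial (Edge n) (Polynomial ℚ) :=
  (A.map fun t => MvPolynomial.C (Polynomial.X ^ t.1) * (t.2.map MvPolynomial.X).prod).sum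

/-- `P` is a reduced form of the commutative monomial `m` in the subdivision algebra: it is
obtained from `m` by successive reductions, and no further reduction is possible. -/
def IsSReducedForm {n : ℕ} (m : Multiset (Edge n))
    (P : MvPolynomial (Edge n) (Polynomial ℚ)) : Prop :=
  ∃ A, Relation.ReflTransGen SReduction {(0, m)} A ∧ (∀ A', ¬ SReduction A A') ∧ P = sPoly A

/-! ### Reduced forms in the noncommutative case -/

/-- The edges `(i, j)` and `(k, l)` have four distinct endpoints. -/
def EdgeDisjoint {n : ℕ} (e f : Edge n) : Prop :=
  src e ≠ src f ∧ src e ≠ tgt f ∧ tgt e ≠ src f ∧ tgt e ≠ tgt f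

/-- The relations `x_{ij} x_{kl} = x_{kl} x_{ij}` for `i, j, k, l` distinct. -/
inductive CommRel (n : ℕ) : FreeMonoid (Edge n) → FreeMonoid (Edge n) → Prop
  | swap (e f : Edge n) (h : EdgeDisjoint e f) :
      CommRel n (FreeMonoid.of e * FreeMonoid.of f) (FreeMonoid.of f * FreeMonoid.of e)

/-- Noncommutative monomials in the variables `x_{ij}`, up to commutation of `x_{ij}` and `x_{kl}`
for `i, j, k, l` distinct. -/
abbrev NCMonomial (n : ℕ) : Type := PresentedMonoid (CommRel n)

/-- Polynomials over `K` in the noncommuting variables `x_{ij}`, up to commutation of `x_{ij}` and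
`x_{kl}` for `i, j, k, l` distinct. -/
abbrev NCPoly (K : Type) [CommRing K] (n : ℕ) : Type := MonoidAlgebra K (NCMonomial n)

/-- The monomial `∏ x_{i_l j_l}`, in the order of the list. -/
def ncMonomial {n : ℕ} (w : List (Edge n)) : NCMonomial n :=
  PresentedMonoid.mk (CommRel n) (FreeMonoid.ofList w)

/-- Commutation of two adjacent variables `x_{ij}`, `x_{kl}` with `i, j, k, l` distinct in one
term.  Polynomials are kept as multisets of terms `β^b w`, `w` a word in the variables. -/
inductive BCommutation {n : ℕ} :
    Multiset (ℕ × List (Edge n)) → Multiset (ℕ × List (Edge n)) → Prop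
  | mk (e f : Edge n) (h : EdgeDisjoint e f) (b : ℕ) (u v : List (Edge n))
      (R : Multiset (ℕ × List (Edge n))) :
      BCommutation ((b, u ++ e :: f :: v) ::ₘ R) ((b, u ++ f :: e :: v) ::ₘ R)

/-- One application of the reduction rule
`x_{ij} x_{jk} → x_{ik} x_{ij} + x_{jk} x_{ik} + β x_{ik}` to adjacent variables of one term. -/
inductive BReduction {n : ℕ} :
    Multiset (ℕ × List (Edge n)) → Multiset (ℕ × List (Edge n)) → Prop
  | mk (i j k : Fin (n + 1)) (hij : i < j) (hjk : j < k) (b : ℕ) (u v : List (Edge n))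
      (R : Multiset (ℕ × List (Edge n))) :
      BReduction
        ((b, u ++ edge i j hij :: edge j k hjk :: v) ::ₘ R)
        ((b, u ++ edge i k (hij.trans hjk) :: edge i j hij :: v) ::ₘ
          (b, u ++ edge j k hjk :: edge i k (hij.trans hjk) :: v) ::ₘ
          (b + 1, u ++ edge i k (hij.trans hjk) :: v) ::ₘ R)

/-- The polynomial with the given terms. -/
noncomputable def bPoly {n : ℕ} (A : Multiset (ℕ × List (Edge n))) : NCPoly (Polynomial ℚ) n :=
  (A.map fun t => MonoidAlgebra.single (ncMonomial t.2) (Polynomial.X ^ t.1)).sum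

/-- `P` is a reduced form of the noncommutative monomial `w` in the quasi-classical Yang-Baxter
algebra: it is obtained from `w` by successive reductions and commutations, and no further
reduction is possible, not even after commutations. -/
def IsBReducedForm {n : ℕ} (w : List (Edge n)) (P : NCPoly (Polynomial ℚ) n) : Prop :=
  ∃ A, Relation.ReflTransGen (fun A₁ A₂ => BReduction A₁ A₂ ∨ BCommutation A₁ A₂) {(0, w)} A ∧
    (∀ A₁ A₂, Relation.ReflTransGen BCommutation A A₁ → ¬ BReduction A₁ A₂) ∧ P = bPoly A

end RootPolytope

/-! Attach to the edge (i,j) the root e_i - e_j in simple-root coordinates: the vector `gaps` that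
is 1 exactly at the gaps i, ..., j-1. If u and v belong to consecutive edges, the open cone on u, v
is the disjoint union of the open cones on (u+v, u), on (v, u+v) and on u+v alone. With `ray` =
z/(1-z), z the monomial of the edge, this is the reduction rule at β = 1 (`ray_mul_ray`), so the sum
over all terms of the products of rays is invariant under reduction (`SReduction.sum_eq`). For a
forest the roots are independent, and the product of rays counts the lattice points of its open cone
(`coeff_prod_ray`).

Distinct noncrossing alternating graphs have disjoint open cones: such a graph and its
multiplicities can be read off from the flow (`eq_of_inOpenCone`). If the tree T is reduced through
noncrossing forests only, the forests obtained at the end therefore have cones that tile the open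
cone of T. Each of them covers T: every edge of T lies on an increasing path of T represented by an
edge of the forest. Conversely a covering forest F has the interior point `flow F 1` inside the open
cone of T, so it occurs, and exactly once (`eq_admissibleForests`). Covering is equivalent to the
condition on pseudo-components (`isAdmissible_iff_covers`); this is where the recursive structure of
T enters.

In the commutative case a noncrossing reduction exists: reduce at j with i least and k greatest
(`exists_reduction`). An arbitrary reduced form may contain crossing graphs, but all its terms are
alternating. Summing coefficients over flows of fixed total supply turns an alternating term with k
edges into a number of compositions into k parts; these sequences are unitriangular in k, so the
numbers of edges of the terms are determined (`card_eq_of_sum_eq`). Since β has degree 1, they also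
determine the powers of β.

In the noncommutative case the order conditions of a good tree force i least and k greatest at every
reduction and are inherited by all reducts (`IsGoodWord.reduct`). A good word with two consecutive
edges can be commuted until such a pair is adjacent (`exists_adjacent`), so irreducible words are
alternating. A word satisfying the order conditions is determined by its letters up to commutation
(`wordEquiv_of_perm`). Hence every reduced form is the sum over admissible forests in lexicographic
order. Setting β = 0 leaves the forests with n edges, which are the spanning trees; spanning trees
in the closure cover T automatically. -/

namespace RootPolytope

open SimpleGraph

variable {n : ℕ}

/-! ### Basic facts on `toGraph` -/

theorem toGraph_adj {G : Finset (Edge n)} {a b : Fin (n + 1)} :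
    (toGraph G).Adj a b ↔ ∃ e ∈ G, (src e = a ∧ tgt e = b) ∨ (src e = b ∧ tgt e = a) := by
  unfold toGraph
  rw [SimpleGraph.fromRel_adj]
  constructor
  · rintro ⟨-, ⟨e, he, h⟩ | ⟨e, he, h⟩⟩
    exacts [⟨e, he, Or.inl h⟩, ⟨e, he, Or.inr h⟩]
  · rintro ⟨e, he, h | h⟩
    · exact ⟨by rw [← h.1, ← h.2]; exact e.2.ne, Or.inl ⟨e, he, h⟩⟩
    · exact ⟨by rw [← h.1, ← h.2]; exact e.2.ne', Or.inr ⟨e, he, h⟩⟩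

theorem adj_of_mem {G : Finset (Edge n)} {e : Edge n} (he : e ∈ G) :
    (toGraph G).Adj (src e) (tgt e) := toGraph_adj.2 ⟨e, he, Or.inl ⟨rfl, rfl⟩⟩

theorem reachable_of_mem {G : Finset (Edge n)} {e : Edge n} (he : e ∈ G) :
    (toGraph G).Reachable (src e) (tgt e) := (adj_of_mem he).reachable

theorem toGraph_mono {G H : Finset (Edge n)} (h : G ⊆ H) : toGraph G ≤ toGraph H := by
  intro a b hab
  rw [toGraph_adj] at hab ⊢
  obtain ⟨e, he, h'⟩ := hab
  exact ⟨e, h he, h'⟩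

theorem edge_ext {e f : Edge n} (h1 : src e = src f) (h2 : tgt e = tgt f) : e = f :=
  Subtype.ext (Prod.ext h1 h2)

theorem sym2_mem_edgeSet {G : Finset (Edge n)} {z : Sym2 (Fin (n + 1))} :
    z ∈ (toGraph G).edgeSet ↔ ∃ e ∈ G, s(src e, tgt e) = z := by
  induction z with
  | _ a b =>
    rw [SimpleGraph.mem_edgeSet, toGraph_adj]
    simp only [Sym2.eq_iff]

theorem sym2_injective {e f : Edge n} (h : s(src e, tgt e) = s(src f, tgt f)) : e = f := by
  rcases Sym2.eq_iff.1 h with h | h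
  · exact edge_ext h.1 h.2
  · have := e.2
    have := f.2
    exact absurd h (by grind)

theorem deleteEdges_toGraph (G : Finset (Edge n)) (e : Edge n) :
    (toGraph G).deleteEdges {s(src e, tgt e)} = toGraph (G.erase e) := by
  ext a b
  rw [SimpleGraph.deleteEdges_adj, toGraph_adj, toGraph_adj]
  constructor
  · rintro ⟨⟨f, hf, h⟩, h'⟩
    refine ⟨f, Finset.mem_erase.2 ⟨?_, hf⟩, h⟩
    rintro rfl
    apply h'
    rw [Set.mem_singleton_iff, Sym2.eq_iff]
    grind
  · rintro ⟨f, hf, h⟩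
    obtain ⟨hne, hf⟩ := Finset.mem_erase.1 hf
    refine ⟨⟨f, hf, h⟩, fun h' => hne ?_⟩
    apply sym2_injective
    rw [← Set.mem_singleton_iff.1 h', Sym2.eq_iff]
    grind

/-- Removing an edge of a forest disconnects its endpoints. -/
theorem not_reachable_erase {G : Finset (Edge n)} (hG : (toGraph G).IsAcyclic) {e : Edge n}
    (he : e ∈ G) : ¬ (toGraph (G.erase e)).Reachable (src e) (tgt e) := by
  have := (SimpleGraph.isAcyclic_iff_forall_adj_isBridge.1 hG) (adj_of_mem he)
  rwa [SimpleGraph.isBridge_iff, deleteEdges_toGraph] at this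

theorem acyclic_mono {G H : Finset (Edge n)} (h : G ⊆ H) (hH : (toGraph H).IsAcyclic) :
    (toGraph G).IsAcyclic := hH.anti (toGraph_mono h)

theorem acyclic_insert {G : Finset (Edge n)} {e : Edge n} (hG : (toGraph G).IsAcyclic)
    (h : ¬ (toGraph G).Reachable (src e) (tgt e)) : (toGraph (insert e G)).IsAcyclic := by
  have := hG.sup_edge_of_not_reachable h
  refine this.anti ?_
  intro a b hab
  rw [toGraph_adj] at hab
  obtain ⟨f, hf, h'⟩ := hab
  rw [SimpleGraph.sup_adj]
  rcases Finset.mem_insert.1 hf with rfl | hf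
  · right
    rw [SimpleGraph.edge_adj]
    have := f.2
    grind
  · exact Or.inl (toGraph_adj.2 ⟨f, hf, h'⟩)

/-- A connection from inside to outside of a set of vertices uses an edge leaving that set. -/
theorem exists_boundary_edge {G : Finset (Edge n)} {u v : Fin (n + 1)}
    (h : (toGraph G).Reachable u v) (S : Set (Fin (n + 1))) (hu : u ∈ S) (hv : v ∉ S) :
    ∃ e ∈ G, (src e ∈ S ∧ tgt e ∉ S) ∨ (tgt e ∈ S ∧ src e ∉ S) := by
  obtain ⟨p⟩ := h
  obtain ⟨d, -, h1, h2⟩ := p.exists_boundary_dart S hu hv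
  obtain ⟨e, he, h⟩ := toGraph_adj.1 d.adj
  refine ⟨e, he, ?_⟩
  rcases h with h | h
  · left; rw [h.1, h.2]; exact ⟨h1, h2⟩
  · right; rw [h.1, h.2]; exact ⟨h1, h2⟩

/-- In a forest, edge-disjoint subgraphs cannot both connect two distinct vertices. -/
theorem eq_of_reachable_disjoint {G U V : Finset (Edge n)} (hG : (toGraph G).IsAcyclic)
    (hU : U ⊆ G) (hV : V ⊆ G) (hUV : Disjoint U V) {x y : Fin (n + 1)}
    (h1 : (toGraph U).Reachable x y) (h2 : (toGraph V).Reachable x y) : x = y := by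
  classical
  obtain ⟨p, hp⟩ := h1.exists_isPath
  obtain ⟨q, hq⟩ := h2.exists_isPath
  have hp' := (SimpleGraph.Walk.isPath_mapLe (toGraph_mono hU)).2 hp
  have hq' := (SimpleGraph.Walk.isPath_mapLe (toGraph_mono hV)).2 hq
  have := (hG.subsingleton_path x y).elim ⟨_, hp'⟩ ⟨_, hq'⟩
  have hpq := congrArg (fun r : (toGraph G).Path x y => r.1.edges) this
  simp only [SimpleGraph.Walk.edges_mapLe_eq_edges] at hpq
  by_contra hxy
  cases p with
  | nil => exact hxy rfl
  | cons h p =>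
    rename_i w
    have hm : s(x, w) ∈ (Walk.cons h p).edges := by simp
    have hm' := hm
    rw [hpq] at hm'
    obtain ⟨e, he, h3⟩ := sym2_mem_edgeSet.1 (Walk.edges_subset_edgeSet _ hm)
    obtain ⟨f, hf, h4⟩ := sym2_mem_edgeSet.1 (Walk.edges_subset_edgeSet _ hm')
    obtain rfl := sym2_injective (h3.trans h4.symm)
    exact (Finset.disjoint_left.1 hUV) he hf

/-! ### The flow of an edge -/

/-- The gaps `p` (between `p` and `p + 1`) crossed by the edge `e`, as an exponent. -/
noncomputable def gaps (e : Edge n) : Fin (n + 1) →₀ ℕ :=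
  Finsupp.equivFunOnFinite.symm fun p => if src e ≤ p ∧ p < tgt e then 1 else 0

theorem gaps_apply (e : Edge n) (p : Fin (n + 1)) :
    gaps e p = if src e ≤ p ∧ p < tgt e then 1 else 0 := rfl

theorem gaps_ne_zero (e : Edge n) : gaps e ≠ 0 := by
  intro h
  have h1 := DFunLike.congr_fun h (src e)
  rw [gaps_apply, if_pos ⟨le_rfl, e.2⟩] at h1
  simp at h1

theorem gaps_add (i j k : Fin (n + 1)) (hij : i < j) (hjk : j < k) :
    gaps (edge i j hij) + gaps (edge j k hjk) = gaps (edge i k (hij.trans hjk)) := by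
  ext p
  simp only [Finsupp.add_apply, gaps_apply]
  grind

/-- The flow with multiplicities `c` along the edges of `s`. -/
noncomputable def flow (s : Finset (Edge n)) (c : Edge n → ℕ) : Fin (n + 1) →₀ ℕ :=
  ∑ e ∈ s, c e • gaps e

theorem flow_apply (s : Finset (Edge n)) (c : Edge n → ℕ) (p : Fin (n + 1)) :
    flow s c p = ∑ e ∈ s, if src e ≤ p ∧ p < tgt e then c e else 0 := by
  simp [flow, Finsupp.finsetSum_apply, gaps_apply]

/-- The value at the gap before `i`. -/
def prev (g : Fin (n + 1) → ℕ) (i : Fin (n + 1)) : ℕ :=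
  if h : i.1 = 0 then 0 else g ⟨i.1 - 1, by omega⟩

theorem prev_flow (s : Finset (Edge n)) (c : Edge n → ℕ) (i : Fin (n + 1)) :
    prev (flow s c) i = ∑ e ∈ s, if src e < i ∧ i ≤ tgt e then c e else 0 := by
  unfold prev
  split_ifs with h
  · symm
    apply Finset.sum_eq_zero
    intro e _
    rw [if_neg]
    rintro ⟨h1, -⟩
    rw [Fin.lt_def] at h1
    omega
  · rw [flow_apply]
    apply Finset.sum_congr rfl
    intro e _
    congr 1
    simp only [Fin.lt_def, Fin.le_def, eq_iff_iff]
    omega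

/-- The net flow out of a vertex. -/
theorem flow_sub_prev (s : Finset (Edge n)) (c : Edge n → ℕ) (i : Fin (n + 1)) :
    (flow s c i : ℤ) - prev (flow s c) i =
      ∑ e ∈ s, (c e : ℤ) * ((if src e = i then 1 else 0) - (if tgt e = i then 1 else 0)) := by
  rw [prev_flow, flow_apply]
  push_cast
  rw [← Finset.sum_sub_distrib]
  apply Finset.sum_congr rfl
  intro e _
  have := e.2
  split_ifs <;> grind

/-- The net flow out of a set `A` of vertices. -/
theorem sum_net (A : Finset (Fin (n + 1))) (s : Finset (Edge n)) (c : Edge n → ℕ) :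
    ∑ i ∈ A, ((flow s c i : ℤ) - prev (flow s c) i) =
      ∑ e ∈ s, (c e : ℤ) * ((if src e ∈ A then 1 else 0) - (if tgt e ∈ A then 1 else 0)) := by
  simp only [flow_sub_prev]
  rw [Finset.sum_comm]
  apply Finset.sum_congr rfl
  intro e _
  rw [← Finset.mul_sum, Finset.sum_sub_distrib]
  simp

/-- A set of edges is independent if its flows determine the multiplicities. -/
def Independent (s : Finset (Edge n)) : Prop :=
  ∀ c c' : Edge n → ℕ, flow s c = flow s c' → ∀ e ∈ s, c e = c' e

/-- Removing e from the forest cuts off a set A of vertices containing `src e` but not `tgt e`.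
Every other edge has both or neither of its ends in A, so the net flow out of A, which depends only
on the flow, is the multiplicity of e. -/
theorem independent_of_acyclic {G : Finset (Edge n)} (hG : (toGraph G).IsAcyclic) :
    Independent G := by
  classical
  intro c c' h e he
  let A : Finset (Fin (n + 1)) :=
    Finset.univ.filter fun v => (toGraph (G.erase e)).Reachable (src e) v
  have key : ∀ c : Edge n → ℕ,
      ∑ i ∈ A, ((flow G c i : ℤ) - prev (flow G c) i) = c e := by
    intro c
    rw [sum_net, Finset.sum_eq_single_of_mem e he]
    · rw [if_pos, if_neg]
      · ring
      · simpa [A] using not_reachable_erase hG he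
      · simp [A]
    · intro f hf hfe
      have h1 : (toGraph (G.erase e)).Reachable (src f) (tgt f) :=
        reachable_of_mem (Finset.mem_erase.2 ⟨hfe, hf⟩)
      have h2 : src f ∈ A ↔ tgt f ∈ A := by
        simp only [A, Finset.mem_filter, Finset.mem_univ, true_and]
        exact ⟨fun h => h.trans h1, fun h => h.trans h1.symm⟩
      simp [h2]
  have h1 := key c
  rw [h, key c'] at h1
  exact_mod_cast h1.symm

/-! ### Replacing edges in a forest -/

/-- If g closed a cycle, its ends would already be joined without f; by the hypothesis on
connections in the presence of e, the ends of f would be joined too, and f would lie on a cycle of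
the original forest. -/
theorem acyclic_replace {m : Finset (Edge n)} {e f g : Edge n}
    (hG : (toGraph (insert e (insert f m))).IsAcyclic) (hef : e ≠ f) (hf : f ∉ m)
    (h : ∀ H : Finset (Edge n), e ∈ H →
      (toGraph H).Reachable (src g) (tgt g) → (toGraph H).Reachable (src f) (tgt f)) :
    (toGraph (insert g (insert e m))).IsAcyclic := by
  have hsub : insert e m ⊆ insert e (insert f m) := by
    intro x; simp only [Finset.mem_insert]; tauto
  apply acyclic_insert (acyclic_mono hsub hG)
  intro hr
  have h1 := h _ (Finset.mem_insert_self e m) hr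
  apply not_reachable_erase hG (e := f) (by simp)
  refine h1.mono (toGraph_mono ?_)
  intro x hx
  rw [Finset.mem_erase]
  refine ⟨?_, hsub hx⟩
  rintro rfl
  rcases Finset.mem_insert.1 hx with h | h
  exacts [hef h.symm, hf h]

theorem not_mem_of_acyclic {m : Finset (Edge n)} {i j k : Fin (n + 1)} {hij : i < j} {hjk : j < k}
    (hG : (toGraph m).IsAcyclic) (h1 : edge i j hij ∈ m) (h2 : edge j k hjk ∈ m) :
    edge i k (hij.trans hjk) ∉ m := by
  intro h3
  apply not_reachable_erase hG h1
  have a1 : edge i k (hij.trans hjk) ∈ m.erase (edge i j hij) := by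
    rw [Finset.mem_erase]; refine ⟨?_, h3⟩
    intro h; have := congrArg tgt h; exact hjk.ne' this
  have a2 : edge j k hjk ∈ m.erase (edge i j hij) := by
    rw [Finset.mem_erase]; refine ⟨?_, h2⟩
    intro h; have := congrArg src h; exact hij.ne' this
  exact (reachable_of_mem a1).trans (reachable_of_mem a2).symm

/-! ### Vertices of subgraphs, main paths and decompositions -/

theorem src_mem_verts {G : Finset (Edge n)} {e : Edge n} (he : e ∈ G) : src e ∈ verts G :=
  ⟨e, he, Or.inl rfl⟩

theorem tgt_mem_verts {G : Finset (Edge n)} {e : Edge n} (he : e ∈ G) : tgt e ∈ verts G :=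
  ⟨e, he, Or.inr rfl⟩

theorem verts_mono {G H : Finset (Edge n)} (h : G ⊆ H) : verts G ⊆ verts H :=
  fun _ ⟨e, he, hv⟩ => ⟨e, h he, hv⟩

theorem verts_union {G H : Finset (Edge n)} {v : Fin (n + 1)} :
    v ∈ verts (G ∪ H) ↔ v ∈ verts G ∨ v ∈ verts H := by
  simp only [verts, Set.mem_ofPred_eq, Finset.mem_union]
  grind

theorem IsSubtree.exists_extremal {S : Finset (Edge n)} (hS : IsSubtree S) :
    ∃ i j, IsLeast (verts S) i ∧ IsGreatest (verts S) j := by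
  obtain ⟨e, he⟩ := hS.1
  have hne : (verts S).Nonempty := ⟨_, src_mem_verts he⟩
  obtain ⟨i, hi, hi'⟩ := Set.exists_min_image _ id (verts S).toFinite hne
  obtain ⟨j, hj, hj'⟩ := Set.exists_max_image _ id (verts S).toFinite hne
  exact ⟨i, j, ⟨hi, hi'⟩, ⟨hj, hj'⟩⟩

theorem IsPathOn.mem_support {P : Finset (Edge n)} {i j : Fin (n + 1)}
    {p : (toGraph P).Walk i j} (hp : ∀ e ∈ P, s(src e, tgt e) ∈ p.edges) {v : Fin (n + 1)}
    (hv : v ∈ verts P) : v ∈ p.support := by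
  obtain ⟨e, he, rfl | rfl⟩ := hv
  · exact p.fst_mem_support_of_mem_edges (hp e he)
  · exact p.snd_mem_support_of_mem_edges (hp e he)

theorem IsPathOn.reachable {P : Finset (Edge n)} {i j : Fin (n + 1)} (h : IsPathOn P i j)
    {u v : Fin (n + 1)} (hu : u ∈ verts P) (hv : v ∈ verts P) : (toGraph P).Reachable u v := by
  obtain ⟨p, -, hp⟩ := h
  have key : ∀ v ∈ verts P, (toGraph P).Reachable i v :=
    fun v hv => ⟨p.takeUntil v (IsPathOn.mem_support hp hv)⟩
  exact (key u hu).symm.trans (key v hv)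

theorem IsPathOn.mem_verts_of_ne {P : Finset (Edge n)} {i j : Fin (n + 1)} (h : IsPathOn P i j)
    (hij : i ≠ j) : i ∈ verts P ∧ j ∈ verts P := by
  obtain ⟨p, -, hp⟩ := h
  have h1 : (toGraph P).Reachable i j := ⟨p⟩
  obtain ⟨e, he, h2⟩ := exists_boundary_edge h1 {i} rfl (by simpa using hij.symm)
  obtain ⟨f, hf, h3⟩ := exists_boundary_edge h1.symm {j} rfl (by simpa using hij)
  simp only [Set.mem_singleton_iff] at h2 h3
  exact ⟨⟨e, he, by tauto⟩, ⟨f, hf, by tauto⟩⟩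

theorem exists_isMainPath {S : Finset (Edge n)} (hS : IsSubtree S) : ∃ P, IsMainPath S P := by
  classical
  obtain ⟨i, j, hi, hj⟩ := hS.exists_extremal
  obtain ⟨p, hp⟩ := (hS.2.2 i hi.1 j hj.1).exists_isPath
  let P := S.filter fun e => s(src e, tgt e) ∈ p.edges
  have hP : ∀ z ∈ p.edges, z ∈ (toGraph P).edgeSet := by
    intro z hz
    obtain ⟨e, he, rfl⟩ := sym2_mem_edgeSet.1 (p.edges_subset_edgeSet hz)
    exact sym2_mem_edgeSet.2 ⟨e, Finset.mem_filter.2 ⟨he, hz⟩, rfl⟩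
  refine ⟨P, Finset.filter_subset _ _, i, j, hi, hj, p.transfer _ hP, hp.transfer hP, ?_⟩
  intro e he
  rw [Walk.edges_transfer]
  exact (Finset.mem_filter.1 he).2

theorem extremal_lt {S : Finset (Edge n)} {i j : Fin (n + 1)} (hS : S.Nonempty)
    (hi : IsLeast (verts S) i) (hj : IsGreatest (verts S) j) : i < j := by
  obtain ⟨e, he⟩ := hS
  exact (hi.2 (src_mem_verts he)).trans_lt (e.2.trans_le (hj.2 (tgt_mem_verts he)))

/-- In a noncrossing graph an edge leaves the open interval under another edge only through the
endpoints of the latter. -/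
theorem Noncrossing.eq_end {G : Finset (Edge n)} (hG : Noncrossing G) {e f : Edge n} (he : e ∈ G)
    (hf : f ∈ G) {x y : Fin (n + 1)} (h : (src e = x ∧ tgt e = y) ∨ (src e = y ∧ tgt e = x))
    (h1 : src f < x) (h2 : x < tgt f) (h3 : ¬ (src f < y ∧ y < tgt f)) :
    y = src f ∨ y = tgt f := by
  have := hG e he f hf
  have := hG f hf e he
  have := e.2
  have := f.2
  grind

theorem Noncrossing.mono {G H : Finset (Edge n)} (h : G ⊆ H) (hH : Noncrossing H) :
    Noncrossing G := fun e he f hf => hH e (h he) f (h hf)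

theorem IsDecomposition.subset {S P : Finset (Edge n)} {D : Finset (Finset (Edge n))}
    (hD : IsDecomposition S P D) {U : Finset (Edge n)} (hU : U ∈ D) : U ⊆ S \ P := by
  rw [← hD.union]
  exact Finset.subset_biUnion_of_mem id hU

theorem exists_isMinDecomposition (S P : Finset (Edge n)) : ∃ D, IsMinDecomposition S P D := by
  classical
  have hex : ∃ D, IsDecomposition S P D := by
    -- Splitting into single edges always works, because both ends of an edge are extremal in it;
    -- minimality then comes from finiteness.
    refine ⟨(S \ P).image fun e => {e}, ?_, ?_, ?_, ?_⟩
    · intro U hU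
      obtain ⟨e, he, rfl⟩ := Finset.mem_image.1 hU
      refine ⟨Finset.singleton_nonempty e, ?_, ?_⟩
      · have : (toGraph (∅ : Finset (Edge n))) = ⊥ := by
          ext a b; rw [toGraph_adj]; simp
        rw [← insert_empty_eq]
        apply acyclic_insert
        · rw [this]; exact isAcyclic_bot
        · rw [this, reachable_bot]; exact e.2.ne
      · have h1 := reachable_of_mem (Finset.mem_singleton_self e)
        rintro u ⟨f, hf, hu⟩ v ⟨g, hg, hv⟩
        obtain rfl := Finset.mem_singleton.1 hf
        obtain rfl := Finset.mem_singleton.1 hg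
        rcases hu with rfl | rfl <;> rcases hv with rfl | rfl
        exacts [Reachable.refl _, h1, h1.symm, Reachable.refl _]
    · intro U hU V hV hne
      obtain ⟨e, he, rfl⟩ := Finset.mem_image.1 hU
      obtain ⟨f, hf, rfl⟩ := Finset.mem_image.1 hV
      rw [Finset.disjoint_singleton]
      rintro rfl
      exact hne rfl
    · rw [Finset.image_biUnion]
      exact Finset.biUnion_singleton_eq_self
    · rintro U hU v ⟨-, hv⟩
      obtain ⟨e, he, rfl⟩ := Finset.mem_image.1 hU
      obtain ⟨f, hf, hv⟩ := hv
      obtain rfl := Finset.mem_singleton.1 hf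
      have hsrc := src_mem_verts (Finset.mem_singleton_self f)
      have htgt := tgt_mem_verts (Finset.mem_singleton_self f)
      rcases hv with rfl | rfl
      · left
        refine ⟨hsrc, ?_⟩
        rintro x ⟨g, hg, hx⟩
        obtain rfl := Finset.mem_singleton.1 hg
        rcases hx with rfl | rfl
        exacts [le_rfl, g.2.le]
      · right
        refine ⟨htgt, ?_⟩
        rintro x ⟨g, hg, hx⟩
        obtain rfl := Finset.mem_singleton.1 hg
        rcases hx with rfl | rfl
        exacts [g.2.le, le_rfl]
  obtain ⟨D, hD, hmin⟩ := Set.exists_min_image {D | IsDecomposition S P D} Finset.card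
    (Set.toFinite _) hex
  exact ⟨D, hD, hmin⟩

/-- Two members of a minimal decomposition cannot be merged. -/
theorem IsMinDecomposition.not_mergeable {S P : Finset (Edge n)} {D : Finset (Finset (Edge n))}
    (hD : IsMinDecomposition S P D) {U V : Finset (Edge n)} (hU : U ∈ D) (hV : V ∈ D)
    (hUV : U ≠ V) (hsub : IsSubtree (U ∪ V))
    (hext : ∀ v ∈ verts P ∩ verts (U ∪ V), IsLeast (verts (U ∪ V)) v ∨
      IsGreatest (verts (U ∪ V)) v) : False := by
  classical
  have hD1 := hD.1
  have hlt : (insert (U ∪ V) ((D.erase U).erase V)).card < D.card := by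
    have h1 := Finset.card_insert_le (U ∪ V) ((D.erase U).erase V)
    rw [Finset.card_erase_of_mem (Finset.mem_erase.2 ⟨hUV.symm, hV⟩),
      Finset.card_erase_of_mem hU] at h1
    have h2 : 1 < D.card := Finset.one_lt_card.2 ⟨U, hU, V, hV, hUV⟩
    omega
  refine absurd (hD.2 (insert (U ∪ V) ((D.erase U).erase V)) ⟨?_, ?_, ?_, ?_⟩) (not_le.2 hlt)
  · intro W hW
    rcases Finset.mem_insert.1 hW with rfl | hW
    · exact hsub
    · exact hD1.isSubtree W (Finset.mem_of_mem_erase (Finset.mem_of_mem_erase hW))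
  · have key : ∀ W ∈ (D.erase U).erase V, Disjoint (U ∪ V) W := by
      intro W hW
      obtain ⟨h1, hW⟩ := Finset.mem_erase.1 hW
      obtain ⟨h2, hW⟩ := Finset.mem_erase.1 hW
      rw [Finset.disjoint_union_left]
      exact ⟨hD1.disjoint _ hU _ hW h2.symm, hD1.disjoint _ hV _ hW h1.symm⟩
    intro W hW W' hW' hne
    rcases Finset.mem_insert.1 hW with h | h <;> rcases Finset.mem_insert.1 hW' with h' | h'
    · exact absurd (h.trans h'.symm) hne
    · rw [h]; exact key _ h'
    · rw [h']; exact (key _ h).symm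
    · exact hD1.disjoint _ (Finset.mem_of_mem_erase (Finset.mem_of_mem_erase h)) _
        (Finset.mem_of_mem_erase (Finset.mem_of_mem_erase h')) hne
  · rw [← hD1.union]
    ext e
    simp only [Finset.mem_biUnion, Finset.mem_insert, Finset.mem_erase, id]
    constructor
    · rintro ⟨W, rfl | ⟨-, -, hW⟩, he⟩
      · rcases Finset.mem_union.1 he with he | he
        exacts [⟨U, hU, he⟩, ⟨V, hV, he⟩]
      · exact ⟨W, hW, he⟩
    · rintro ⟨W, hW, he⟩
      by_cases h1 : W = U
      · exact ⟨_, Or.inl rfl, Finset.mem_union_left _ (h1 ▸ he)⟩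
      by_cases h2 : W = V
      · exact ⟨_, Or.inl rfl, Finset.mem_union_right _ (h2 ▸ he)⟩
      exact ⟨W, Or.inr ⟨h2, h1, hW⟩, he⟩
  · intro W hW
    rcases Finset.mem_insert.1 hW with rfl | hW
    · exact hext
    · exact hD1.extremal W (Finset.mem_of_mem_erase (Finset.mem_of_mem_erase hW))

theorem isSubtree_union {S U V : Finset (Edge n)} (hS : (toGraph S).IsAcyclic) (hU : U ⊆ S)
    (hV : V ⊆ S) (hU' : IsSubtree U) (hV' : IsSubtree V) {y : Fin (n + 1)} (hy : y ∈ verts U)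
    (hy' : y ∈ verts V) : IsSubtree (U ∪ V) := by
  refine ⟨hU'.1.mono Finset.subset_union_left, acyclic_mono (Finset.union_subset hU hV) hS, ?_⟩
  have key : ∀ u ∈ verts (U ∪ V), (toGraph (U ∪ V)).Reachable y u := by
    intro u hu
    rcases verts_union.1 hu with hu | hu
    · exact (hU'.2.2 y hy u hu).mono (toGraph_mono Finset.subset_union_left)
    · exact (hV'.2.2 y hy' u hu).mono (toGraph_mono Finset.subset_union_right)
  intro u hu v hv
  exact (key u hu).symm.trans (key v hv)

section decomposition

variable {S P : Finset (Edge n)} {D : Finset (Finset (Edge n))} {i j : Fin (n + 1)}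

/-- A connected graph edge-disjoint from the main path meets it in at most one vertex. -/
theorem eq_of_mem_main (hS : (toGraph S).IsAcyclic) (hPS : P ⊆ S) (hP : IsPathOn P i j)
    {U : Finset (Edge n)} (hU : U ⊆ S \ P) (hU' : IsSubtree U) {u v : Fin (n + 1)}
    (hu : u ∈ verts P) (hu' : u ∈ verts U) (hv : v ∈ verts P) (hv' : v ∈ verts U) : u = v :=
  eq_of_reachable_disjoint hS (hU.trans Finset.sdiff_subset) hPS
    (Finset.disjoint_of_subset_left hU Finset.sdiff_disjoint) (hU'.2.2 u hu' v hv')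
    (hP.reachable hu hv)

/-- A connected graph avoiding the main path lies on one side of each of its vertices. -/
theorem same_side (hN : Noncrossing S) (hPS : P ⊆ S) (hP : IsPathOn P i j) (hij : i ≠ j)
    (hi : IsLeast (verts S) i) {K : Finset (Edge n)} (hK : K ⊆ S)
    (hK' : IsSubtree K) (hKP : ∀ x ∈ verts K, x ∉ verts P) {v y z : Fin (n + 1)}
    (hv : v ∈ verts P) (hy : y ∈ verts K) (hz : z ∈ verts K) : v < y ↔ v < z := by
  have key : ∀ y ∈ verts K, ∀ z ∈ verts K, v < y → v < z := by
    intro y hy z hz hvy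
    by_contra hvz
    obtain ⟨e, he, h⟩ := exists_boundary_edge (hK'.2.2 y hy z hz) {x | v < x} hvy hvz
    simp only [Set.mem_ofPred_eq] at h
    have h1 : src e ≠ v := by rintro rfl; exact hKP _ (src_mem_verts he) hv
    have h2 := e.2
    have h3 : src e < v ∧ v < tgt e := by grind
    -- The edge e of K passes over v. The path from v to the least vertex i must leave the interval
    -- under e, and by noncrossing it can do so only through an end of e, which is off the path.
    have hi' := (hP.mem_verts_of_ne hij).1
    have hij' : i ≤ src e := hi.2 (src_mem_verts (hK he))
    obtain ⟨f, hf, h4⟩ := exists_boundary_edge (hP.reachable hv hi')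
      {x | src e < x ∧ x < tgt e} h3 (by simp only [Set.mem_ofPred_eq]; grind)
    simp only [Set.mem_ofPred_eq] at h4
    rcases h4 with ⟨h5, h6⟩ | ⟨h5, h6⟩
    · rcases hN.eq_end (hPS hf) (hK he) (Or.inl ⟨rfl, rfl⟩) h5.1 h5.2 h6 with h7 | h7
      · exact hKP _ (src_mem_verts he) (h7 ▸ tgt_mem_verts hf)
      · exact hKP _ (tgt_mem_verts he) (h7 ▸ tgt_mem_verts hf)
    · rcases hN.eq_end (hPS hf) (hK he) (Or.inr ⟨rfl, rfl⟩) h5.1 h5.2 h6 with h7 | h7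
      · exact hKP _ (src_mem_verts he) (h7 ▸ src_mem_verts hf)
      · exact hKP _ (tgt_mem_verts he) (h7 ▸ src_mem_verts hf)
  exact ⟨key y hy z hz, key z hz y hy⟩

/-- Distinct members of a minimal decomposition meet only on the main path. -/
theorem mem_main_of_mem_inter (hS : (toGraph S).IsAcyclic) (hN : Noncrossing S) (hPS : P ⊆ S)
    (hP : IsPathOn P i j) (hij : i ≠ j) (hi : IsLeast (verts S) i)
    (hD : IsMinDecomposition S P D) {U V : Finset (Edge n)} (hU : U ∈ D) (hV : V ∈ D)
    (hUV : U ≠ V) {y : Fin (n + 1)} (hy : y ∈ verts U) (hy' : y ∈ verts V) : y ∈ verts P := by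
  by_contra hyP
  have sub : ∀ W ∈ D, W ⊆ S := fun W hW => (hD.1.subset hW).trans Finset.sdiff_subset
  -- If U and V met at y off the path, their union could replace both. When U touches the path at v,
  -- V avoids the path, so all of V is on the same side of v as y, and v stays extremal in the
  -- union.
  have key : ∀ U ∈ D, ∀ V ∈ D, U ≠ V → y ∈ verts U → y ∈ verts V → ∀ v ∈ verts P, v ∈ verts U →
      IsLeast (verts (U ∪ V)) v ∨ IsGreatest (verts (U ∪ V)) v := by
    intro U hU V hV hUV hy hy' v hv hvU
    have hvy : v ≠ y := by rintro rfl; exact hyP hv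
    have hdisj := hD.1.disjoint U hU V hV hUV
    have hvV : v ∉ verts V := fun hvV => hvy <| eq_of_reachable_disjoint hS (sub U hU) (sub V hV)
      hdisj ((hD.1.isSubtree U hU).2.2 v hvU y hy) ((hD.1.isSubtree V hV).2.2 v hvV y hy')
    have hVP : ∀ x ∈ verts V, x ∉ verts P := by
      intro x hx hxP
      have : v = x := eq_of_mem_main hS hPS hP
        (Finset.union_subset (hD.1.subset hU) (hD.1.subset hV))
        (isSubtree_union hS (sub U hU) (sub V hV) (hD.1.isSubtree U hU) (hD.1.isSubtree V hV)
          hy hy') hv (verts_union.2 (Or.inl hvU)) hxP (verts_union.2 (Or.inr hx))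
      exact hvV (this ▸ hx)
    have side := fun z hz => same_side hN hPS hP hij hi (sub V hV) (hD.1.isSubtree V hV) hVP hv
      hy' (z := z) hz
    rcases hD.1.extremal U hU v ⟨hv, hvU⟩ with h | h
    · left
      refine ⟨verts_union.2 (Or.inl hvU), fun x hx => ?_⟩
      rcases verts_union.1 hx with hx | hx
      · exact h.2 hx
      · exact ((side x hx).1 (lt_of_le_of_ne (h.2 hy) hvy)).le
    · right
      refine ⟨verts_union.2 (Or.inl hvU), fun x hx => ?_⟩
      rcases verts_union.1 hx with hx | hx
      · exact h.2 hx
      · have : ¬ v < y := not_lt.2 (h.2 hy)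
        exact not_lt.1 fun h' => this ((side x hx).2 h')
  refine hD.not_mergeable hU hV hUV (isSubtree_union hS (sub U hU) (sub V hV)
    (hD.1.isSubtree U hU) (hD.1.isSubtree V hV) hy hy') ?_
  rintro v ⟨hv, hv'⟩
  rcases verts_union.1 hv' with h | h
  · exact key U hU V hV hUV hy hy' v hv h
  · rw [Finset.union_comm]
    exact key V hV U hU hUV.symm hy' hy v hv h

/-- At each vertex of the main path a minimal decomposition has at most one member on each side. -/
theorem eq_of_same_side (hS : (toGraph S).IsAcyclic) (hPS : P ⊆ S)
    (hP : IsPathOn P i j) (hD : IsMinDecomposition S P D) {U V : Finset (Edge n)} (hU : U ∈ D)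
    (hV : V ∈ D) {v : Fin (n + 1)} (hv : v ∈ verts P)
    (h : (IsLeast (verts U) v ∧ IsLeast (verts V) v) ∨
      (IsGreatest (verts U) v ∧ IsGreatest (verts V) v)) : U = V := by
  by_contra hUV
  have sub : ∀ W ∈ D, W ⊆ S := fun W hW => (hD.1.subset hW).trans Finset.sdiff_subset
  have hvU : v ∈ verts U := by rcases h with h | h <;> exact h.1.1
  have hvV : v ∈ verts V := by rcases h with h | h <;> exact h.2.1
  have hsub := isSubtree_union hS (sub U hU) (sub V hV) (hD.1.isSubtree U hU)
    (hD.1.isSubtree V hV) hvU hvV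
  refine hD.not_mergeable hU hV hUV hsub ?_
  rintro x ⟨hx, hx'⟩
  obtain rfl : v = x := eq_of_mem_main hS hPS hP
    (Finset.union_subset (hD.1.subset hU) (hD.1.subset hV)) hsub hv
    (verts_union.2 (Or.inl hvU)) hx hx'
  rcases h with h | h
  · left
    refine ⟨hx', fun y hy => ?_⟩
    rcases verts_union.1 hy with hy | hy
    exacts [h.1.2 hy, h.2.2 hy]
  · right
    refine ⟨hx', fun y hy => ?_⟩
    rcases verts_union.1 hy with hy | hy
    exacts [h.1.2 hy, h.2.2 hy]

/-- Each member of a minimal decomposition meets the main path. -/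
theorem exists_mem_main (hS : IsSubtree S) (hN : Noncrossing S) (hPS : P ⊆ S)
    (hP : IsPathOn P i j) (hij : i ≠ j) (hi : IsLeast (verts S) i)
    (hD : IsMinDecomposition S P D) {U : Finset (Edge n)} (hU : U ∈ D) :
    ∃ v ∈ verts P, v ∈ verts U := by
  by_contra! hno
  -- A member missing the path would share no vertex with the path or with other members,
  -- contradicting connectedness of S.
  have closed : ∀ e ∈ S, (src e ∈ verts U ∨ tgt e ∈ verts U) → e ∈ U := by
    intro e he h
    by_cases heP : e ∈ P
    · rcases h with h | h
      exacts [absurd h (hno _ (src_mem_verts heP)), absurd h (hno _ (tgt_mem_verts heP))]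
    have he' : e ∈ D.biUnion id := by rw [hD.1.union]; exact Finset.mem_sdiff.2 ⟨he, heP⟩
    obtain ⟨V, hV, heV⟩ := Finset.mem_biUnion.1 he'
    by_contra heU
    have hUV : U ≠ V := by rintro rfl; exact heU heV
    rcases h with h | h
    · exact hno _ (mem_main_of_mem_inter hS.2.1 hN hPS hP hij hi hD hU hV hUV h
        (src_mem_verts heV)) h
    · exact hno _ (mem_main_of_mem_inter hS.2.1 hN hPS hP hij hi hD hU hV hUV h
        (tgt_mem_verts heV)) h
  obtain ⟨e, he⟩ := (hD.1.isSubtree U hU).1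
  have heS : e ∈ S := Finset.sdiff_subset (hD.1.subset hU he)
  have hi' := (hP.mem_verts_of_ne hij).1
  obtain ⟨f, hf, h⟩ := exists_boundary_edge (hS.2.2 _ (src_mem_verts heS) i hi.1) (verts U)
    (src_mem_verts he) (hno i hi')
  rcases h with h | h
  · exact h.2 (tgt_mem_verts (closed f hf (Or.inl h.1)))
  · exact h.2 (src_mem_verts (closed f hf (Or.inr h.1)))

/-- An edge with an endpoint off the main path passes over no vertex of the main path. -/
theorem no_edge_over_main (hN : Noncrossing S) (hPS : P ⊆ S)
    (hP : IsPathOn P i j) (hi : IsLeast (verts S) i)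
    (hj : IsGreatest (verts S) j) {f : Edge n} (hf : f ∈ S) {w : Fin (n + 1)} (hw : w ∈ verts P)
    (h1 : src f < w) (h2 : w < tgt f) (h3 : src f ∉ verts P ∨ tgt f ∉ verts P) : False := by
  classical
  obtain ⟨p, hp, hpe⟩ := hP
  have hwp := IsPathOn.mem_support hpe hw
  have hi' : i ≤ src f := hi.2 (src_mem_verts hf)
  have hj' : tgt f ≤ j := hj.2 (tgt_mem_verts hf)
  have sup : ∀ {a b : Fin (n + 1)} (q : (toGraph P).Walk a b), src f ∉ q.support →
      tgt f ∉ q.support → src f < a → a < tgt f → (b < src f ∨ tgt f < b) → False := by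
    intro a b q hq1 hq2 ha1 ha2 hb
    obtain ⟨d, hd, h5, h6⟩ := q.exists_boundary_dart {x | src f < x ∧ x < tgt f} ⟨ha1, ha2⟩
      (by simp only [Set.mem_ofPred_eq]; grind)
    obtain ⟨e, he, h7⟩ := toGraph_adj.1 d.adj
    have h8 := q.dart_snd_mem_support_of_mem_darts hd
    rcases hN.eq_end (hPS he) hf h7 h5.1 h5.2 h6 with h9 | h9
    · exact hq1 (h9 ▸ h8)
    · exact hq2 (h9 ▸ h8)
  have memP : ∀ x ∈ p.support, x ∈ verts P := by
    intro x hx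
    rcases eq_or_ne x w with rfl | hne
    · exact hw
    · have hr : (toGraph P).Reachable x w :=
        (Walk.reachable (p.takeUntil x hx)).symm.trans (Walk.reachable (p.takeUntil w hwp))
      obtain ⟨e, he, h⟩ := exists_boundary_edge hr {x} rfl (by simpa using hne.symm)
      simp only [Set.mem_singleton_iff] at h
      exact ⟨e, he, by tauto⟩
  -- The two halves of the path share only w. One end of f is off the path altogether and the other
  -- misses one half; that half runs from under f to i or j without using an end of f, which
  -- noncrossing forbids.
  have split : ∀ x, x ≠ w → x ∉ (p.takeUntil w hwp).support ∨ x ∉ (p.dropUntil w hwp).support := by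
    intro x hxw
    by_contra! h
    have h4 := hp.support_nodup
    rw [← p.take_spec hwp, Walk.support_append, List.nodup_append] at h4
    refine h4.2.2 x h.1 x ?_ rfl
    have := h.2
    rw [Walk.mem_support_iff] at this
    exact this.resolve_left hxw
  have hT := fun x => p.support_takeUntil_subset_support hwp (a := x)
  have hDr := fun x => p.support_dropUntil_subset_support hwp (a := x)
  have take_case : src f ∉ (p.takeUntil w hwp).support → tgt f ∉ (p.takeUntil w hwp).support →
      False := by
    intro a b
    refine sup (p.takeUntil w hwp).reverse (by simpa using a) (by simpa using b) h1 h2 ?_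
    left
    refine lt_of_le_of_ne hi' ?_
    rintro rfl
    exact a (Walk.start_mem_support _)
  have drop_case : src f ∉ (p.dropUntil w hwp).support → tgt f ∉ (p.dropUntil w hwp).support →
      False := by
    intro a b
    refine sup (p.dropUntil w hwp) a b h1 h2 ?_
    right
    refine lt_of_le_of_ne hj' ?_
    intro h
    rw [h] at b
    exact b (Walk.end_mem_support _)
  rcases h3 with h3 | h3
  · have a1 := fun h => h3 (memP _ (hT _ h))
    have a2 := fun h => h3 (memP _ (hDr _ h))
    rcases split (tgt f) h2.ne' with h | h
    exacts [take_case a1 h, drop_case a2 h]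
  · have a1 := fun h => h3 (memP _ (hT _ h))
    have a2 := fun h => h3 (memP _ (hDr _ h))
    rcases split (src f) h1.ne with h | h
    exacts [take_case h a1, drop_case h a2]

end decomposition

/-! ### Increasing paths and coverings -/

/-- There is a weakly increasing path of `T` from `a` to `b`. -/
abbrev Up (T : Finset (Edge n)) (a b : Fin (n + 1)) : Prop :=
  Relation.ReflTransGen (fun a b => ∃ f ∈ T, src f = a ∧ tgt f = b) a b

theorem Up.mono {S T : Finset (Edge n)} (h : S ⊆ T) {a b : Fin (n + 1)} (hab : Up S a b) :
    Up T a b :=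
  hab.lift id fun _ _ ⟨f, hf, h'⟩ => ⟨f, h hf, h'⟩

theorem Up.single {T : Finset (Edge n)} {e : Edge n} (he : e ∈ T) : Up T (src e) (tgt e) :=
  Relation.ReflTransGen.single ⟨e, he, rfl, rfl⟩

theorem Up.le {T : Finset (Edge n)} {a b : Fin (n + 1)} (h : Up T a b) : a ≤ b := by
  induction h with
  | refl => exact le_rfl
  | tail _ h ih =>
    obtain ⟨e, -, rfl, rfl⟩ := h
    exact ih.trans e.2.le

theorem Up.reachable {T : Finset (Edge n)} {a b : Fin (n + 1)} (h : Up T a b) :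
    (toGraph T).Reachable a b := by
  induction h with
  | refl => exact Reachable.refl _
  | tail _ h ih =>
    obtain ⟨e, he, rfl, rfl⟩ := h
    exact ih.trans (reachable_of_mem he)

theorem mem_closure {T : Finset (Edge n)} {e : Edge n} :
    e ∈ closure T ↔ Up T (src e) (tgt e) := by
  classical
  unfold closure
  simp only [Finset.mem_filter, Finset.mem_univ, true_and]
  refine ⟨Relation.TransGen.to_reflTransGen, fun h => ?_⟩
  rcases Relation.reflTransGen_iff_eq_or_transGen.1 h with h | h
  · exact absurd h e.2.ne'
  · exact h

theorem Up.erase_or {S : Finset (Edge n)} {a b : Fin (n + 1)} (t : Edge n) (h : Up S a b) :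
    Up (S.erase t) a b ∨ (Up S a (src t) ∧ Up S (tgt t) b) := by
  induction h with
  | refl => exact Or.inl .refl
  | tail hab h ih =>
    obtain ⟨e, he, rfl, rfl⟩ := h
    rcases ih with ih | ih
    · by_cases het : e = t
      · subst het
        exact Or.inr ⟨hab, .refl⟩
      · exact Or.inl (ih.trans (Up.single (Finset.mem_erase.2 ⟨het, he⟩)))
    · exact Or.inr ⟨ih.1, ih.2.trans (Up.single he)⟩

/-- An increasing path of a forest runs through all edges of any path with the same endpoints. -/
theorem Up.split {S P : Finset (Edge n)} (hS : (toGraph S).IsAcyclic) (hPS : P ⊆ S)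
    {i j : Fin (n + 1)} (hP : IsPathOn P i j) (h : Up S i j) {t : Edge n} (ht : t ∈ P) :
    Up S i (src t) ∧ Up S (tgt t) j := by
  refine (h.erase_or t).resolve_left fun h' => ?_
  obtain ⟨p, hp, hpe⟩ := hP
  obtain ⟨q, hq⟩ := h'.reachable.exists_isPath
  have hp' := (Walk.isPath_mapLe (toGraph_mono hPS)).2 hp
  have hq' := (Walk.isPath_mapLe (toGraph_mono (Finset.erase_subset t S))).2 hq
  -- Paths in a forest are unique, so the path avoiding t would have the same edges as P, among them
  -- t.
  have := (hS.subsingleton_path i j).elim ⟨_, hp'⟩ ⟨_, hq'⟩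
  have hpq := congrArg (fun r : (toGraph S).Path i j => r.1.edges) this
  simp only [Walk.edges_mapLe_eq_edges] at hpq
  have h1 := hpe t ht
  rw [hpq] at h1
  obtain ⟨e, he, h2⟩ := sym2_mem_edgeSet.1 (q.edges_subset_edgeSet h1)
  exact (Finset.mem_erase.1 he).1 (sym2_injective h2)

/-- Every edge of `T` lies on an increasing path of `T` joining the endpoints of an edge of `F`. -/
def Covers (T F : Finset (Edge n)) : Prop :=
  ∀ t ∈ T, ∃ f ∈ F, Up T (src f) (src t) ∧ Up T (tgt t) (tgt f)

/-! ### The trees occurring in the recursive definition of pseudo-components -/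

/-- `S` is a subtree of `T` with minimal vertex `i` and maximal vertex `j`, which is attached to the
rest of `T` only at `i`, under all other edges from `i`, or only at `j`, under all other edges to
`j`. -/
structure IsSegment (T S : Finset (Edge n)) (i j : Fin (n + 1)) : Prop where
  subset : S ⊆ T
  isSubtree : IsSubtree S
  least : IsLeast (verts S) i
  greatest : IsGreatest (verts S) j
  attached :
    (∀ e ∈ T, e ∉ S → (tgt e ∈ verts S → tgt e = i) ∧
      (src e ∈ verts S → src e = i ∧ j < tgt e)) ∨
    (∀ e ∈ T, e ∉ S → (src e ∈ verts S → src e = j) ∧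
      (tgt e ∈ verts S → tgt e = j ∧ src e < i))

theorem IsSegment.lt {T S : Finset (Edge n)} {i j : Fin (n + 1)} (h : IsSegment T S i j) :
    i < j := extremal_lt h.isSubtree.1 h.least h.greatest

theorem IsMainPath.isPathOn {S P : Finset (Edge n)} {i j : Fin (n + 1)} (hP : IsMainPath S P)
    (hi : IsLeast (verts S) i) (hj : IsGreatest (verts S) j) : IsPathOn P i j := by
  obtain ⟨-, i', j', hi', hj', h⟩ := hP
  rwa [hi.unique hi', hj.unique hj']

/-- A member U meets the main path in a single vertex v, which is extremal in U, and edges outside U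
touch U only at v. What remains is that an outside edge leaving v on the side of U is longer than U.
This is the invariant that makes the recursive definition of pseudo-components usable. -/
theorem IsSegment.of_mem {T S P : Finset (Edge n)} {i j : Fin (n + 1)}
    {D : Finset (Finset (Edge n))} (hT : (toGraph T).IsAcyclic) (hN : Noncrossing T)
    (h : IsSegment T S i j) (hP : IsMainPath S P) (hD : IsMinDecomposition S P D)
    {U : Finset (Edge n)} (hU : U ∈ D) : ∃ i' j', IsSegment T U i' j' := by
  have hPS := hP.1
  have hPo := hP.isPathOn h.least h.greatest
  have hS := acyclic_mono h.subset hT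
  have hNS := hN.mono h.subset
  have hij := h.lt.ne
  have hUt := hD.1.isSubtree U hU
  have hUS : U ⊆ S := (hD.1.subset hU).trans Finset.sdiff_subset
  obtain ⟨v, hv, hvU⟩ := exists_mem_main h.isSubtree hNS hPS hPo hij h.least hD hU
  have uniq : ∀ y, y ∈ verts P → y ∈ verts U → y = v := fun y hy hy' =>
    eq_of_mem_main hS hPS hPo (hD.1.subset hU) hUt hy hy' hv hvU
  obtain ⟨hiP, hjP⟩ := hPo.mem_verts_of_ne hij
  have member : ∀ e ∈ S, e ∉ P → ∃ V ∈ D, e ∈ V := by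
    intro e he heP
    have he' : e ∈ D.biUnion id := by rw [hD.1.union]; exact Finset.mem_sdiff.2 ⟨he, heP⟩
    exact Finset.mem_biUnion.1 he'
  have touch : ∀ e ∈ T, e ∉ U → ∀ y, (src e = y ∨ tgt e = y) → y ∈ verts U → y = v := by
    intro e he heU y hy hyU
    by_cases heS : e ∈ S
    · by_contra hyv
      have hyP : y ∉ verts P := fun h => hyv (uniq y h hyU)
      have heP : e ∉ P := fun h => hyP ⟨e, h, hy⟩
      obtain ⟨V, hV, heV⟩ := member e heS heP
      exact hyP (mem_main_of_mem_inter hS hNS hPS hPo hij h.least hD hU hV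
        (by rintro rfl; exact heU heV) hyU ⟨e, heV, hy⟩)
    · have hyS := verts_mono hUS hyU
      have : y = i ∨ y = j := by
        rcases h.attached with ha | ha
        · have := ha e he heS
          rcases hy with rfl | rfl
          exacts [Or.inl (this.2 hyS).1, Or.inl (this.1 hyS)]
        · have := ha e he heS
          rcases hy with rfl | rfl
          exacts [Or.inr (this.1 hyS), Or.inr (this.2 hyS).1]
      rcases this with rfl | rfl
      exacts [uniq _ hiP hyU, uniq _ hjP hyU]
  have notboth : ∀ f ∈ U, src f ∉ verts P ∨ tgt f ∉ verts P := by
    intro f hf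
    by_contra! hb
    exact f.2.ne ((uniq _ hb.1 (src_mem_verts hf)).trans (uniq _ hb.2 (tgt_mem_verts hf)).symm)
  obtain ⟨a, b, ha, hb⟩ := hUt.exists_extremal
  rcases hD.1.extremal U hU v ⟨hv, hvU⟩ with hmin | hmax
  · refine ⟨v, b, h.subset.trans' hUS, hUt, hmin, hb, Or.inl fun e he heU => ?_⟩
    refine ⟨fun h' => touch e he heU _ (Or.inr rfl) h', fun h' => ?_⟩
    have hsv := touch e he heU _ (Or.inl rfl) h'
    refine ⟨hsv, ?_⟩
    by_cases heS : e ∈ S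
    -- If a path edge from v ended below b, some edge of U would pass over its target, a vertex of
    -- the path. If e lies in another member, that member also has v as least vertex and must equal
    -- U. Edges outside S are handled by the attachment of S.
    · by_cases heP : e ∈ P
      · by_contra hlt
        have hwP := tgt_mem_verts heP
        have hwU : tgt e ∉ verts U := fun h'' => e.2.ne (hsv.trans (uniq _ hwP h'').symm)
        have hlt' : ¬ b ≤ tgt e := fun hle =>
          hwU (le_antisymm hle (not_lt.1 hlt) ▸ hb.1)
        have hve : v ≤ tgt e := hsv ▸ e.2.le
        obtain ⟨f, hf, hfb⟩ := exists_boundary_edge (hUt.2.2 v hvU b hb.1) {x | x ≤ tgt e} hve hlt'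
        simp only [Set.mem_ofPred_eq] at hfb
        have hf2 := f.2
        have hne : src f ≠ tgt e := fun h'' => hwU (h'' ▸ src_mem_verts hf)
        exact no_edge_over_main hNS hPS hPo h.least h.greatest (hUS hf) hwP (by grind) (by grind)
          (notboth f hf)
      · obtain ⟨V, hV, heV⟩ := member e heS heP
        exfalso
        apply heU
        have hVv : v ∈ verts V := hsv ▸ src_mem_verts heV
        have : IsLeast (verts V) v := (hD.1.extremal V hV v ⟨hv, hVv⟩).resolve_right fun h'' =>
          absurd (h''.2 (tgt_mem_verts heV)) (not_le.2 (hsv ▸ e.2))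
        rw [eq_of_same_side hS hPS hPo hD hU hV hv (Or.inl ⟨hmin, this⟩)]
        exact heV
    · have hbj : b ≤ j := h.greatest.2 (verts_mono hUS hb.1)
      rcases h.attached with hatt | hatt
      · exact hbj.trans_lt ((hatt e he heS).2 (verts_mono hUS h')).2
      · have h1 := (hatt e he heS).1 (verts_mono hUS h')
        have h2 := extremal_lt hUt.1 hmin hb
        exact absurd (hbj.trans_eq (h1.symm.trans hsv)) (not_le.2 h2)
  · refine ⟨a, v, h.subset.trans' hUS, hUt, ha, hmax, Or.inr fun e he heU => ?_⟩
    refine ⟨fun h' => touch e he heU _ (Or.inl rfl) h', fun h' => ?_⟩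
    have hsv := touch e he heU _ (Or.inr rfl) h'
    refine ⟨hsv, ?_⟩
    by_cases heS : e ∈ S
    · by_cases heP : e ∈ P
      · by_contra hlt
        have hwP := src_mem_verts heP
        have hwU : src e ∉ verts U := fun h'' => e.2.ne' (hsv.trans (uniq _ hwP h'').symm)
        have hlt' : ¬ src e ≤ a := fun hle =>
          hwU (le_antisymm hle (not_lt.1 hlt) ▸ ha.1)
        have hve : src e ≤ v := hsv ▸ e.2.le
        obtain ⟨f, hf, hfb⟩ := exists_boundary_edge (hUt.2.2 v hvU a ha.1) {x | src e ≤ x} hve hlt'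
        simp only [Set.mem_ofPred_eq] at hfb
        have hf2 := f.2
        have hne : tgt f ≠ src e := fun h'' => hwU (h'' ▸ tgt_mem_verts hf)
        exact no_edge_over_main hNS hPS hPo h.least h.greatest (hUS hf) hwP (by grind) (by grind)
          (notboth f hf)
      · obtain ⟨V, hV, heV⟩ := member e heS heP
        exfalso
        apply heU
        have hVv : v ∈ verts V := hsv ▸ tgt_mem_verts heV
        have : IsGreatest (verts V) v := (hD.1.extremal V hV v ⟨hv, hVv⟩).resolve_left fun h'' =>
          absurd (h''.2 (src_mem_verts heV)) (not_le.2 (hsv ▸ e.2))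
        rw [eq_of_same_side hS hPS hPo hD hU hV hv (Or.inr ⟨hmax, this⟩)]
        exact heV
    · have hbj : i ≤ a := h.least.2 (verts_mono hUS ha.1)
      rcases h.attached with hatt | hatt
      · have h1 := (hatt e he heS).1 (verts_mono hUS h')
        have h2 := extremal_lt hUt.1 ha hmax
        exact absurd ((hsv.symm.trans h1).le.trans hbj) (not_le.2 h2)
      · exact ((hatt e he heS).2 (verts_mono hUS h')).2.trans_le hbj

theorem IsPseudoComponent.exists_segment {T S Q : Finset (Edge n)} (hT : (toGraph T).IsAcyclic)
    (hN : Noncrossing T) (hQ : IsPseudoComponent S Q) :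
    ∀ i j, IsSegment T S i j → ∃ U i' j', IsSegment T U i' j' ∧ IsMainPath U Q := by
  induction hQ with
  | path hP => exact fun i j h => ⟨_, i, j, h, hP⟩
  | step hP hD hS _ ih =>
    intro i j h
    obtain ⟨i', j', h'⟩ := h.of_mem hT hN hP hD hS
    exact ih i' j' h'

/-! ### The endpoints of a path are determined by its edges -/

theorem IsPathOn.symm {P : Finset (Edge n)} {i j : Fin (n + 1)} (h : IsPathOn P i j) :
    IsPathOn P j i := by
  obtain ⟨p, hp, hpe⟩ := h
  exact ⟨p.reverse, hp.reverse, fun e he => by simpa using hpe e he⟩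

theorem IsPathOn.eq_of_mem_start {P : Finset (Edge n)} {i j : Fin (n + 1)} (h : IsPathOn P i j)
    {e f : Edge n} (he : e ∈ P) (hf : f ∈ P) (hie : i ∈ s(src e, tgt e))
    (hif : i ∈ s(src f, tgt f)) : e = f := by
  obtain ⟨p, hp, hpe⟩ := h
  cases p with
  | nil => simpa using hpe e he
  | cons hadj q =>
    rename_i w
    rw [Walk.cons_isPath_iff] at hp
    have key : ∀ e ∈ P, i ∈ s(src e, tgt e) → s(src e, tgt e) = s(i, w) := by
      intro e he hie
      have h1 := hpe e he
      rw [Walk.edges_cons, List.mem_cons] at h1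
      refine h1.resolve_right fun h2 => hp.2 ?_
      exact q.mem_support_of_mem_edges h2 hie
    exact sym2_injective ((key e he hie).trans (key f hf hif).symm)

theorem exists_mem_edges_of_ne {V : Type*} {G : SimpleGraph V} {a b : V} (p : G.Walk a b)
    (h : a ≠ b) : ∃ z ∈ p.edges, a ∈ z := by
  cases p with
  | nil => exact absurd rfl h
  | cons hadj q => exact ⟨_, List.mem_cons_self, Sym2.mem_mk_left _ _⟩

theorem IsPathOn.exists_ne_of_inner {P : Finset (Edge n)} {i j x : Fin (n + 1)}
    (h : IsPathOn P i j) (hx : x ∈ verts P) (hxi : x ≠ i) (hxj : x ≠ j) :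
    ∃ e ∈ P, ∃ f ∈ P, e ≠ f ∧ x ∈ s(src e, tgt e) ∧ x ∈ s(src f, tgt f) := by
  classical
  obtain ⟨p, hp, hpe⟩ := h
  have hxp := IsPathOn.mem_support hpe hx
  obtain ⟨y, hy, hxy⟩ := exists_mem_edges_of_ne (p.takeUntil x hxp).reverse hxi
  obtain ⟨z, hz, hxz⟩ := exists_mem_edges_of_ne (p.dropUntil x hxp) hxj
  rw [Walk.edges_reverse, List.mem_reverse] at hy
  have hnd := hp.isTrail.edges_nodup
  rw [← p.take_spec hxp, Walk.edges_append, List.nodup_append] at hnd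
  obtain ⟨e, he, rfl⟩ := sym2_mem_edgeSet.1 (Walk.edges_subset_edgeSet _ hy)
  obtain ⟨f, hf, rfl⟩ := sym2_mem_edgeSet.1 (Walk.edges_subset_edgeSet _ hz)
  refine ⟨e, he, f, hf, ?_, hxy, hxz⟩
  rintro rfl
  exact hnd.2.2 _ hy _ hz rfl

/-- An interior vertex of a path lies on two of its edges and an end on only one. This identifies
the interval named by a pseudo-component with the extremal vertices of the segment it comes from. -/
theorem IsPathOn.endpoints_eq {P : Finset (Edge n)} {i j i' j' : Fin (n + 1)}
    (h : IsPathOn P i j) (h' : IsPathOn P i' j') (hij : i < j) (hij' : i' < j') :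
    i = i' ∧ j = j' := by
  obtain ⟨hi, hj⟩ := h.mem_verts_of_ne hij.ne
  have h1 : i = i' ∨ i = j' := by
    by_contra! hne
    obtain ⟨e, he, f, hf, hef, h1, h2⟩ := h'.exists_ne_of_inner hi hne.1 hne.2
    exact hef (h.eq_of_mem_start he hf h1 h2)
  have h2 : j = i' ∨ j = j' := by
    by_contra! hne
    obtain ⟨e, he, f, hf, hef, h1, h2⟩ := h'.exists_ne_of_inner hj hne.1 hne.2
    exact hef (h.symm.eq_of_mem_start he hf h1 h2)
  grind

/-! ### Admissible forests are those covering `T` -/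

/-- Let b be the largest target of an F-edge from i, with b = i if there is none. If b < j, some
edge t of the path Q has its source at or before b and its target beyond b, and t is covered by an
edge f of F. Either f starts at i, against the choice of b, or f starts after i and crosses or
continues the edge (i,b). -/
theorem exists_left_edge {T S Q F : Finset (Edge n)} {i j : Fin (n + 1)} (h : IsSegment T S i j)
    (hQS : Q ⊆ S) (hQ : IsPathOn Q i j) (hFN : Noncrossing F) (hFA : Alternating F)
    (hC : Covers T F) (hi : ∀ e ∈ T, tgt e ≠ i) : ∃ e ∈ F, src e = i ∧ j ≤ tgt e := by
  classical
  by_contra! hno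
  obtain ⟨b, hb, hmax⟩ := Finset.exists_max_image
    (insert i ((F.filter fun e => src e = i).image tgt)) id ⟨i, by simp⟩
  simp only [id, Finset.mem_insert, Finset.mem_image, Finset.mem_filter] at hb hmax
  have hbj : b < j := by
    rcases hb with rfl | ⟨e, ⟨he, hei⟩, rfl⟩
    exacts [h.lt, hno e he hei]
  have hib : i ≤ b := hmax i (Or.inl rfl)
  obtain ⟨hiQ, hjQ⟩ := hQ.mem_verts_of_ne h.lt.ne
  obtain ⟨t, ht, htb⟩ := exists_boundary_edge (hQ.reachable hiQ hjQ) {x | x ≤ b} hib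
    (by simpa using hbj)
  simp only [Set.mem_ofPred_eq] at htb
  have ht2 := t.2
  have hu : src t ≤ b ∧ b < tgt t := by grind
  obtain ⟨f, hf, hf1, hf2⟩ := hC t (h.subset (hQS ht))
  -- Followed backwards, an increasing path that is inside S before j cannot leave S: no edge of T
  -- ends at i, and an attachment at j is excluded by u < j.
  have claim : ∀ u, Up T (src f) u → u ∈ verts S → u < j → i ≤ src f := by
    intro u hu
    induction hu with
    | refl => exact fun hu _ => h.least.2 hu
    | tail _ he ih =>
      obtain ⟨e, he, rfl, rfl⟩ := he
      intro hz hzj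
      have heS : e ∈ S := by
        by_contra heS
        rcases h.attached with ha | ha
        · exact hi e he ((ha e he heS).1 hz)
        · exact hzj.ne ((ha e he heS).2 hz).1
      exact ih (src_mem_verts heS) (e.2.trans hzj)
  have hif := claim _ hf1 (src_mem_verts (hQS ht)) (hu.1.trans_lt hbj)
  have h1 := hf1.le
  have h2 := hf2.le
  rcases hif.eq_or_lt with h3 | h3
  · have := hmax (tgt f) (Or.inr ⟨f, ⟨hf, h3.symm⟩, rfl⟩)
    exact absurd (hu.2.trans_le h2) (not_lt.2 this)
  · rcases hb with rfl | ⟨e, ⟨he, hei⟩, rfl⟩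
    · exact absurd (h1.trans hu.1) (not_le.2 h3)
    · have := hFN e he f hf
      have := hFA e he f hf
      grind

theorem exists_right_edge {T S Q F : Finset (Edge n)} {i j : Fin (n + 1)} (h : IsSegment T S i j)
    (hQS : Q ⊆ S) (hQ : IsPathOn Q i j) (hFN : Noncrossing F) (hFA : Alternating F)
    (hC : Covers T F) (hj : ∀ e ∈ T, src e ≠ j) : ∃ e ∈ F, src e ≤ i ∧ tgt e = j := by
  classical
  by_contra! hno
  obtain ⟨b, hb, hmin⟩ := Finset.exists_min_image
    (insert j ((F.filter fun e => tgt e = j).image src)) id ⟨j, by simp⟩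
  simp only [id, Finset.mem_insert, Finset.mem_image, Finset.mem_filter] at hb hmin
  have hib : i < b := by
    rcases hb with rfl | ⟨e, ⟨he, hej⟩, rfl⟩
    · exact h.lt
    · exact not_le.1 fun hle => hno e he hle hej
  have hbj : b ≤ j := hmin j (Or.inl rfl)
  obtain ⟨hiQ, hjQ⟩ := hQ.mem_verts_of_ne h.lt.ne
  obtain ⟨t, ht, htb⟩ := exists_boundary_edge (hQ.reachable hjQ hiQ) {x | b ≤ x} hbj
    (by simpa using hib)
  simp only [Set.mem_ofPred_eq] at htb
  have ht2 := t.2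
  have hu : src t < b ∧ b ≤ tgt t := by grind
  obtain ⟨f, hf, hf1, hf2⟩ := hC t (h.subset (hQS ht))
  have claim : ∀ u, Up T u (tgt f) → u ∈ verts S → i < u → tgt f ≤ j := by
    intro u hu
    induction hu using Relation.ReflTransGen.head_induction_on with
    | refl => exact fun hu _ => h.greatest.2 hu
    | head he _ ih =>
      obtain ⟨e, he, rfl, rfl⟩ := he
      intro hz hzj
      have heS : e ∈ S := by
        by_contra heS
        rcases h.attached with ha | ha
        · exact hzj.ne' ((ha e he heS).2 hz).1
        · exact hj e he ((ha e he heS).1 hz)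
      exact ih (tgt_mem_verts heS) (hzj.trans e.2)
  have hif := claim _ hf2 (tgt_mem_verts (hQS ht)) (hib.trans_le hu.2)
  have h1 := hf1.le
  have h2 := hf2.le
  rcases hif.eq_or_lt with h3 | h3
  · have := hmin (src f) (Or.inr ⟨f, ⟨hf, h3⟩, rfl⟩)
    exact absurd (h1.trans_lt hu.1) (not_lt.2 this)
  · rcases hb with rfl | ⟨e, ⟨he, hei⟩, rfl⟩
    · exact absurd (hu.2.trans h2) (not_le.2 h3)
    · have := hFN f hf e he
      have := hFA f hf e he
      grind

theorem IsSpanningTree.mem_verts {T : Finset (Edge n)} (hn : 1 ≤ n) (hT : IsSpanningTree T)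
    (v : Fin (n + 1)) : v ∈ verts T := by
  have : ∃ w : Fin (n + 1), w ≠ v := by
    have : Nontrivial (Fin (n + 1)) := Fin.nontrivial_iff_two_le.2 (by omega)
    exact exists_ne v
  obtain ⟨w, hw⟩ := this
  obtain ⟨e, he, h⟩ := exists_boundary_edge (hT.connected v w) {v} rfl (by simpa using hw)
  simp only [Set.mem_singleton_iff] at h
  exact ⟨e, he, by tauto⟩

theorem IsSpanningTree.isSegment {T : Finset (Edge n)} (hn : 1 ≤ n) (hT : IsSpanningTree T) :
    IsSegment T T 0 (Fin.last n) where
  subset := subset_rfl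
  isSubtree := by
    obtain ⟨e, he, -⟩ := hT.mem_verts hn 0
    exact ⟨⟨e, he⟩, hT.isAcyclic, fun u _ v _ => hT.connected u v⟩
  least := ⟨hT.mem_verts hn 0, fun x _ => Fin.zero_le x⟩
  greatest := ⟨hT.mem_verts hn _, fun x _ => Fin.le_last x⟩
  attached := Or.inl fun e he he' => absurd he he'

theorem IsAdmissible.of_covers {T F : Finset (Edge n)} (hn : 1 ≤ n) (hT : IsSpanningTree T)
    (hN : Noncrossing T) (hF : IsNCASpanningForest T F) (hC : Covers T F) : IsAdmissible T F := by
  have hseg := hT.isSegment hn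
  have pc : ∀ Q i j, i < j → IsPseudoComponent T Q → IsPathOn Q i j →
      ∃ U, IsSegment T U i j ∧ Q ⊆ U := by
    intro Q i j hij hQ hQij
    obtain ⟨U, i', j', hU, hQU⟩ := hQ.exists_segment hT.isAcyclic hN _ _ hseg
    obtain ⟨rfl, rfl⟩ := hQij.endpoints_eq (hQU.isPathOn hU.least hU.greatest) hij hU.lt
    exact ⟨U, hU, hQU.1⟩
  refine ⟨hF, ?_, ?_, ?_⟩
  · obtain ⟨P, hP⟩ := exists_isMainPath hseg.isSubtree
    -- The edge (1, n+1) is the left condition for the main path of T, as no edge ends at the least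
    -- vertex.
    obtain ⟨e, he, h1, h2⟩ := exists_left_edge hseg hP.1
      (hP.isPathOn hseg.least hseg.greatest) hF.2.2.1 hF.2.2.2 hC
      (fun e _ h => absurd e.2 (by rw [show e.1.2 = 0 from h]; exact not_lt.2 (Fin.zero_le _)))
    exact ⟨e, he, h1, le_antisymm (Fin.le_last _) h2⟩
  · rintro i j ⟨hij, ⟨Q, hQ, hQij⟩, hj⟩
    obtain ⟨U, hU, hQU⟩ := pc Q i j hij hQ hQij
    exact exists_right_edge hU hQU hQij hF.2.2.1 hF.2.2.2 hC hj
  · rintro i j ⟨hij, ⟨Q, hQ, hQij⟩, hi⟩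
    obtain ⟨U, hU, hQU⟩ := pc Q i j hij hQ hQij
    exact exists_left_edge hU hQU hQij hF.2.2.1 hF.2.2.2 hC hi

/-- Induction on the size of the segment S. If t is on the main path of S and S is attached at i, no
edge starts at j, so that path is a right pseudo-component and admissibility supplies an edge of F
over it; attachment at j is the mirror image. Otherwise t belongs to a smaller segment of the
decomposition. -/
theorem IsSegment.covered {T F : Finset (Edge n)} (hT : (toGraph T).IsAcyclic)
    (hN : Noncrossing T) (hF : IsAdmissible T F) :
    ∀ (k : ℕ) (S : Finset (Edge n)) (i j : Fin (n + 1)), S.card = k → IsSegment T S i j →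
      (∀ Q, IsPseudoComponent S Q → IsPseudoComponent T Q) →
      ∀ t ∈ S, ∃ f ∈ F, Up T (src f) (src t) ∧ Up T (tgt t) (tgt f) := by
  intro k
  induction k using Nat.strong_induction_on with
  | _ k ih =>
    intro S i j hk h hpc t ht
    obtain ⟨P, hP⟩ := exists_isMainPath h.isSubtree
    have hPo := hP.isPathOn h.least h.greatest
    have hS := acyclic_mono h.subset hT
    have hcl := hF.forest.1
    by_cases htP : t ∈ P
    · rcases h.attached with ha | ha
      · have hj : ∀ e ∈ T, src e ≠ j := by
          intro e he hej
          by_cases heS : e ∈ S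
          · exact absurd (h.greatest.2 (tgt_mem_verts heS)) (not_le.2 (hej ▸ e.2))
          · have := ((ha e he heS).2 (hej ▸ h.greatest.1)).1
            exact h.lt.ne (this.symm.trans hej)
        obtain ⟨f, hf, h1, h2⟩ := hF.right i j ⟨h.lt, ⟨P, hpc P (.path hP), hPo⟩, hj⟩
        have hup : Up T (src f) j := h2 ▸ mem_closure.1 (hcl hf)
        -- The increasing path represented by f can enter S only at i, so it contains an increasing
        -- path of S from i to j, and by `Up.split` the edge t lies on it.
        have claim : ∀ y, Up T (src f) y → y ∈ verts S → Up T (src f) i ∧ Up S i y := by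
          intro y hy
          induction hy with
          | refl =>
            intro hy
            rw [le_antisymm h1 (h.least.2 hy)]
            exact ⟨.refl, .refl⟩
          | tail hy he ih' =>
            obtain ⟨e, he, rfl, rfl⟩ := he
            intro hz
            by_cases heS : e ∈ S
            · obtain ⟨h3, h4⟩ := ih' (src_mem_verts heS)
              exact ⟨h3, h4.trans (Up.single heS)⟩
            · have := (ha e he heS).1 hz
              exact ⟨this ▸ hy.trans (Up.single he), this ▸ .refl⟩
        obtain ⟨h3, h4⟩ := claim j hup h.greatest.1
        obtain ⟨h5, h6⟩ := h4.split hS hP.1 hPo htP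
        exact ⟨f, hf, h3.trans (h5.mono h.subset), h2 ▸ h6.mono h.subset⟩
      · have hi : ∀ e ∈ T, tgt e ≠ i := by
          intro e he hei
          by_cases heS : e ∈ S
          · exact absurd (h.least.2 (src_mem_verts heS)) (not_le.2 (hei ▸ e.2))
          · have := ((ha e he heS).2 (hei ▸ h.least.1)).1
            exact h.lt.ne (hei.symm.trans this)
        obtain ⟨f, hf, h1, h2⟩ := hF.left i j ⟨h.lt, ⟨P, hpc P (.path hP), hPo⟩, hi⟩
        have hup : Up T i (tgt f) := h1 ▸ mem_closure.1 (hcl hf)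
        have claim : ∀ y, Up T y (tgt f) → y ∈ verts S → Up T j (tgt f) ∧ Up S y j := by
          intro y hy
          induction hy using Relation.ReflTransGen.head_induction_on with
          | refl =>
            intro hy
            rw [le_antisymm (h.greatest.2 hy) h2]
            exact ⟨.refl, .refl⟩
          | head he hy ih' =>
            obtain ⟨e, he, rfl, rfl⟩ := he
            intro hz
            by_cases heS : e ∈ S
            · obtain ⟨h3, h4⟩ := ih' (tgt_mem_verts heS)
              exact ⟨h3, (Up.single heS).trans h4⟩
            · have := (ha e he heS).1 hz
              exact ⟨this ▸ (Up.single he).trans hy, this ▸ .refl⟩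
        obtain ⟨h3, h4⟩ := claim i hup h.least.1
        obtain ⟨h5, h6⟩ := h4.split hS hP.1 hPo htP
        exact ⟨f, hf, h1 ▸ h5.mono h.subset, (h6.mono h.subset).trans h3⟩
    · obtain ⟨D, hD⟩ := exists_isMinDecomposition S P
      have ht' : t ∈ D.biUnion id := by rw [hD.1.union]; exact Finset.mem_sdiff.2 ⟨ht, htP⟩
      obtain ⟨U, hU, htU⟩ := Finset.mem_biUnion.1 ht'
      obtain ⟨i', j', hseg⟩ := h.of_mem hT hN hP hD hU
      obtain ⟨e, he, -⟩ := (hPo.mem_verts_of_ne h.lt.ne).1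
      have hlt : U.card < k := by
        rw [← hk]
        apply Finset.card_lt_card
        rw [Finset.ssubset_iff_of_subset ((hD.1.subset hU).trans Finset.sdiff_subset)]
        exact ⟨e, hP.1 he, fun heU => (Finset.mem_sdiff.1 (hD.1.subset hU heU)).2 he⟩
      exact ih _ hlt U i' j' rfl hseg (fun Q hQ => hpc Q (.step hP hD hU hQ)) t htU

theorem isAdmissible_iff_covers {T F : Finset (Edge n)} (hn : 1 ≤ n) (hT : IsSpanningTree T)
    (hN : Noncrossing T) : IsAdmissible T F ↔ IsNCASpanningForest T F ∧ Covers T F :=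
  ⟨fun h => ⟨h.forest, IsSegment.covered hT.isAcyclic hN h _ T _ _ rfl (hT.isSegment hn)
    (fun _ hQ => hQ)⟩, fun h => .of_covers hn hT hN h.1 h.2⟩

/-- Every spanning tree of the closure covers `T`. -/
theorem covers_of_isSpanningTree {T F : Finset (Edge n)} (hT : IsSpanningTree T)
    (hFT : F ⊆ closure T) (hF : IsSpanningTree F) : Covers T F := by
  intro t ht
  by_contra! hno
  apply not_reachable_erase hT.isAcyclic ht
  by_contra hr
  -- Some edge of the spanning tree F joins the two components of T without t; the increasing path
  -- it represents has to use t.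
  obtain ⟨f, hf, h⟩ := exists_boundary_edge (hF.connected (src t) (tgt t))
    {x | (toGraph (T.erase t)).Reachable (src t) x} (Reachable.refl _) hr
  simp only [Set.mem_ofPred_eq] at h
  rcases (mem_closure.1 (hFT hf)).erase_or t with h1 | h1
  · have := h1.reachable
    rcases h with h | h
    exacts [h.2 (h.1.trans this), h.2 (h.1.trans this.symm)]
  · exact hno f hf h1.1 h1.2

/-! ### Generating functions of open cones -/

/-- The generating function `z / (1 - z)` of the positive multiples of the flow of `e`. -/
noncomputable def ray (e : Edge n) : MvPowerSeries (Fin (n + 1)) ℚ :=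
  MvPowerSeries.monomial (gaps e) 1 * (1 - MvPowerSeries.monomial (gaps e) 1)⁻¹

theorem one_sub_mul_inv (e : Edge n) :
    (1 - MvPowerSeries.monomial (gaps e) (1 : ℚ)) *
      (1 - MvPowerSeries.monomial (gaps e) (1 : ℚ))⁻¹ = 1 := by
  classical
  apply MvPowerSeries.mul_inv_cancel
  rw [map_sub, map_one, ← MvPowerSeries.coeff_zero_eq_constantCoeff_apply,
    MvPowerSeries.coeff_monomial, if_neg (gaps_ne_zero e).symm]
  simp

theorem ray_eq (e : Edge n) :
    ray e = MvPowerSeries.monomial (gaps e) 1 + MvPowerSeries.monomial (gaps e) 1 * ray e := by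
  have h := one_sub_mul_inv e
  unfold ray
  linear_combination MvPowerSeries.monomial (gaps e) (1 : ℚ) * h

/-- The monomial of (i,k) is the product of those of (i,j) and (j,k). Multiplicities (a,b) of the
two short edges split according to a > b, a < b and a = b, which give the three terms on the right.
-/
theorem ray_mul_ray (i j k : Fin (n + 1)) (hij : i < j) (hjk : j < k) :
    ray (edge i j hij) * ray (edge j k hjk) =
      ray (edge i k (hij.trans hjk)) * ray (edge i j hij) +
        (ray (edge j k hjk) * ray (edge i k (hij.trans hjk)) + ray (edge i k (hij.trans hjk))) := by
  have h1 := one_sub_mul_inv (edge i j hij)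
  have h2 := one_sub_mul_inv (edge j k hjk)
  have h3 := one_sub_mul_inv (edge i k (hij.trans hjk))
  have h4 : MvPowerSeries.monomial (gaps (edge i k (hij.trans hjk))) (1 : ℚ) =
      MvPowerSeries.monomial (gaps (edge i j hij)) (1 : ℚ) *
        MvPowerSeries.monomial (gaps (edge j k hjk)) (1 : ℚ) := by
    rw [MvPowerSeries.monomial_mul_monomial, gaps_add, one_mul]
  unfold ray
  rw [h4] at h3 ⊢
  set z1 := MvPowerSeries.monomial (gaps (edge i j hij)) (1 : ℚ)
  set z2 := MvPowerSeries.monomial (gaps (edge j k hjk)) (1 : ℚ)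
  set y1 := (1 - z1)⁻¹
  set y2 := (1 - z2)⁻¹
  set y3 := (1 - z1 * z2)⁻¹
  have e1 : z1 * y1 = y1 - 1 := by linear_combination -h1
  have e2 : z2 * y2 = y2 - 1 := by linear_combination -h2
  have e3 : y1 + y2 - 1 = (1 - z1 * z2) * (y1 * y2) := by
    have : (1 - z1 * z2) * (y1 * y2) = y1 * y2 - (z1 * y1) * (z2 * y2) := by ring
    rw [this, e1, e2]; ring
  have e4 : z1 * z2 * y3 * (z1 * y1) + (z2 * y2 * (z1 * z2 * y3) + z1 * z2 * y3) =
      z1 * z2 * y3 * (y1 + y2 - 1) := by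
    rw [e1, e2]; ring
  rw [e4, e3]
  linear_combination -(z1 * z2 * (y1 * y2)) * h3

/-- From ray = z(1 + ray): a recursion for coefficients along subtraction of `gaps e`, on which the
inductions below run. -/
theorem coeff_ray_mul (e : Edge n) (f : MvPowerSeries (Fin (n + 1)) ℚ) (g : Fin (n + 1) →₀ ℕ) :
    MvPowerSeries.coeff g (ray e * f) = if gaps e ≤ g then
      MvPowerSeries.coeff (g - gaps e) f + MvPowerSeries.coeff (g - gaps e) (ray e * f) else 0 := by
  classical
  have h : ray e * f = MvPowerSeries.monomial (gaps e) 1 * (f + ray e * f) := by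
    conv_lhs => rw [ray_eq]
    ring
  rw [h, MvPowerSeries.coeff_monomial_mul, ← h, map_add, one_mul]

theorem sub_gaps_lt {e : Edge n} {g : Fin (n + 1) →₀ ℕ} (h : gaps e ≤ g) : g - gaps e < g := by
  refine lt_of_le_of_ne tsub_le_self fun h' => gaps_ne_zero e ?_
  have := tsub_add_cancel_of_le h
  rw [h'] at this
  simpa using this

/-! ### Lattice points of open cones -/

theorem flow_congr {s : Finset (Edge n)} {c c' : Edge n → ℕ} (h : ∀ e ∈ s, c e = c' e) :
    flow s c = flow s c' := Finset.sum_congr rfl fun e he => by rw [h e he]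

theorem flow_insert {s : Finset (Edge n)} {e : Edge n} (he : e ∉ s) (c : Edge n → ℕ) :
    flow (insert e s) c = c e • gaps e + flow s c := Finset.sum_insert he

theorem flow_update {s : Finset (Edge n)} {e : Edge n} (he : e ∉ s) (c : Edge n → ℕ) (k : ℕ) :
    flow (insert e s) (Function.update c e k) = k • gaps e + flow s c := by
  rw [flow_insert he, Function.update_self]
  congr 1
  exact flow_congr fun f hf => Function.update_of_ne (by rintro rfl; exact he hf) _ _

theorem Independent.of_insert {s : Finset (Edge n)} {e : Edge n} (he : e ∉ s)
    (h : Independent (insert e s)) : Independent s := by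
  intro c c' hcc f hf
  have hfe : f ≠ e := by rintro rfl; exact he hf
  have := h (Function.update c e 0) (Function.update c' e 0)
    (by rw [flow_update he, flow_update he, hcc]) f (Finset.mem_insert_of_mem hf)
  rwa [Function.update_of_ne hfe, Function.update_of_ne hfe] at this

/-- `g` lies in the open cone spanned by the flows of `s`. -/
def InOpenCone (s : Finset (Edge n)) (g : Fin (n + 1) →₀ ℕ) : Prop :=
  ∃ c : Edge n → ℕ, (∀ e ∈ s, 0 < c e) ∧ flow s c = g

/-- Take away one copy of e: if its multiplicity was 1 the rest lies in the cone of s, otherwise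
still in the cone of the enlarged set. This matches the recursion `coeff_ray_mul`. -/
theorem inOpenCone_insert {s : Finset (Edge n)} {e : Edge n} (he : e ∉ s)
    (g : Fin (n + 1) →₀ ℕ) : InOpenCone (insert e s) g ↔
      gaps e ≤ g ∧ (InOpenCone s (g - gaps e) ∨ InOpenCone (insert e s) (g - gaps e)) := by
  have pos : ∀ (c : Edge n → ℕ) (k : ℕ), 0 < k → (∀ f ∈ s, 0 < c f) →
      ∀ f ∈ insert e s, 0 < Function.update c e k f := by
    intro c k hk hc f hf
    by_cases hfe : f = e
    · subst hfe; simpa using hk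
    · rw [Function.update_of_ne hfe]
      exact hc f ((Finset.mem_insert.1 hf).resolve_left hfe)
  constructor
  · rintro ⟨c, hc, rfl⟩
    have h1 := hc e (Finset.mem_insert_self e s)
    obtain ⟨k, hk⟩ := Nat.exists_eq_succ_of_ne_zero h1.ne'
    have h2 : flow (insert e s) c = gaps e + (k • gaps e + flow s c) := by
      rw [flow_insert he, hk, Nat.succ_eq_add_one, add_smul, one_smul]; abel
    rw [h2, add_tsub_cancel_left]
    refine ⟨le_self_add, ?_⟩
    have hcs : ∀ f ∈ s, 0 < c f := fun f hf => hc f (Finset.mem_insert_of_mem hf)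
    rcases Nat.eq_zero_or_pos k with rfl | hk0
    · exact Or.inl ⟨c, hcs, by simp⟩
    · exact Or.inr ⟨_, pos c k hk0 hcs, flow_update he c k⟩
  · rintro ⟨hle, ⟨c, hc, h⟩ | ⟨c, hc, h⟩⟩
    · refine ⟨_, pos c 1 one_pos hc, ?_⟩
      rw [flow_update he, h, one_smul, add_tsub_cancel_of_le hle]
    · refine ⟨_, pos c (c e + 1) (Nat.succ_pos _) fun f hf => hc f (Finset.mem_insert_of_mem hf), ?_⟩
      rw [flow_insert he] at h
      rw [flow_update he, add_smul, one_smul, add_right_comm, h, tsub_add_cancel_of_le hle]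

open Classical in
/-- The product of the generating functions of independent rays is the generating function of their
open cone. -/
theorem coeff_prod_ray {s : Finset (Edge n)} : Independent s → ∀ g : Fin (n + 1) →₀ ℕ,
    MvPowerSeries.coeff g (∏ e ∈ s, ray e) = if InOpenCone s g then 1 else 0 := by
  induction s using Finset.induction_on with
  | empty =>
    intro _ g
    rw [Finset.prod_empty, MvPowerSeries.coeff_one]
    congr 1
    simp only [InOpenCone, flow, Finset.sum_empty, eq_iff_iff]
    exact ⟨fun h => ⟨0, by simp, h.symm⟩, fun ⟨_, _, h⟩ => h.symm⟩
  | insert e s he ih =>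
    intro hind g
    rw [Finset.prod_insert he]
    induction g using WellFoundedLT.induction with
    | ind g ihg =>
      rw [coeff_ray_mul]
      simp only [inOpenCone_insert he g]
      by_cases hle : gaps e ≤ g
      · rw [if_pos hle, ih (hind.of_insert he), ihg _ (sub_gaps_lt hle)]
        -- By independence the multiplicity of e cannot be both 0 and positive, so the two
        -- contributions never add up to 2.
        have excl : ¬ (InOpenCone s (g - gaps e) ∧ InOpenCone (insert e s) (g - gaps e)) := by
          rintro ⟨⟨c, hc, h⟩, ⟨c', hc', h'⟩⟩
          have := hind (Function.update c e 0) c'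
            (by rw [flow_update he, h, h', zero_smul, zero_add]) e (Finset.mem_insert_self e s)
          have h0 := hc' e (Finset.mem_insert_self e s)
          rw [← this] at h0
          simp at h0
        by_cases h1 : InOpenCone s (g - gaps e)
        · by_cases h2 : InOpenCone (insert e s) (g - gaps e)
          · exact absurd ⟨h1, h2⟩ excl
          · simp [h1, h2, hle]
        · by_cases h2 : InOpenCone (insert e s) (g - gaps e) <;> simp [h1, h2, hle]
      · simp [hle]

/-! ### The height of a flow -/

/-- The total supply of a flow. -/
def height (g : Fin (n + 1) →₀ ℕ) : ℕ := ∑ i, (g i - prev g i)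

/-- What flows across gap i was supplied at vertices up to i. The differences in `height` are
truncated, so only sources contribute. Bounded entries make each height level finite. -/
theorem le_height (g : Fin (n + 1) →₀ ℕ) (i : Fin (n + 1)) : g i ≤ height g := by
  have key : ∀ (k : ℕ) (hk : k < n + 1), g ⟨k, hk⟩ ≤
      ∑ j ∈ Finset.univ.filter (fun j : Fin (n + 1) => j.1 ≤ k), (g j - prev g j) := by
    intro k
    induction k with
    | zero =>
      intro hk
      have h0 : prev g ⟨0, hk⟩ = 0 := by simp [prev]
      have := Finset.single_le_sum (f := fun j => g j - prev g j) (fun _ _ => Nat.zero_le _)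
        (show (⟨0, hk⟩ : Fin (n + 1)) ∈ Finset.univ.filter (fun j : Fin (n + 1) => j.1 ≤ 0) by simp)
      simp only [h0, tsub_zero] at this
      exact this
    | succ k ih =>
      intro hk
      have hk' : k < n + 1 := by omega
      have hp : prev g ⟨k + 1, hk⟩ = g ⟨k, hk'⟩ := by simp [prev]
      have hset : Finset.univ.filter (fun j : Fin (n + 1) => j.1 ≤ k + 1) =
          insert ⟨k + 1, hk⟩ (Finset.univ.filter (fun j : Fin (n + 1) => j.1 ≤ k)) := by
        ext j
        simp only [Finset.mem_filter, Finset.mem_univ, true_and, Finset.mem_insert, Fin.ext_iff]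
        omega
      rw [hset, Finset.sum_insert (by simp), hp]
      have := ih hk'
      omega
  exact (key i.1 i.2).trans (Finset.sum_le_sum_of_subset (Finset.filter_subset _ _))

theorem height_zero : height (0 : Fin (n + 1) →₀ ℕ) = 0 := by simp [height]

theorem finite_height (h : ℕ) : {g : Fin (n + 1) →₀ ℕ | height g = h}.Finite := by
  refine (Set.finite_Iic (Finsupp.equivFunOnFinite.symm fun _ => h)).subset ?_
  rintro g rfl
  intro i
  exact le_height g i

/-- The sum of the coefficients at the flows of height `h`. -/
noncomputable def heightSum (h : ℕ) : MvPowerSeries (Fin (n + 1)) ℚ →ₗ[ℚ] ℚ :=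
  ∑ g ∈ (finite_height h).toFinset, MvPowerSeries.coeff g

theorem heightSum_apply (h : ℕ) (f : MvPowerSeries (Fin (n + 1)) ℚ) :
    heightSum h f = ∑ g ∈ (finite_height h).toFinset, MvPowerSeries.coeff g f := by
  simp [heightSum, LinearMap.sum_apply]

theorem prev_add_gaps (g : Fin (n + 1) →₀ ℕ) (e : Edge n) (i : Fin (n + 1)) :
    prev (g + gaps e) i = prev g i + if src e < i ∧ i ≤ tgt e then 1 else 0 := by
  unfold prev
  split_ifs with h h' h'
  · exact absurd h'.1 (by rw [Fin.lt_def]; omega)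
  · rfl
  · rw [Finsupp.add_apply, gaps_apply, if_pos]
    simp only [Fin.lt_def, Fin.le_def] at h' ⊢
    omega
  · rw [Finsupp.add_apply, gaps_apply, if_neg]
    simp only [Fin.lt_def, Fin.le_def] at h' ⊢
    omega

/-- The flow `g` has its sources in `A` and its sinks outside. -/
def HasSources (A : Set (Fin (n + 1))) (g : Fin (n + 1) →₀ ℕ) : Prop :=
  ∀ i, (i ∈ A → prev g i ≤ g i) ∧ (i ∉ A → g i ≤ prev g i)

/-- The truncated net supply grows by one at `src e`. At `tgt e`, which is a sink, it is zero before
and after. Without a separation of sources from sinks the height need not increase. -/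
theorem HasSources.add_gaps {A : Set (Fin (n + 1))} {g : Fin (n + 1) →₀ ℕ} (hg : HasSources A g)
    {e : Edge n} (h1 : src e ∈ A) (h2 : tgt e ∉ A) :
    HasSources A (g + gaps e) ∧ height (g + gaps e) = height g + 1 := by
  have hlt := e.2
  have hs := fun i => prev_add_gaps g e i
  have ha : ∀ i, (g + gaps e) i = g i + if src e ≤ i ∧ i < tgt e then 1 else 0 := fun i => by
    rw [Finsupp.add_apply, gaps_apply]
  constructor
  · intro i
    rw [hs, ha]
    have := hg i
    constructor
    · intro hi
      have hi' : i ≠ tgt e := by rintro rfl; exact h2 hi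
      have := this.1 hi
      split_ifs <;> grind
    · intro hi
      have hi' : i ≠ src e := by rintro rfl; exact hi h1
      have := this.2 hi
      split_ifs <;> grind
  · have : height g + 1 = ∑ i, ((g i - prev g i) + if i = src e then 1 else 0) := by
      rw [Finset.sum_add_distrib]; simp [height]
    rw [this]
    unfold height
    apply Finset.sum_congr rfl
    intro i _
    rw [hs, ha]
    have h3 := (hg i).1
    have h4 := (hg i).2
    by_cases hi : i = src e
    · subst hi
      have := h3 h1
      rw [if_pos ⟨le_rfl, hlt⟩, if_neg (by simp), if_pos rfl]
      omega
    · by_cases hi' : i = tgt e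
      · subst hi'
        have := h4 h2
        rw [if_neg (by simp), if_pos ⟨hlt, le_rfl⟩, if_neg hi]
        omega
      · rw [if_neg hi]
        split_ifs <;> grind

/-- The power series `f` is supported on flows with sources in `A` and sinks outside. -/
def SupportedOn (A : Set (Fin (n + 1))) (f : MvPowerSeries (Fin (n + 1)) ℚ) : Prop :=
  ∀ g, MvPowerSeries.coeff g f ≠ 0 → HasSources A g

theorem SupportedOn.ray_mul {A : Set (Fin (n + 1))} {f : MvPowerSeries (Fin (n + 1)) ℚ}
    (hf : SupportedOn A f) {e : Edge n} (h1 : src e ∈ A) (h2 : tgt e ∉ A) :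
    SupportedOn A (ray e * f) := by
  intro g
  induction g using WellFoundedLT.induction with
  | ind g ih =>
    intro hg
    rw [coeff_ray_mul] at hg
    split_ifs at hg with hle
    · have : HasSources A (g - gaps e) := by
        by_cases h : MvPowerSeries.coeff (g - gaps e) f = 0
        · rw [h, zero_add] at hg
          exact ih _ (sub_gaps_lt hle) hg
        · exact hf _ h
      have := (this.add_gaps h1 h2).1
      rwa [tsub_add_cancel_of_le hle] at this
    · exact absurd rfl hg

theorem heightSum_zero_ray_mul (e : Edge n) (f : MvPowerSeries (Fin (n + 1)) ℚ) :
    heightSum 0 (ray e * f) = 0 := by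
  rw [heightSum_apply]
  apply Finset.sum_eq_zero
  intro g hg
  by_contra hne
  have hg0 : height g = 0 := by simpa using hg
  have : g = 0 := by
    ext i
    have := le_height g i
    simp only [Finsupp.coe_zero, Pi.zero_apply]
    omega
  subst this
  rw [coeff_ray_mul, if_neg] at hne
  · exact hne rfl
  · intro h
    exact gaps_ne_zero e (le_antisymm h zero_le)

/-- Since ray = z(1 + ray), the coefficients of `ray e * f` are those of `f + ray e * f` shifted by
`gaps e`, and on the support the shift raises the height by exactly one. -/
theorem heightSum_succ_ray_mul {A : Set (Fin (n + 1))} {f : MvPowerSeries (Fin (n + 1)) ℚ}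
    (hf : SupportedOn A f) {e : Edge n} (h1 : src e ∈ A) (h2 : tgt e ∉ A) (h : ℕ) :
    heightSum (h + 1) (ray e * f) = heightSum h f + heightSum h (ray e * f) := by
  rw [← map_add]
  have hsup : ∀ g, MvPowerSeries.coeff g (f + ray e * f) ≠ 0 → HasSources A g := by
    intro g hg
    by_cases h0 : MvPowerSeries.coeff g f = 0
    · rw [map_add, h0, zero_add] at hg
      exact hf.ray_mul h1 h2 g hg
    · exact hf g h0
  have hco : ∀ g, MvPowerSeries.coeff (g + gaps e) (ray e * f) =
      MvPowerSeries.coeff g (f + ray e * f) := by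
    intro g
    rw [coeff_ray_mul, if_pos le_add_self, add_tsub_cancel_right, map_add]
  rw [heightSum_apply, heightSum_apply]
  symm
  apply Finset.sum_bij_ne_zero (fun g _ _ => g + gaps e)
  · intro g hg hne
    have hg0 : height g = h := by simpa using hg
    simp [((hsup g hne).add_gaps h1 h2).2, hg0]
  · intro g _ _ g' _ _ hgg
    exact add_right_cancel hgg
  · intro g hg hne
    have hle : gaps e ≤ g := by
      by_contra hle
      rw [coeff_ray_mul, if_neg hle] at hne
      exact hne rfl
    have hg' : g - gaps e + gaps e = g := tsub_add_cancel_of_le hle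
    have hne' : MvPowerSeries.coeff (g - gaps e) (f + ray e * f) ≠ 0 := by
      rw [← hco, hg']; exact hne
    refine ⟨g - gaps e, ?_, hne', hg'⟩
    have h3 := ((hsup _ hne').add_gaps h1 h2).2
    have h4 : height g = h + 1 := by simpa using hg
    rw [hg', h4] at h3
    simp only [Set.Finite.mem_toFinset, Set.mem_ofPred_eq]
    omega
  · intro g _ _
    exact (hco g).symm

/-- The number of compositions of `h` into `k` parts. -/
def numCompositions : ℕ → ℕ → ℕ
  | 0, 0 => 1
  | 0, _ + 1 => 0
  | _ + 1, 0 => 0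
  | k + 1, h + 1 => numCompositions k h + numCompositions (k + 1) h

theorem numCompositions_of_lt {h : ℕ} : ∀ {k : ℕ}, h < k → numCompositions k h = 0 := by
  induction h with
  | zero =>
    intro k hk
    obtain ⟨k, rfl⟩ := Nat.exists_eq_succ_of_ne_zero hk.ne'
    simp [numCompositions]
  | succ h ih =>
    intro k hk
    obtain ⟨k, rfl⟩ := Nat.exists_eq_succ_of_ne_zero (Nat.ne_of_gt (Nat.zero_lt_of_lt hk))
    rw [Nat.succ_eq_add_one, numCompositions, ih (by omega), ih (by omega)]

theorem numCompositions_self (k : ℕ) : numCompositions k k = 1 := by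
  induction k with
  | zero => simp [numCompositions]
  | succ k ih => rw [numCompositions, ih, numCompositions_of_lt (Nat.lt_succ_self k)]

/-- When sources and sinks are separated, each unit on each edge contributes 1 to the height, so
only the number of edges matters. The multiset may have repeated edges or cycles; independence plays
no role here. -/
theorem heightSum_prod {A : Set (Fin (n + 1))} (m : Multiset (Edge n))
    (hm : ∀ e ∈ m, src e ∈ A ∧ tgt e ∉ A) :
    SupportedOn A (m.map ray).prod ∧
      ∀ h, heightSum h (m.map ray).prod = numCompositions m.card h := by
  classical
  induction m using Multiset.induction_on with
  | empty =>
    simp only [Multiset.map_zero, Multiset.prod_zero, Multiset.card_zero]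
    constructor
    · intro g hg
      rw [MvPowerSeries.coeff_one] at hg
      obtain rfl : g = 0 := by by_contra h; rw [if_neg h] at hg; exact hg rfl
      intro i
      simp [prev]
    · intro h
      rw [heightSum_apply]
      simp only [MvPowerSeries.coeff_one, Finset.sum_ite_eq', Set.Finite.mem_toFinset,
        Set.mem_ofPred_eq, height_zero]
      cases h <;> simp [numCompositions]
  | cons e m ih =>
    obtain ⟨h1, h2⟩ := hm e (Multiset.mem_cons_self e m)
    obtain ⟨ih1, ih2⟩ := ih fun f hf => hm f (Multiset.mem_cons_of_mem hf)
    rw [Multiset.map_cons, Multiset.prod_cons, Multiset.card_cons]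
    refine ⟨ih1.ray_mul h1 h2, fun h => ?_⟩
    induction h with
    | zero => rw [heightSum_zero_ray_mul]; simp [numCompositions]
    | succ h ihh =>
      rw [heightSum_succ_ray_mul ih1 h1 h2, ihh, ih2, numCompositions]
      push_cast
      ring

theorem sum_numCompositions (M : Multiset ℕ) (h : ℕ) :
    (M.map fun k => numCompositions k h).sum =
      ∑ k ∈ Finset.range (h + 1), M.count k * numCompositions k h := by
  induction M using Multiset.induction_on with
  | empty => simp
  | cons a M ih =>
    rw [Multiset.map_cons, Multiset.sum_cons, ih]
    simp only [Multiset.count_cons, add_mul, Finset.sum_add_distrib, ite_mul, one_mul, zero_mul]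
    rw [add_comm, Finset.sum_ite_eq']
    congr 1
    split_ifs with ha
    · rfl
    · exact numCompositions_of_lt (by simpa using ha)

/-- The matrix of composition numbers is triangular with ones on the diagonal, so the number of k's
is recovered successively from the sum at h = k. -/
theorem eq_of_sum_numCompositions {M N : Multiset ℕ}
    (h : ∀ h, (M.map fun k => numCompositions k h).sum = (N.map fun k => numCompositions k h).sum) :
    M = N := by
  ext k
  induction k using Nat.strong_induction_on with
  | _ k ih =>
    have hk := h k
    rw [sum_numCompositions, sum_numCompositions, Finset.sum_range_succ, Finset.sum_range_succ,
      numCompositions_self, Finset.sum_congr rfl fun i hi => by rw [ih i (Finset.mem_range.1 hi)]]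
      at hk
    omega

/-- Two multisets of alternating graphs with the same generating function have the same numbers of
edges. -/
theorem card_eq_of_sum_eq {A B : Multiset (Multiset (Edge n))}
    (hA : ∀ m ∈ A, ∀ e ∈ m, ∀ f ∈ m, tgt e ≠ src f)
    (hB : ∀ m ∈ B, ∀ e ∈ m, ∀ f ∈ m, tgt e ≠ src f)
    (h : (A.map fun m => (m.map ray).prod).sum = (B.map fun m => (m.map ray).prod).sum) :
    A.map Multiset.card = B.map Multiset.card := by
  apply eq_of_sum_numCompositions
  have key : ∀ (A : Multiset (Multiset (Edge n))),
      (∀ m ∈ A, ∀ e ∈ m, ∀ f ∈ m, tgt e ≠ src f) → ∀ k : ℕ,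
      heightSum k (A.map fun m => (m.map ray).prod).sum =
        (((A.map Multiset.card).map fun c => numCompositions c k).sum : ℕ) := by
    intro A hA k
    rw [map_multiset_sum, Multiset.map_map, Multiset.map_map, Nat.cast_multiset_sum,
      Multiset.map_map]
    congr 1
    apply Multiset.map_congr rfl
    intro m hm
    exact (heightSum_prod (A := {v | ∃ e ∈ m, src e = v}) m fun e he =>
      ⟨⟨e, he, rfl⟩, fun ⟨f, hf, hfe⟩ => hA m hm e he f hf hfe.symm⟩).2 k
  intro k
  have h1 := key A hA k
  rw [h, key B hB k] at h1
  exact_mod_cast h1.symm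

/-! ### Noncrossing alternating graphs have disjoint open cones -/

/-- The flow along the edges which start before `a` and end at or after `b`. -/
def cornerSum (F : Finset (Edge n)) (c : Edge n → ℕ) (a b : ℕ) : ℕ :=
  ∑ e ∈ F, if (src e).1 < a ∧ b ≤ (tgt e).1 then c e else 0

theorem cornerSum_le_flow (F : Finset (Edge n)) (c : Edge n → ℕ) {a b : ℕ} {p : Fin (n + 1)}
    (h1 : a ≤ p.1 + 1) (h2 : p.1 < b) : cornerSum F c a b ≤ flow F c p := by
  rw [flow_apply]
  apply Finset.sum_le_sum
  intro e _
  simp only [Fin.le_def, Fin.lt_def]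
  split_ifs <;> omega

/-- Take p as the largest target below j of an edge passing over or ending at i, or i itself. An
edge over the gap p that starts after i would cross or continue the edge ending at p; one starting
at or before i reaches j by the choice of p. -/
theorem exists_flow_eq_cornerSum {F : Finset (Edge n)} (hN : Noncrossing F) (hA : Alternating F)
    (c : Edge n → ℕ) {i j : Fin (n + 1)} (hij : i < j) :
    ∃ p, i ≤ p ∧ p < j ∧ flow F c p = cornerSum F c (i.1 + 1) j.1 := by
  classical
  obtain ⟨p, hp, hmax⟩ := Finset.exists_max_image
    (insert i ((F.filter fun e => src e ≤ i ∧ i ≤ tgt e ∧ tgt e < j).image tgt)) id ⟨i, by simp⟩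
  simp only [id, Finset.mem_insert, Finset.mem_image, Finset.mem_filter] at hp hmax
  have hip : i ≤ p := hmax i (Or.inl rfl)
  have hpj : p < j := by
    rcases hp with rfl | ⟨e, ⟨-, -, -, h⟩, rfl⟩
    exacts [hij, h]
  refine ⟨p, hip, hpj, ?_⟩
  rw [flow_apply, cornerSum]
  apply Finset.sum_congr rfl
  intro e he
  congr 1
  rw [Nat.lt_succ_iff, ← Fin.le_def, ← Fin.le_def, eq_iff_iff]
  constructor
  · rintro ⟨h1, h2⟩
    by_cases hei : src e ≤ i
    · refine ⟨hei, ?_⟩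
      by_contra hlt
      exact absurd (hmax (tgt e) (Or.inr ⟨e, ⟨he, hei, (hip.trans_lt h2).le, not_le.1 hlt⟩, rfl⟩))
        (not_le.2 h2)
    · exfalso
      rcases hp with rfl | ⟨f, ⟨hf, hf1, hf2, hf3⟩, rfl⟩
      · exact hei h1
      · have := hN f hf e he
        have := hA f hf e he
        grind
  · rintro ⟨h1, h2⟩
    exact ⟨h1.trans hip, hpj.trans_le h2⟩

/-- For interior corners the corner sum is the minimum of the flow over the gaps between them:
`cornerSum_le_flow` gives the bound and `exists_flow_eq_cornerSum` shows it is attained. Hence it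
depends on the flow alone. -/
theorem cornerSum_eq {F F' : Finset (Edge n)} {c c' : Edge n → ℕ} (hN : Noncrossing F)
    (hA : Alternating F) (hN' : Noncrossing F') (hA' : Alternating F')
    (h : flow F c = flow F' c') {a b : ℕ} (hab : a ≤ b) :
    cornerSum F c a b = cornerSum F' c' a b := by
  rcases Nat.eq_zero_or_pos a with rfl | ha
  · simp [cornerSum]
  by_cases hb : b < n + 1
  · obtain ⟨i, rfl⟩ : ∃ i, a = i + 1 := ⟨a - 1, by omega⟩
    have hij : (⟨i, by omega⟩ : Fin (n + 1)) < ⟨b, hb⟩ := by rw [Fin.lt_def]; exact hab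
    obtain ⟨p, h1, h2, h3⟩ := exists_flow_eq_cornerSum hN hA c hij
    obtain ⟨q, h4, h5, h6⟩ := exists_flow_eq_cornerSum hN' hA' c' hij
    simp only [Fin.le_def, Fin.lt_def] at h1 h2 h3 h4 h5 h6
    apply le_antisymm
    · rw [← h6, ← h]
      exact cornerSum_le_flow F c (by omega) h5
    · rw [← h3, h]
      exact cornerSum_le_flow F' c' (by omega) h2
  · have : ∀ e : Edge n, ¬ b ≤ (tgt e).1 := fun e => by have := (tgt e).2; omega
    simp [cornerSum, this]

/-- The multiplicity of e is a mixed second difference of corner sums, by inclusion and exclusion.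
-/
theorem cornerSum_add (F : Finset (Edge n)) (c : Edge n → ℕ) (e : Edge n) :
    cornerSum F c ((src e).1 + 1) (tgt e).1 + cornerSum F c (src e).1 ((tgt e).1 + 1) =
      cornerSum F c (src e).1 (tgt e).1 + cornerSum F c ((src e).1 + 1) ((tgt e).1 + 1) +
        if e ∈ F then c e else 0 := by
  have h : (if e ∈ F then c e else 0) = ∑ f ∈ F, if e = f then c f else 0 := by
    rw [Finset.sum_ite_eq]
  rw [h]
  unfold cornerSum
  rw [← Finset.sum_add_distrib, ← Finset.sum_add_distrib, ← Finset.sum_add_distrib]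
  apply Finset.sum_congr rfl
  intro f _
  have hef : e = f ↔ (src e).1 = (src f).1 ∧ (tgt e).1 = (tgt f).1 :=
    ⟨fun h => by rw [h]; exact ⟨rfl, rfl⟩, fun h => edge_ext (Fin.ext h.1) (Fin.ext h.2)⟩
  simp only [hef]
  split_ifs <;> omega

theorem subset_of_flow_eq {F F' : Finset (Edge n)} {c c' : Edge n → ℕ} (hN : Noncrossing F)
    (hA : Alternating F) (hN' : Noncrossing F') (hA' : Alternating F') (hc : ∀ e ∈ F, 0 < c e)
    (h : flow F c = flow F' c') : F ⊆ F' := by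
  intro e he
  have h1 := cornerSum_add F c e
  have h2 := cornerSum_add F' c' e
  have he' : (src e).1 < (tgt e).1 := e.2
  have key := fun a b hab => cornerSum_eq (a := a) (b := b) hN hA hN' hA' h hab
  rw [key _ _ (by omega), key _ _ (by omega), key _ _ (by omega), key _ _ (by omega),
    if_pos he] at h1
  have := hc e he
  by_contra hn
  rw [if_neg hn] at h2
  omega

theorem eq_of_inOpenCone {F F' : Finset (Edge n)} (hN : Noncrossing F) (hA : Alternating F)
    (hN' : Noncrossing F') (hA' : Alternating F') {g : Fin (n + 1) →₀ ℕ} (h : InOpenCone F g)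
    (h' : InOpenCone F' g) : F = F' := by
  obtain ⟨c, hc, rfl⟩ := h
  obtain ⟨c', hc', h⟩ := h'
  exact (subset_of_flow_eq hN hA hN' hA' hc h.symm).antisymm
    (subset_of_flow_eq hN' hA' hN hA hc' h)

/-! ### The cone points of forests covering `T` -/

theorem flow_add (s : Finset (Edge n)) (c c' : Edge n → ℕ) :
    flow s (c + c') = flow s c + flow s c' := by
  simp [flow, add_smul, Finset.sum_add_distrib]

theorem flow_sum {ι : Type*} (I : Finset ι) (s : Finset (Edge n)) (c : ι → Edge n → ℕ) :
    flow s (∑ f ∈ I, c f) = ∑ f ∈ I, flow s (c f) := by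
  classical
  induction I using Finset.induction_on with
  | empty => simp [flow]
  | insert a I ha ih => rw [Finset.sum_insert ha, Finset.sum_insert ha, flow_add, ih]

theorem flow_single {s : Finset (Edge n)} {t : Edge n} (ht : t ∈ s) :
    flow s (Pi.single t 1) = gaps t := by
  rw [flow, Finset.sum_eq_single_of_mem t ht]
  · simp
  · intro e _ het
    simp [Pi.single_eq_of_ne het]

theorem Up.exists_flow {T : Finset (Edge n)} {a b : Fin (n + 1)} (h : Up T a b) :
    ∃ c : Edge n → ℕ, ∀ p, flow T c p = if a ≤ p ∧ p < b then 1 else 0 := by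
  induction h with
  | refl => exact ⟨0, fun p => by rw [if_neg (by grind)]; simp [flow]⟩
  | tail hab h ih =>
    obtain ⟨e, he, rfl, rfl⟩ := h
    obtain ⟨c, hc⟩ := ih
    refine ⟨c + Pi.single e 1, fun p => ?_⟩
    rw [flow_add, flow_single he, Finsupp.add_apply, hc, gaps_apply]
    have := Up.le hab
    have := e.2
    grind

theorem exists_flow_eq_gaps {T : Finset (Edge n)} {f t : Edge n} (ht : t ∈ T)
    (h1 : Up T (src f) (src t)) (h2 : Up T (tgt t) (tgt f)) :
    ∃ c : Edge n → ℕ, flow T c = gaps f ∧ 0 < c t := by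
  obtain ⟨c1, hc1⟩ := h1.exists_flow
  obtain ⟨c2, hc2⟩ := h2.exists_flow
  refine ⟨c1 + Pi.single t 1 + c2, ?_, by simp⟩
  ext p
  rw [flow_add, flow_add, flow_single ht, Finsupp.add_apply, Finsupp.add_apply, hc1, hc2,
    gaps_apply, gaps_apply]
  have := h1.le
  have := h2.le
  have := t.2
  grind

theorem Covers.inOpenCone {T F : Finset (Edge n)} (hT : (toGraph T).IsAcyclic)
    (hF : F ⊆ closure T) (hC : Covers T F) : InOpenCone T (flow F 1) := by
  have hex : ∀ f : Edge n, ∃ c : Edge n → ℕ, f ∈ F → flow T c = gaps f := by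
    intro f
    by_cases hf : f ∈ F
    · obtain ⟨c, hc⟩ := (mem_closure.1 (hF hf)).exists_flow
      exact ⟨c, fun _ => Finsupp.ext fun p => by rw [hc, gaps_apply]⟩
    · exact ⟨0, fun h => absurd h hf⟩
  choose c hc using hex
  refine ⟨∑ f ∈ F, c f, fun t ht => ?_, ?_⟩
  · obtain ⟨f, hf, h1, h2⟩ := hC t ht
    obtain ⟨c', hc', hpos⟩ := exists_flow_eq_gaps ht h1 h2
    -- The representation chosen for f need not be the one built through t, but on T the two agree
    -- by independence, so it too is positive at t.
    rw [← independent_of_acyclic hT (c f) c' (by rw [hc f hf, hc']) t ht] at hpos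
    rw [Finset.sum_apply]
    exact hpos.trans_le (Finset.single_le_sum (f := fun f => c f t)
      (fun _ _ => Nat.zero_le _) hf)
  · rw [flow_sum, flow]
    exact Finset.sum_congr rfl fun f hf => by rw [hc f hf]; simp

/-- Noncrossing alternating forests whose open cones subdivide the open cone of `T` are exactly the
admissible ones. -/
theorem eq_admissibleForests {T : Finset (Edge n)} (hn : 1 ≤ n) (hT : IsSpanningTree T)
    (hN : Noncrossing T) {A : Multiset (Finset (Edge n))}
    (hA : ∀ F ∈ A, IsNCASpanningForest T F ∧ Covers T F)
    (hsum : (A.map fun F => ∏ e ∈ F, ray e).sum = ∏ e ∈ T, ray e) :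
    A = (admissibleForests T).val := by
  classical
  have hmem : ∀ F, F ∈ admissibleForests T ↔ IsNCASpanningForest T F ∧ Covers T F := by
    intro F
    rw [admissibleForests, Finset.mem_filter, isAdmissible_iff_covers hn hT hN]
    simp
  ext F
  by_cases hF : F ∈ admissibleForests T
  · rw [Multiset.count_eq_one_of_mem (admissibleForests T).nodup hF]
    obtain ⟨hF1, hF2⟩ := (hmem F).1 hF
    -- Compare coefficients at an interior point of the cone of F: on the T side it is 1 because F
    -- covers T; on the other side it counts the G in A equal to F, by disjointness of open cones.
    have h1 := congrArg (MvPowerSeries.coeff (flow F 1)) hsum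
    rw [coeff_prod_ray (independent_of_acyclic hT.isAcyclic),
      if_pos (hF2.inOpenCone hT.isAcyclic hF1.1), map_multiset_sum, Multiset.map_map,
      Multiset.map_congr (g := fun G => if F = G then (1 : ℚ) else 0) rfl] at h1
    · rw [Multiset.count, Multiset.countP_eq_card_filter]
      have h2 : ∀ B : Multiset (Finset (Edge n)),
          (B.map fun G => if F = G then (1 : ℚ) else 0).sum = (B.filter fun G => F = G).card := by
        intro B
        induction B using Multiset.induction_on with
        | empty => simp
        | cons G B ih =>
          rw [Multiset.map_cons, Multiset.sum_cons, ih, Multiset.filter_cons]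
          split_ifs <;> simp [add_comm]
      rw [h2] at h1
      exact_mod_cast h1
    · intro G hG
      obtain ⟨hG1, -⟩ := hA G hG
      rw [Function.comp_apply, coeff_prod_ray (independent_of_acyclic hG1.2.1)]
      congr 1
      rw [eq_iff_iff]
      have hFc : InOpenCone F (flow F 1) := ⟨1, fun _ _ => one_pos, rfl⟩
      constructor
      · exact fun h => eq_of_inOpenCone hF1.2.2.1 hF1.2.2.2 hG1.2.2.1 hG1.2.2.2 hFc h
      · rintro rfl
        exact hFc
  · rw [Multiset.count_eq_zero_of_notMem fun h => hF ((hmem F).2 (hA F h)),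
      Multiset.count_eq_zero_of_notMem hF]

/-! ### Trees among the admissible forests -/

theorem card_edgeSet_toGraph (F : Finset (Edge n)) : (toGraph F).edgeSet.ncard = F.card := by
  classical
  have : (toGraph F).edgeSet = ((F.image fun e => s(src e, tgt e) : Finset _) : Set _) := by
    ext z
    rw [sym2_mem_edgeSet]
    simp
  rw [this, Set.ncard_coe_finset, Finset.card_image_of_injective _ fun _ _ h => sym2_injective h]

theorem IsSpanningTree.card {F : Finset (Edge n)} (hF : IsSpanningTree F) : F.card = n := by
  have h := (SimpleGraph.isTree_iff_connected_and_card.1 hF).2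
  rw [Nat.card_coe_set_eq, card_edgeSet_toGraph, Nat.card_fin] at h
  omega

theorem exists_isTree_of_acyclic {F : Finset (Edge n)} (hF : (toGraph F).IsAcyclic) :
    ∃ G : SimpleGraph (Fin (n + 1)), toGraph F ≤ G ∧ G.IsTree ∧ G.edgeSet.ncard = n := by
  obtain ⟨G, h1, -, h2⟩ := SimpleGraph.connected_top.exists_isTree_le_of_le_of_isAcyclic
    (le_top : toGraph F ≤ ⊤) hF
  have h := (SimpleGraph.isTree_iff_connected_and_card.1 h2).2
  rw [Nat.card_coe_set_eq, Nat.card_fin] at h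
  exact ⟨G, h1, h2, by omega⟩

theorem card_le_of_acyclic {F : Finset (Edge n)} (hF : (toGraph F).IsAcyclic) : F.card ≤ n := by
  obtain ⟨G, h1, -, h2⟩ := exists_isTree_of_acyclic hF
  rw [← card_edgeSet_toGraph]
  exact (Set.ncard_le_ncard (SimpleGraph.edgeSet_mono h1) (Set.toFinite _)).trans_eq h2

theorem isSpanningTree_of_card {F : Finset (Edge n)} (hF : (toGraph F).IsAcyclic)
    (hc : F.card = n) : IsSpanningTree F := by
  obtain ⟨G, h1, h2, h3⟩ := exists_isTree_of_acyclic hF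
  have : (toGraph F).edgeSet = G.edgeSet :=
    Set.eq_of_subset_of_ncard_le (SimpleGraph.edgeSet_mono h1)
      (by rw [card_edgeSet_toGraph, hc, h3]) (Set.toFinite _)
  rw [IsSpanningTree, SimpleGraph.edgeSet_inj.1 this]
  exact h2

/-- Trees need no admissibility condition because they always cover T; conversely a forest with n
edges on n+1 vertices is a spanning tree. -/
theorem ncaTrees_eq {T : Finset (Edge n)} (hn : 1 ≤ n) (hT : IsSpanningTree T)
    (hN : Noncrossing T) : ncaTrees T = (admissibleForests T).filter fun F => F.card = n := by
  classical
  ext F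
  rw [Finset.mem_filter, ncaTrees, admissibleForests, Finset.mem_filter, Finset.mem_filter,
    isAdmissible_iff_covers hn hT hN]
  simp only [Finset.mem_univ, true_and]
  constructor
  · intro h
    exact ⟨⟨⟨h.1, h.2.1.isAcyclic, h.2.2⟩, covers_of_isSpanningTree hT h.1 h.2.1⟩, h.2.1.card⟩
  · rintro ⟨⟨h, -⟩, hc⟩
    exact ⟨h.1, isSpanningTree_of_card h.2.1 hc, h.2.2⟩

/-! ### Reductions of noncrossing forests -/

/-- The noncrossing forests in the closure of `T` covering `T`. -/
structure IsCoveringForest (T G : Finset (Edge n)) : Prop where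
  subset : G ⊆ closure T
  acyclic : (toGraph G).IsAcyclic
  noncrossing : Noncrossing G
  covers : Covers T G

theorem subset_closure (T : Finset (Edge n)) : T ⊆ closure T :=
  fun _ he => mem_closure.2 (Up.single he)

theorem covers_self (T : Finset (Edge n)) : Covers T T := fun t ht => ⟨t, ht, .refl, .refl⟩

section reduct

variable {T m : Finset (Edge n)} {i j k : Fin (n + 1)} {hij : i < j} {hjk : j < k}

theorem edge_ne_left : edge i j hij ≠ edge i k (hij.trans hjk) := fun h =>
  hjk.ne (congrArg tgt h)

theorem edge_ne_right : edge j k hjk ≠ edge i k (hij.trans hjk) := fun h =>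
  hij.ne' (congrArg src h)

theorem edge_ne_consecutive : edge i j hij ≠ edge j k hjk := fun h => hij.ne (congrArg src h)

/-- The long edge of a reduction crosses nothing if `i` is minimal and `k` is maximal. -/
theorem Noncrossing.insert_long {G : Finset (Edge n)} (hN : Noncrossing G)
    (h1 : edge i j hij ∈ G) (h2 : edge j k hjk ∈ G) (hmin : ∀ e ∈ G, tgt e = j → i ≤ src e)
    (hmax : ∀ e ∈ G, src e = j → tgt e ≤ k) :
    Noncrossing (insert (edge i k (hij.trans hjk)) G) := by
  have key : ∀ e ∈ G, ¬ (src e < i ∧ i < tgt e ∧ tgt e < k) ∧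
      ¬ (i < src e ∧ src e < k ∧ k < tgt e) := by
    intro e he
    have a1 := hN e he _ h1
    have a2 := hN _ h1 e he
    have a3 := hN e he _ h2
    have a4 := hN _ h2 e he
    have a5 := hmin e he
    have a6 := hmax e he
    simp only [src, tgt, edge] at *
    grind
  intro e he f hf
  rcases Finset.mem_insert.1 he with rfl | he <;> rcases Finset.mem_insert.1 hf with rfl | hf
  · exact fun h => lt_irrefl _ h.1
  · exact (key f hf).2
  · exact (key e he).1
  · exact hN e he f hf

theorem IsCoveringForest.insert_long {G : Finset (Edge n)} (hG : IsCoveringForest T G)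
    (h1 : edge i j hij ∈ G) (h2 : edge j k hjk ∈ G) (hmin : ∀ e ∈ G, tgt e = j → i ≤ src e)
    (hmax : ∀ e ∈ G, src e = j → tgt e ≤ k) {G' : Finset (Edge n)}
    (hG' : G' ⊆ insert (edge i k (hij.trans hjk)) G) (hik : edge i k (hij.trans hjk) ∈ G')
    (hsub : ∀ e ∈ G, e ≠ edge i j hij → e ≠ edge j k hjk → e ∈ G')
    (hac : (toGraph G').IsAcyclic) : IsCoveringForest T G' := by
  have u1 : Up T i j := mem_closure.1 (hG.subset h1)
  have u2 : Up T j k := mem_closure.1 (hG.subset h2)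
  refine ⟨fun e he => ?_, hac, (hG.noncrossing.insert_long h1 h2 hmin hmax).mono hG', ?_⟩
  · rcases Finset.mem_insert.1 (hG' he) with rfl | he
    · exact mem_closure.2 (u1.trans u2)
    · exact hG.subset he
  · intro t ht
    obtain ⟨f, hf, h3, h4⟩ := hG.covers t ht
    by_cases hf1 : f = edge i j hij
    · subst hf1
      exact ⟨_, hik, h3, h4.trans u2⟩
    by_cases hf2 : f = edge j k hjk
    · subst hf2
      exact ⟨_, hik, u1.trans h3, h4⟩
    exact ⟨f, hsub f hf hf1 hf2, h3, h4⟩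

/-- The long edge preserves covering, as any increasing path represented by (i,j) or (j,k) extends
to one represented by (i,k). Extremality of i and k prevents crossings, and exchanging one edge of
the triangle i, j, k for another creates no cycle. -/
theorem IsCoveringForest.reduct (hG : IsCoveringForest T (insert (edge i j hij)
      (insert (edge j k hjk) m))) (h1 : edge i j hij ∉ m) (h2 : edge j k hjk ∉ m)
    (hmin : ∀ e ∈ insert (edge i j hij) (insert (edge j k hjk) m), tgt e = j → i ≤ src e)
    (hmax : ∀ e ∈ insert (edge i j hij) (insert (edge j k hjk) m), src e = j → tgt e ≤ k) :
    edge i k (hij.trans hjk) ∉ m ∧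
    IsCoveringForest T (insert (edge i k (hij.trans hjk)) (insert (edge i j hij) m)) ∧
    IsCoveringForest T (insert (edge j k hjk) (insert (edge i k (hij.trans hjk)) m)) ∧
    IsCoveringForest T (insert (edge i k (hij.trans hjk)) m) := by
  have e1 : edge i j hij ∈ insert (edge i j hij) (insert (edge j k hjk) m) := by simp
  have e2 : edge j k hjk ∈ insert (edge i j hij) (insert (edge j k hjk) m) := by simp
  have a1 : (toGraph (insert (edge i k (hij.trans hjk)) (insert (edge i j hij) m))).IsAcyclic := by
    refine acyclic_replace hG.acyclic edge_ne_consecutive h2 fun H hH hr => ?_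
    exact (reachable_of_mem hH).symm.trans hr
  have a2 : (toGraph (insert (edge i k (hij.trans hjk)) (insert (edge j k hjk) m))).IsAcyclic := by
    have := hG.acyclic
    rw [Finset.insert_comm] at this
    refine acyclic_replace this edge_ne_consecutive.symm h1 fun H hH hr => ?_
    exact hr.trans (reachable_of_mem hH).symm
  have main := fun G' => hG.insert_long e1 e2 hmin hmax (G' := G')
  refine ⟨?_, main _ ?_ ?_ ?_ a1, main _ ?_ ?_ ?_ (by rwa [Finset.insert_comm]),
    main _ ?_ ?_ ?_ (acyclic_mono ?_ a1)⟩
  · intro h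
    exact not_mem_of_acyclic hG.acyclic e1 e2
      (Finset.mem_insert_of_mem (Finset.mem_insert_of_mem h))
  all_goals
    try intro e
    simp only [Finset.mem_insert]
    tauto

end reduct

/-! ### The commutative case -/

/-- A quantity which is decreased by each reduction. -/
def complexity (m : Multiset (Edge n)) : ℕ :=
  (m.map fun e => n + 1 - ((tgt e).1 - (src e).1)).sum

/-- A reduct has one short edge replaced by a longer one or both replaced by a single edge. Lengths
are at most n, so every edge contributes at least 1. -/
theorem complexity_reduct (m : Multiset (Edge n)) {i j k : Fin (n + 1)} (hij : i < j)
    (hjk : j < k) :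
    complexity (edge i k (hij.trans hjk) ::ₘ edge i j hij ::ₘ m) <
      complexity (edge i j hij ::ₘ edge j k hjk ::ₘ m) ∧
    complexity (edge j k hjk ::ₘ edge i k (hij.trans hjk) ::ₘ m) <
      complexity (edge i j hij ::ₘ edge j k hjk ::ₘ m) ∧
    complexity (edge i k (hij.trans hjk) ::ₘ m) <
      complexity (edge i j hij ::ₘ edge j k hjk ::ₘ m) := by
  have h1 : i.1 < j.1 := hij
  have h2 : j.1 < k.1 := hjk
  have h3 := k.2
  simp only [complexity, Multiset.map_cons, Multiset.sum_cons, src, tgt, edge]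
  omega

theorem SReduction.add {A B : Multiset (ℕ × Multiset (Edge n))} (h : SReduction A B)
    (C : Multiset (ℕ × Multiset (Edge n))) : SReduction (A + C) (B + C) := by
  cases h with
  | mk i j k hij hjk b m R =>
    simp only [Multiset.cons_add]
    exact .mk i j k hij hjk b m (R + C)

theorem reflTransGen_add {α : Type*} {r : Multiset α → Multiset α → Prop}
    (hr : ∀ A B C, r A B → r (A + C) (B + C)) {A B C D : Multiset α}
    (h : Relation.ReflTransGen r A B) (h' : Relation.ReflTransGen r C D) :
    Relation.ReflTransGen r (A + C) (B + D) := by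
  have h1 : Relation.ReflTransGen r (A + C) (B + C) := h.lift (· + C) fun _ _ h => hr _ _ C h
  have h2 : Relation.ReflTransGen r (B + C) (B + D) := h'.lift (B + ·) fun _ _ h => by
    simp only [add_comm B]
    exact hr _ _ B h
  exact h1.trans h2

/-- The powers of β are ignored, that is, β = 1: each step is then an instance of `ray_mul_ray`. -/
theorem SReduction.sum_eq {A B : Multiset (ℕ × Multiset (Edge n))}
    (h : Relation.ReflTransGen SReduction A B) :
    (B.map fun t => (t.2.map ray).prod).sum = (A.map fun t => (t.2.map ray).prod).sum := by
  induction h with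
  | refl => rfl
  | tail _ h ih =>
    rw [← ih]
    cases h with
    | mk i j k hij hjk b m R =>
      simp only [Multiset.map_cons, Multiset.sum_cons, Multiset.prod_cons, ← mul_assoc,
        ray_mul_ray i j k hij hjk]
      ring

theorem SReduction.degree {A B : Multiset (ℕ × Multiset (Edge n))} {N : ℕ}
    (h : Relation.ReflTransGen SReduction A B) (hA : ∀ t ∈ A, t.1 + t.2.card = N) :
    ∀ t ∈ B, t.1 + t.2.card = N := by
  induction h with
  | refl => exact hA
  | tail _ h ih =>
    cases h with
    | mk i j k hij hjk b m R =>
      have h1 := ih _ (Multiset.mem_cons_self _ _)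
      simp only [Multiset.card_cons] at h1
      intro t ht
      simp only [Multiset.mem_cons] at ht
      rcases ht with rfl | rfl | rfl | ht
      · simp only [Multiset.card_cons]; omega
      · simp only [Multiset.card_cons]; omega
      · simp only [Multiset.card_cons]; omega
      · exact ih t (Multiset.mem_cons_of_mem ht)

theorem alternating_of_irreducible {A : Multiset (ℕ × Multiset (Edge n))}
    (hA : ∀ A', ¬ SReduction A A') : ∀ t ∈ A, ∀ e ∈ t.2, ∀ f ∈ t.2, tgt e ≠ src f := by
  rintro ⟨b, m⟩ ht e he f hf hef
  obtain ⟨⟨i, j⟩, hij⟩ := e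
  obtain ⟨⟨j', k⟩, hjk⟩ := f
  change j = j' at hef
  subst hef
  obtain ⟨m', rfl⟩ := Multiset.exists_cons_of_mem he
  rcases Multiset.mem_cons.1 hf with hf | hf
  · exact (ne_of_lt hjk) (congrArg tgt hf).symm
  obtain ⟨m, rfl⟩ := Multiset.exists_cons_of_mem hf
  obtain ⟨R, rfl⟩ := Multiset.exists_cons_of_mem ht
  exact hA _ (.mk i j k hij hjk b m R)

/-- The choice that keeps the forest noncrossing: at a vertex j with edges on both sides, take the
farthest neighbour on each side. -/
theorem exists_extremal_pair {G : Finset (Edge n)} (hG : ¬ Alternating G) :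
    ∃ (i j k : Fin (n + 1)) (hij : i < j) (hjk : j < k), edge i j hij ∈ G ∧ edge j k hjk ∈ G ∧
      (∀ e ∈ G, tgt e = j → i ≤ src e) ∧ (∀ e ∈ G, src e = j → tgt e ≤ k) := by
  classical
  unfold Alternating at hG
  push Not at hG
  obtain ⟨e, he, f, hf, hef⟩ := hG
  obtain ⟨a, ha, hamin⟩ := Finset.exists_min_image (G.filter fun x => tgt x = src f) src
    ⟨e, by simp [he, hef]⟩
  obtain ⟨b, hb, hbmax⟩ := Finset.exists_max_image (G.filter fun x => src x = src f) tgt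
    ⟨f, by simp [hf]⟩
  rw [Finset.mem_filter] at ha hb
  refine ⟨src a, src f, tgt b, ha.2 ▸ a.2, hb.2 ▸ b.2, ?_, ?_, ?_, ?_⟩
  · convert ha.1 using 1
    exact edge_ext rfl ha.2.symm
  · convert hb.1 using 1
    exact edge_ext hb.2.symm rfl
  · exact fun x hx hx' => hamin x (Finset.mem_filter.2 ⟨hx, hx'⟩)
  · exact fun x hx hx' => hbmax x (Finset.mem_filter.2 ⟨hx, hx'⟩)

/-- A noncrossing forest can be reduced to noncrossing alternating forests. -/
theorem exists_reduction {T : Finset (Edge n)} : ∀ (N : ℕ) (G : Finset (Edge n)) (b : ℕ),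
    complexity G.val = N → IsCoveringForest T G →
    ∃ A, Relation.ReflTransGen SReduction {(b, G.val)} A ∧
      ∀ t ∈ A, ∃ F : Finset (Edge n), t.2 = F.val ∧ IsCoveringForest T F ∧ Alternating F := by
  classical
  intro N
  induction N using Nat.strong_induction_on with
  | _ N ih =>
    intro G b hN hG
    by_cases hA : Alternating G
    · exact ⟨_, .refl, fun t ht => ⟨G, by rw [Multiset.mem_singleton.1 ht], hG, hA⟩⟩
    obtain ⟨i, j, k, hij, hjk, h1, h2, hmin, hmax⟩ := exists_extremal_pair hA
    obtain ⟨m, hm1, hm2, rfl⟩ : ∃ m, edge i j hij ∉ m ∧ edge j k hjk ∉ m ∧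
        G = insert (edge i j hij) (insert (edge j k hjk) m) := by
      refine ⟨(G.erase (edge i j hij)).erase (edge j k hjk), by simp, by simp, ?_⟩
      rw [Finset.insert_erase (Finset.mem_erase.2 ⟨edge_ne_consecutive.symm, h2⟩),
        Finset.insert_erase h1]
    obtain ⟨hm3, r1, r2, r3⟩ := hG.reduct hm1 hm2 hmin hmax
    have v0 : (insert (edge i j hij) (insert (edge j k hjk) m)).val =
        edge i j hij ::ₘ edge j k hjk ::ₘ m.val := by
      rw [Finset.insert_val_of_notMem, Finset.insert_val_of_notMem hm2]
      simp only [Finset.mem_insert, not_or]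
      exact ⟨edge_ne_consecutive, hm1⟩
    have v1 : (insert (edge i k (hij.trans hjk)) (insert (edge i j hij) m)).val =
        edge i k (hij.trans hjk) ::ₘ edge i j hij ::ₘ m.val := by
      rw [Finset.insert_val_of_notMem, Finset.insert_val_of_notMem hm1]
      simp only [Finset.mem_insert, not_or]
      exact ⟨(edge_ne_left (hjk := hjk)).symm, hm3⟩
    have v2 : (insert (edge j k hjk) (insert (edge i k (hij.trans hjk)) m)).val =
        edge j k hjk ::ₘ edge i k (hij.trans hjk) ::ₘ m.val := by
      rw [Finset.insert_val_of_notMem, Finset.insert_val_of_notMem hm3]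
      simp only [Finset.mem_insert, not_or]
      exact ⟨edge_ne_right (hij := hij), hm2⟩
    have v3 := Finset.insert_val_of_notMem hm3
    obtain ⟨c1, c2, c3⟩ := complexity_reduct m.val hij hjk
    rw [← v0, ← v1, hN] at c1
    rw [← v0, ← v2, hN] at c2
    rw [← v0, ← v3, hN] at c3
    obtain ⟨A1, s1, p1⟩ := ih _ c1 _ b rfl r1
    obtain ⟨A2, s2, p2⟩ := ih _ c2 _ b rfl r2
    obtain ⟨A3, s3, p3⟩ := ih _ c3 _ (b + 1) rfl r3
    refine ⟨A1 + (A2 + A3), ?_, ?_⟩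
    · refine .head ?_ (reflTransGen_add (fun _ _ C h => h.add C) s1
        (reflTransGen_add (fun _ _ C h => h.add C) s2 s3))
      rw [v0, v1, v2, v3]
      exact SReduction.mk i j k hij hjk b m.val 0
    · intro t ht
      rcases Multiset.mem_add.1 ht with ht | ht
      · exact p1 t ht
      rcases Multiset.mem_add.1 ht with ht | ht
      exacts [p2 t ht, p3 t ht]

/-! ### Evaluation of reduced forms and counting of forests -/

theorem eval_sPoly (A : Multiset (ℕ × Multiset (Edge n))) :
    MvPolynomial.eval (fun _ => 1) (sPoly A) =
      (A.map fun t => (Polynomial.X : Polynomial ℚ) ^ t.1).sum := by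
  rw [sPoly, map_multiset_sum, Multiset.map_map]
  congr 1
  apply Multiset.map_congr rfl
  intro t _
  simp [map_multiset_prod, Multiset.map_map]

theorem isCoveringForest_self {T : Finset (Edge n)} (hT : IsSpanningTree T) (hN : Noncrossing T) :
    IsCoveringForest T T := ⟨subset_closure T, hT.isAcyclic, hN, covers_self T⟩

theorem map_toFinset_eq_admissibleForests {T : Finset (Edge n)} (hn : 1 ≤ n)
    (hT : IsSpanningTree T) (hN : Noncrossing T) {A : Multiset (Multiset (Edge n))}
    (hA : ∀ m ∈ A, ∃ F : Finset (Edge n), m = F.val ∧ IsCoveringForest T F ∧ Alternating F)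
    (hsum : (A.map fun m => (m.map ray).prod).sum = ∏ e ∈ T, ray e) :
    A = (admissibleForests T).val.map Finset.val := by
  classical
  have h1 : A.map Multiset.toFinset = (admissibleForests T).val := by
    apply eq_admissibleForests hn hT hN
    · intro F hF
      obtain ⟨m, hm, rfl⟩ := Multiset.mem_map.1 hF
      obtain ⟨F, rfl, h, ha⟩ := hA m hm
      rw [Finset.val_toFinset]
      exact ⟨⟨h.subset, h.acyclic, h.noncrossing, ha⟩, h.covers⟩
    · rw [← hsum, Multiset.map_map]
      congr 1
      apply Multiset.map_congr rfl
      intro m hm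
      obtain ⟨F, rfl, -⟩ := hA m hm
      rw [Function.comp_apply, Finset.val_toFinset]
      rfl
  rw [← h1, Multiset.map_map]
  conv_lhs => rw [← Multiset.map_id A]
  apply Multiset.map_congr rfl
  intro m hm
  obtain ⟨F, rfl, -⟩ := hA m hm
  simp

theorem exists_reduction_to_admissible {T : Finset (Edge n)} (hn : 1 ≤ n) (hT : IsSpanningTree T)
    (hN : Noncrossing T) : ∃ A, Relation.ReflTransGen SReduction {(0, T.val)} A ∧
      (∀ A', ¬ SReduction A A') ∧
      A.map Prod.snd = (admissibleForests T).val.map Finset.val := by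
  obtain ⟨A, h1, h2⟩ := exists_reduction (T := T) _ T 0 rfl (isCoveringForest_self hT hN)
  refine ⟨A, h1, ?_, ?_⟩
  · rintro A' h
    cases h with
    | mk i j k hij hjk b m R =>
      obtain ⟨F, hF, -, hA⟩ := h2 _ (Multiset.mem_cons_self _ _)
      have e1 : edge i j hij ∈ F := by rw [← Finset.mem_val, ← hF]; simp
      have e2 : edge j k hjk ∈ F := by rw [← Finset.mem_val, ← hF]; simp
      exact hA _ e1 _ e2 rfl
  · apply map_toFinset_eq_admissibleForests hn hT hN
    · intro m hm
      obtain ⟨t, ht, rfl⟩ := Multiset.mem_map.1 hm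
      exact h2 t ht
    · rw [Multiset.map_map]
      refine (SReduction.sum_eq h1).trans ?_
      simp

/-- An arbitrary reduced form is compared with the noncrossing one. Both have alternating terms and
the same generating function, hence equally many terms with each number of edges; homogeneity fixes
the exponents of β. -/
theorem eval_reducedForm {T : Finset (Edge n)} (hn : 1 ≤ n) (hT : IsSpanningTree T)
    (hN : Noncrossing T) {P : MvPolynomial (Edge n) (Polynomial ℚ)}
    (hP : IsSReducedForm T.val P) : MvPolynomial.eval (fun _ => 1) P =
      ∑ F ∈ admissibleForests T, (Polynomial.X : Polynomial ℚ) ^ (n - F.card) := by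
  obtain ⟨A, h1, h2, rfl⟩ := hP
  obtain ⟨B, h3, h4, h5⟩ := exists_reduction_to_admissible hn hT hN
  have hdeg : ∀ t ∈ A, t.1 + t.2.card = n := by
    apply SReduction.degree h1
    intro t ht
    rw [Multiset.mem_singleton.1 ht]
    simpa using hT.card
  have hcard : (A.map Prod.snd).map Multiset.card = (B.map Prod.snd).map Multiset.card := by
    apply card_eq_of_sum_eq
    · intro m hm
      obtain ⟨t, ht, rfl⟩ := Multiset.mem_map.1 hm
      exact alternating_of_irreducible h2 t ht
    · intro m hm
      obtain ⟨t, ht, rfl⟩ := Multiset.mem_map.1 hm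
      exact alternating_of_irreducible h4 t ht
    · rw [Multiset.map_map, Multiset.map_map]
      exact (SReduction.sum_eq h1).trans (SReduction.sum_eq h3).symm
  have h6 : (A.map fun t => (Polynomial.X : Polynomial ℚ) ^ t.1) =
      ((A.map Prod.snd).map Multiset.card).map fun c => Polynomial.X ^ (n - c) := by
    rw [Multiset.map_map, Multiset.map_map]
    apply Multiset.map_congr rfl
    intro t ht
    have := hdeg t ht
    simp only [Function.comp_apply]
    congr 1
    omega
  rw [eval_sPoly, h6, hcard, h5, Multiset.map_map, Multiset.map_map]
  rfl

theorem mem_admissibleForests {T F : Finset (Edge n)} :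
    F ∈ admissibleForests T ↔ IsAdmissible T F := by
  classical
  simp [admissibleForests]

theorem IsAdmissible.card_bounds {T F : Finset (Edge n)} (hF : IsAdmissible T F) :
    1 ≤ F.card ∧ F.card ≤ n := by
  obtain ⟨e, he, -⟩ := hF.root
  exact ⟨Finset.card_pos.2 ⟨e, he⟩, card_le_of_acyclic hF.forest.2.1⟩

theorem sum_admissibleForests (T : Finset (Edge n)) :
    ∑ F ∈ admissibleForests T, (Polynomial.X : Polynomial ℚ) ^ (n - F.card) =
      ∑ m ∈ Finset.range n, (numForests T (n - m) : Polynomial ℚ) * Polynomial.X ^ m := by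
  classical
  rw [← Finset.sum_fiberwise_of_maps_to (t := Finset.range n) (g := fun F => n - F.card)]
  · apply Finset.sum_congr rfl
    intro m hm
    have hset : (admissibleForests T).filter (fun F => n - F.card = m) =
        (admissibleForests T).filter (fun F => F.card = n - m) := by
      apply Finset.filter_congr
      intro F hF
      have := (mem_admissibleForests.1 hF).card_bounds
      have := Finset.mem_range.1 hm
      omega
    rw [Finset.sum_congr rfl fun F hF => by rw [(Finset.mem_filter.1 hF).2], Finset.sum_const,
      nsmul_eq_mul, hset, numForests]
  · intro F hF
    have := (mem_admissibleForests.1 hF).card_bounds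
    rw [Finset.mem_range]
    omega

/-- At β = 0 only forests with n edges survive. The function f is left general so that one statement
serves both the counts and the noncommutative polynomial. -/
theorem sum_zero_pow_admissibleForests {M : Type*} [AddCommMonoid M] {T : Finset (Edge n)}
    (hn : 1 ≤ n) (hT : IsSpanningTree T) (hN : Noncrossing T) (f : Finset (Edge n) → ℚ → M)
    (hf : ∀ F, f F 0 = 0) :
    ∑ F ∈ admissibleForests T, f F ((0 : ℚ) ^ (n - F.card)) = ∑ F ∈ ncaTrees T, f F 1 := by
  classical
  rw [ncaTrees_eq hn hT hN, Finset.sum_filter]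
  apply Finset.sum_congr rfl
  intro F hF
  have := (mem_admissibleForests.1 hF).card_bounds
  split_ifs with h
  · rw [h, Nat.sub_self, pow_zero]
  · rw [zero_pow (by omega), hf]

theorem commutative_part {T : Finset (Edge n)} (hn : 1 ≤ n) (hT : IsSpanningTree T)
    (hN : Noncrossing T) : (∃ P, IsSReducedForm T.val P) ∧ ∀ P, IsSReducedForm T.val P →
      MvPolynomial.eval (fun _ => 1) P =
        ∑ m ∈ Finset.range n, (numForests T (n - m) : Polynomial ℚ) * Polynomial.X ^ m ∧
      (MvPolynomial.eval (fun _ => 1) P).eval 0 = ((ncaTrees T).card : ℚ) := by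
  obtain ⟨A, h1, h2, -⟩ := exists_reduction_to_admissible hn hT hN
  refine ⟨⟨_, A, h1, h2, rfl⟩, fun P hP => ?_⟩
  rw [eval_reducedForm hn hT hN hP]
  refine ⟨sum_admissibleForests T, ?_⟩
  rw [Polynomial.eval_finsetSum]
  simp only [Polynomial.eval_pow, Polynomial.eval_X]
  rw [sum_zero_pow_admissibleForests hn hT hN (fun _ x => x) fun _ => rfl]
  simp

/-! ### Words up to commutation -/

theorem EdgeDisjoint.symm {e f : Edge n} (h : EdgeDisjoint e f) : EdgeDisjoint f e :=
  ⟨h.1.symm, h.2.2.1.symm, h.2.1.symm, h.2.2.2.symm⟩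

/-- Commutation of two adjacent variables without common index. -/
def Swap (w w' : List (Edge n)) : Prop :=
  ∃ u v e f, EdgeDisjoint e f ∧ w = u ++ e :: f :: v ∧ w' = u ++ f :: e :: v

/-- Words which agree up to the allowed commutations. -/
abbrev WordEquiv (w w' : List (Edge n)) : Prop := Relation.ReflTransGen Swap w w'

theorem WordEquiv.append_left {w w' : List (Edge n)} (h : WordEquiv w w') (u : List (Edge n)) :
    WordEquiv (u ++ w) (u ++ w') := by
  refine h.lift (u ++ ·) ?_
  rintro _ _ ⟨u', v, e, f, hef, rfl, rfl⟩
  exact ⟨u ++ u', v, e, f, hef, by simp, by simp⟩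

theorem WordEquiv.append_right {w w' : List (Edge n)} (h : WordEquiv w w') (v : List (Edge n)) :
    WordEquiv (w ++ v) (w' ++ v) := by
  refine h.lift (· ++ v) ?_
  rintro _ _ ⟨u, v', e, f, hef, rfl, rfl⟩
  exact ⟨u, v' ++ v, e, f, hef, by simp, by simp⟩

theorem WordEquiv.cons {w w' : List (Edge n)} (h : WordEquiv w w') (x : Edge n) :
    WordEquiv (x :: w) (x :: w') := h.append_left [x]

theorem WordEquiv.perm {w w' : List (Edge n)} (h : WordEquiv w w') : w.Perm w' := by
  induction h with
  | refl => exact .refl _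
  | tail _ h ih =>
    obtain ⟨u, v, e, f, -, rfl, rfl⟩ := h
    exact ih.trans (List.Perm.append_left u (List.Perm.swap f e v))

theorem WordEquiv.symm {w w' : List (Edge n)} (h : WordEquiv w w') : WordEquiv w' w := by
  induction h with
  | refl => exact .refl
  | tail _ h ih =>
    obtain ⟨u, v, e, f, hef, rfl, rfl⟩ := h
    exact .head ⟨u, v, f, e, hef.symm, rfl, rfl⟩ ih

theorem WordEquiv.ncMonomial_eq {w w' : List (Edge n)} (h : WordEquiv w w') :
    ncMonomial w = ncMonomial w' := by
  induction h with
  | refl => rfl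
  | tail _ h ih =>
    obtain ⟨u, v, e, f, hef, rfl, rfl⟩ := h
    rw [ih]
    have key : PresentedMonoid.mk (CommRel n) (FreeMonoid.of e * FreeMonoid.of f) =
        PresentedMonoid.mk (CommRel n) (FreeMonoid.of f * FreeMonoid.of e) :=
      PresentedMonoid.mk_eq_mk_of_rel (.swap e f hef)
    have hword : ∀ e f : Edge n, FreeMonoid.ofList (u ++ e :: f :: v) =
        FreeMonoid.ofList u * (FreeMonoid.of e * FreeMonoid.of f) * FreeMonoid.ofList v := by
      intro e f
      rw [mul_assoc, mul_assoc]
      rfl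
    rw [ncMonomial, ncMonomial, hword, hword, map_mul, map_mul, key, ← map_mul, ← map_mul]

theorem wordEquiv_move {x : Edge n} {C : List (Edge n)} (hC : ∀ c ∈ C, EdgeDisjoint x c)
    (B : List (Edge n)) : WordEquiv (x :: (C ++ B)) (C ++ x :: B) := by
  induction C with
  | nil => exact .refl
  | cons c C ih =>
    have h1 : WordEquiv (x :: c :: (C ++ B)) (c :: x :: (C ++ B)) :=
      .single ⟨[], C ++ B, x, c, hC c (by simp), rfl, rfl⟩
    exact h1.trans ((ih fun d hd => hC d (List.mem_cons_of_mem c hd)).cons c)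

theorem wordEquiv_partition (p : Edge n → Bool) {M : List (Edge n)}
    (hM : M.Pairwise fun b c => p b = true → p c = false → EdgeDisjoint b c) :
    WordEquiv M ((M.filter fun x => !p x) ++ M.filter p) := by
  induction M with
  | nil => exact .refl
  | cons x M ih =>
    rw [List.pairwise_cons] at hM
    refine ((ih hM.2).cons x).trans ?_
    by_cases hx : p x = true
    · rw [List.filter_cons_of_neg (by simpa using hx), List.filter_cons_of_pos hx]
      refine wordEquiv_move (fun c hc => ?_) _
      rw [List.mem_filter] at hc
      exact hM.1 c hc.1 hx (by simpa using hc.2)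
    · rw [List.filter_cons_of_pos (by simpa using hx), List.filter_cons_of_neg hx]
      exact .refl

/-! ### Good words -/

/-- The order conditions on two edges of a good forest, the first of which has the smaller label. -/
def Before (x y : Edge n) : Prop :=
  tgt y ≠ src x ∧ (src x = src y → tgt y < tgt x) ∧ (tgt x = tgt y → src y < src x)

theorem IsGoodForest.pairwise_before {L : List (Edge n)} (h : IsGoodForest L) :
    L.Pairwise Before := by
  rw [List.pairwise_iff_get]
  intro a b hab
  have hne : L.get a ≠ L.get b := fun h' => hab.ne ((List.nodup_iff_injective_get.1 h.nodup) h')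
  refine ⟨fun h' => hab.asymm (h.consecutive b a h'), fun h' => ?_, fun h' => ?_⟩
  · refine lt_of_le_of_ne (not_lt.1 fun h'' => hab.asymm (h.same_src a b h' h'')) fun h'' => ?_
    exact hne (edge_ext h' h''.symm)
  · refine lt_of_le_of_ne (not_lt.1 fun h'' => hab.asymm (h.same_tgt a b h' h'')) fun h'' => ?_
    exact hne (edge_ext h''.symm h')

theorem before_of_edgeDisjoint {e f : Edge n} (h : EdgeDisjoint e f) : Before e f :=
  ⟨h.2.1.symm, fun h' => absurd h' h.1, fun h' => absurd h' h.2.2.2⟩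

/-- Any two edges sharing a vertex can satisfy `Before` in at most one order, so if both orders are
allowed the variables commute. -/
theorem edgeDisjoint_of_before {x y : Edge n} (h : Before x y) (h' : Before y x) :
    EdgeDisjoint x y :=
  ⟨fun hs => (h.2.1 hs).asymm (h'.2.1 hs.symm), fun hs => h.1 hs.symm, fun hs => h'.1 hs,
    fun hs => (h.2.2 hs).asymm (h'.2.2 hs.symm)⟩

theorem nodup_of_pairwise_before {w : List (Edge n)} (h : w.Pairwise Before) : w.Nodup :=
  h.imp fun hxy hne => by subst hne; exact lt_irrefl _ (hxy.2.1 rfl)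

theorem pairwise_before_swap {u v : List (Edge n)} {e f : Edge n} (hef : EdgeDisjoint e f)
    (h : (u ++ e :: f :: v).Pairwise Before) : (u ++ f :: e :: v).Pairwise Before := by
  have := before_of_edgeDisjoint hef.symm
  simp only [List.pairwise_append, List.pairwise_cons, List.mem_cons] at h ⊢
  grind

/-- A word is determined by its letters and the order conditions, up to commutation. -/
theorem wordEquiv_of_perm {w' : List (Edge n)} : ∀ {w : List (Edge n)}, w.Perm w' →
    w.Pairwise Before → w'.Pairwise Before → WordEquiv w w' := by
  induction w' with
  | nil =>
    intro w hp _ _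
    rw [List.perm_nil.1 hp]
  | cons x w' ih =>
    intro w hp hw hw'
    obtain ⟨u, v, rfl⟩ := List.append_of_mem (hp.symm.subset List.mem_cons_self)
    rw [List.pairwise_cons] at hw'
    have hp' : (u ++ v).Perm w' := (List.perm_middle.symm.trans hp).cons_inv
    -- A letter y standing before x in one word and after it in the other satisfies the order
    -- conditions both ways, so x can be moved to the front.
    have hu : ∀ y ∈ u, EdgeDisjoint x y := by
      intro y hy
      refine edgeDisjoint_of_before (hw'.1 y (hp'.subset (List.mem_append_left v hy))) ?_
      exact (List.pairwise_append.1 hw).2.2 y hy x List.mem_cons_self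
    have hw2 : (u ++ v).Pairwise Before := hw.sublist
      (List.Sublist.append_left (List.sublist_cons_self x v) u)
    exact (wordEquiv_move hu v).symm.trans ((ih hp' hw2 hw'.2).cons x)

theorem pairwise_before_lexLabelling {F : Finset (Edge n)} (hF : Alternating F) :
    (lexLabelling F).Pairwise Before := by
  have h1 := Finset.pairwise_sort F lexLE
  have h2 : (lexLabelling F).Nodup := Finset.sort_nodup F lexLE
  have h3 : ∀ x ∈ lexLabelling F, x ∈ F := fun x hx => (Finset.mem_sort lexLE).1 hx
  refine (h1.and h2).imp_of_mem ?_
  rintro x y hx hy ⟨h4, h5⟩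
  refine ⟨hF y (h3 y hy) x (h3 x hx), fun h => ?_, fun h => ?_⟩
  · rcases h4 with h4 | h4
    · exact h4
    · exact absurd (edge_ext h h4.1) h5
  · rcases h4 with h4 | h4
    · exact absurd h h4.ne'
    · exact lt_of_le_of_ne h4.2 fun h' => h5 (edge_ext h'.symm h)

theorem edgeDisjoint_of_src_lt {b c : Edge n} (h : Before b c) (hs : src b < src c)
    (hne : tgt b ≠ src c) : EdgeDisjoint b c :=
  ⟨hs.ne, (hs.trans c.2).ne, hne, fun h' => hs.asymm (h.2.2 h')⟩

theorem pairwise_of_forall_append {α : Type*} {R : α → α → Prop} {l : List α}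
    (h : ∀ u a m b v, l = u ++ a :: (m ++ b :: v) → R a b) : l.Pairwise R := by
  induction l with
  | nil => exact .nil
  | cons x l ih =>
    refine .cons (fun b hb => ?_) (ih fun u a m b v hl => h (x :: u) a m b v (by rw [hl]; rfl))
    obtain ⟨m, v, rfl⟩ := List.append_of_mem hb
    exact h [] x m b v rfl

/-- In a good word, consecutive edges can be made adjacent by commutations. -/
theorem exists_adjacent {w : List (Edge n)} (hw : w.Pairwise Before)
    (h : ∃ e ∈ w, ∃ f ∈ w, tgt e = src f) :
    ∃ u v e f, tgt e = src f ∧ WordEquiv w (u ++ e :: f :: v) := by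
  classical
  -- Among all pairs of consecutive edges take one with the fewest letters M in between; then no
  -- consecutive pair with a smaller separation occurs among e, M, f.
  have hex : ∃ k, ∃ u e M f v, w = u ++ e :: (M ++ f :: v) ∧ tgt e = src f ∧ M.length = k := by
    obtain ⟨e, he, f, hf, hef⟩ := h
    obtain ⟨u, v, rfl⟩ := List.append_of_mem he
    rw [List.pairwise_append] at hw
    rcases List.mem_append.1 hf with hf | hf
    · exact absurd hef (hw.2.2 f hf e List.mem_cons_self).1
    rcases List.mem_cons.1 hf with rfl | hf
    · exact absurd hef f.2.ne'
    obtain ⟨M, v, rfl⟩ := List.append_of_mem hf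
    exact ⟨_, u, e, M, f, v, rfl, hef, rfl⟩
  obtain ⟨u, e, M, f, v, rfl, hef, hM⟩ := Nat.find_spec hex
  have hmin : ∀ u' e' M' f' v', u ++ e :: (M ++ f :: v) = u' ++ e' :: (M' ++ f' :: v') →
      M'.length < M.length → tgt e' ≠ src f' := by
    intro u' e' M' f' v' heq hlt h'
    exact Nat.find_min hex (hM ▸ hlt) ⟨u', e', M', f', v', heq, h', rfl⟩
  have hMM : M.Pairwise fun b c => tgt b ≠ src c := by
    refine pairwise_of_forall_append fun u' a m b v' hl => ?_
    refine hmin (u ++ e :: u') a m b (v' ++ f :: v) (by simp [hl]) ?_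
    simp [hl]
    omega
  have heM : ∀ c ∈ M, tgt e ≠ src c := by
    intro c hc
    obtain ⟨m, v', rfl⟩ := List.append_of_mem hc
    exact hmin u e m c (v' ++ f :: v) (by simp) (by simp)
  have hMf : ∀ b ∈ M, tgt b ≠ src f := by
    intro b hb
    obtain ⟨u', m, rfl⟩ := List.append_of_mem hb
    exact hmin (u ++ e :: u') b m f v (by simp) (by simp; omega)
  have hb := List.pairwise_append.1 hw
  have hb1 := List.pairwise_cons.1 hb.2.1
  have hb2 := List.pairwise_append.1 hb1.2
  have hpart : WordEquiv M ((M.filter fun x => !decide (src x ≤ src e)) ++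
      M.filter fun x => decide (src x ≤ src e)) := by
    refine wordEquiv_partition (fun x => decide (src x ≤ src e)) ?_
    refine (hb2.1.and hMM).imp ?_
    rintro b c ⟨h1, h2⟩ h3 h4
    rw [decide_eq_true_eq] at h3
    rw [decide_eq_false_iff_not, not_le] at h4
    exact edgeDisjoint_of_src_lt h1 (h3.trans_lt h4) h2
  -- Letters of M starting after e commute with e and move out to the left; those starting at or
  -- before `src e` start before f, commute with f and move out to the right. The first kind also
  -- passes the second.
  set C := M.filter fun x => !decide (src x ≤ src e) with hC
  set B := M.filter fun x => decide (src x ≤ src e) with hB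
  refine ⟨u ++ C, B ++ v, e, f, hef, ?_⟩
  rw [List.append_assoc]
  refine WordEquiv.append_left ?_ u
  have s1 : WordEquiv (e :: (M ++ f :: v)) (e :: (C ++ (B ++ f :: v))) := by
    rw [← List.append_assoc]
    exact (hpart.append_right _).cons e
  have s2 : WordEquiv (e :: (C ++ (B ++ f :: v))) (C ++ e :: (B ++ f :: v)) := by
    refine wordEquiv_move (fun c hc => ?_) _
    rw [hC, List.mem_filter] at hc
    have hlt : src e < src c := by simpa using hc.2
    exact edgeDisjoint_of_src_lt (hb1.1 c (List.mem_append_left _ hc.1)) hlt (heM c hc.1)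
  have s3 : WordEquiv (f :: (B ++ v)) (B ++ f :: v) := by
    refine wordEquiv_move (fun b hb' => ?_) _
    rw [hB, List.mem_filter] at hb'
    have hle : src b ≤ src e := by simpa using hb'.2
    refine (edgeDisjoint_of_src_lt (hb2.2.2 b hb'.1 f List.mem_cons_self) ?_ (hMf b hb'.1)).symm
    rw [← hef]
    exact hle.trans_lt e.2
  exact s1.trans (s2.trans ((s3.symm.cons e).append_left C))

/-- The words of good forests in the closure of `T` covering `T`. -/
structure IsGoodWord (T : Finset (Edge n)) (w : List (Edge n)) : Prop where
  before : w.Pairwise Before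
  forest : IsCoveringForest T w.toFinset

theorem IsGoodWord.swap {T : Finset (Edge n)} {u v : List (Edge n)} {e f : Edge n}
    (hef : EdgeDisjoint e f) (h : IsGoodWord T (u ++ e :: f :: v)) :
    IsGoodWord T (u ++ f :: e :: v) := by
  refine ⟨pairwise_before_swap hef h.before, ?_⟩
  rw [List.toFinset_eq_of_perm _ _ (List.Perm.append_left u (List.Perm.swap e f v))]
  exact h.forest

theorem IsGoodWord.reduct {T : Finset (Edge n)} {u v : List (Edge n)} {i j k : Fin (n + 1)}
    {hij : i < j} {hjk : j < k} (h : IsGoodWord T (u ++ edge i j hij :: edge j k hjk :: v)) :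
    IsGoodWord T (u ++ edge i k (hij.trans hjk) :: edge i j hij :: v) ∧
    IsGoodWord T (u ++ edge j k hjk :: edge i k (hij.trans hjk) :: v) ∧
    IsGoodWord T (u ++ edge i k (hij.trans hjk) :: v) := by
  have hset : (u ++ edge i j hij :: edge j k hjk :: v).toFinset =
      insert (edge i j hij) (insert (edge j k hjk) (u ++ v).toFinset) := by
    ext x; simp only [List.toFinset_append, List.toFinset_cons, Finset.mem_union,
      Finset.mem_insert]; tauto
  have hF := h.forest
  have hb := h.before
  have hnd := nodup_of_pairwise_before hb
  simp only [List.pairwise_append, List.pairwise_cons, List.mem_cons] at hb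
  obtain ⟨bu, ⟨bij, bjk, bv⟩, buv⟩ := hb
  have xij : ∀ x ∈ u, Before x (edge i j hij) := fun x hx => buv x hx _ (Or.inl rfl)
  have xjk : ∀ x ∈ u, Before x (edge j k hjk) := fun x hx => buv x hx _ (Or.inr (Or.inl rfl))
  have yij : ∀ y ∈ v, Before (edge i j hij) y := fun y hy => bij y (Or.inr hy)
  have hN := hF.noncrossing
  rw [hset] at hF
  have hm1 : edge i j hij ∉ (u ++ v).toFinset := by
    have := (List.nodup_middle.1 hnd)
    simp only [List.nodup_cons, List.mem_append, List.mem_cons] at this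
    simp only [List.mem_toFinset, List.mem_append]
    tauto
  have hm2 : edge j k hjk ∉ (u ++ v).toFinset := by
    have h' := (List.nodup_cons.1 (List.nodup_middle.1 hnd)).2
    have := (List.nodup_middle.1 h')
    simpa only [List.nodup_cons, List.mem_toFinset] using (List.nodup_cons.1 this).1
  have hmin : ∀ e ∈ insert (edge i j hij) (insert (edge j k hjk) (u ++ v).toFinset),
      tgt e = j → i ≤ src e := by
    intro e he hej
    simp only [Finset.mem_insert, List.mem_toFinset, List.mem_append] at he
    rcases he with rfl | rfl | he | he
    · exact le_rfl
    · exact absurd hej hjk.ne'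
    · exact ((xij e he).2.2 hej).le
    · exact absurd hej (bjk e he).1
  have hmax : ∀ e ∈ insert (edge i j hij) (insert (edge j k hjk) (u ++ v).toFinset),
      src e = j → tgt e ≤ k := by
    intro e he hej
    simp only [Finset.mem_insert, List.mem_toFinset, List.mem_append] at he
    rcases he with rfl | rfl | he | he
    · exact absurd hej hij.ne
    · exact le_rfl
    · exact absurd hej.symm (xij e he).1
    · exact ((bjk e he).2.1 hej.symm).le
  obtain ⟨hm3, r1, r2, r3⟩ := hF.reduct hm1 hm2 hmin hmax
  -- The order conditions alone do not place (i,k): for example an earlier edge from i is only known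
  -- to end beyond j, and noncrossing with (j,k) pushes its target to k or beyond.
  have cross : ∀ x ∈ u ++ v, ¬ (src x < j ∧ j < tgt x ∧ tgt x < k) ∧
      ¬ (i < src x ∧ src x < j ∧ j < tgt x) := by
    intro x hx
    have hx' : x ∈ (u ++ edge i j hij :: edge j k hjk :: v).toFinset := by
      rw [hset]
      exact Finset.mem_insert_of_mem (Finset.mem_insert_of_mem (List.mem_toFinset.2 hx))
    exact ⟨hN x hx' (edge j k hjk) (by simp), hN (edge i j hij) (by simp) x hx'⟩
  have hne : ∀ x ∈ u ++ v, ¬ (src x = i ∧ tgt x = k) := by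
    rintro x hx ⟨rfl, rfl⟩
    exact hm3 (List.mem_toFinset.2 hx)
  have xik : ∀ x ∈ u, Before x (edge i k (hij.trans hjk)) := by
    intro x hx
    have h1 := xij x hx
    have h2 := xjk x hx
    have h3 := cross x (List.mem_append_left v hx)
    have h4 := hne x (List.mem_append_left v hx)
    simp only [Before, src, tgt, edge] at *
    refine ⟨h2.1, ?_, ?_⟩ <;> grind
  have yik : ∀ y ∈ v, Before (edge i k (hij.trans hjk)) y := by
    intro y hy
    have h1 := yij y hy
    have h2 := bjk y hy
    have h3 := cross y (List.mem_append_right u hy)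
    have h4 := hne y (List.mem_append_right u hy)
    simp only [Before, src, tgt, edge] at *
    refine ⟨h1.1, ?_, ?_⟩ <;> grind
  have b1 : Before (edge i k (hij.trans hjk)) (edge i j hij) :=
    ⟨hij.ne', fun _ => hjk, fun h => absurd h hjk.ne'⟩
  have b2 : Before (edge j k hjk) (edge i k (hij.trans hjk)) :=
    ⟨hjk.ne', fun h => absurd h hij.ne', fun _ => hij⟩
  refine ⟨⟨?_, ?_⟩, ⟨?_, ?_⟩, ⟨?_, ?_⟩⟩
  · simp only [List.pairwise_append, List.pairwise_cons, List.mem_cons]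
    grind
  · convert r1 using 1
    ext x; simp only [List.toFinset_append, List.toFinset_cons, Finset.mem_union,
      Finset.mem_insert]; tauto
  · simp only [List.pairwise_append, List.pairwise_cons, List.mem_cons]
    grind
  · convert r2 using 1
    ext x; simp only [List.toFinset_append, List.toFinset_cons, Finset.mem_union,
      Finset.mem_insert]; tauto
  · simp only [List.pairwise_append, List.pairwise_cons, List.mem_cons]
    grind
  · convert r3 using 1
    ext x; simp only [List.toFinset_append, List.toFinset_cons, Finset.mem_union,
      Finset.mem_insert]; tauto

/-! ### Reductions of words -/

/-- A reduction or a commutation. -/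
abbrev BStep (A B : Multiset (ℕ × List (Edge n))) : Prop := BReduction A B ∨ BCommutation A B

/-- The word `w` cannot be reduced, even after commutations. -/
def IsNormalWord (w : List (Edge n)) : Prop :=
  ∀ u v e f, tgt e = src f → ¬ WordEquiv w (u ++ e :: f :: v)

theorem BReduction.add {A B : Multiset (ℕ × List (Edge n))} (h : BReduction A B)
    (C : Multiset (ℕ × List (Edge n))) : BReduction (A + C) (B + C) := by
  cases h with
  | mk i j k hij hjk b u v R =>
    simp only [Multiset.cons_add]
    exact .mk i j k hij hjk b u v (R + C)

theorem BCommutation.add {A B : Multiset (ℕ × List (Edge n))} (h : BCommutation A B)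
    (C : Multiset (ℕ × List (Edge n))) : BCommutation (A + C) (B + C) := by
  cases h with
  | mk e f hef b u v R =>
    simp only [Multiset.cons_add]
    exact .mk e f hef b u v (R + C)

theorem WordEquiv.bCommutation {w w' : List (Edge n)} (h : WordEquiv w w') (b : ℕ)
    (R : Multiset (ℕ × List (Edge n))) :
    Relation.ReflTransGen BCommutation ((b, w) ::ₘ R) ((b, w') ::ₘ R) := by
  refine h.lift (fun w => (b, w) ::ₘ R) ?_
  rintro _ _ ⟨u, v, e, f, hef, rfl, rfl⟩
  exact .mk e f hef b u v R

theorem exists_wordEquiv_of_bCommutation {A B : Multiset (ℕ × List (Edge n))}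
    (h : Relation.ReflTransGen BCommutation A B) :
    ∀ t ∈ B, ∃ s ∈ A, WordEquiv s.2 t.2 := by
  induction h with
  | refl => exact fun t ht => ⟨t, ht, .refl⟩
  | tail _ h ih =>
    cases h with
    | mk e f hef b u v R =>
      intro t ht
      rcases Multiset.mem_cons.1 ht with rfl | ht
      · obtain ⟨s, hs, hst⟩ := ih _ (Multiset.mem_cons_self _ _)
        exact ⟨s, hs, hst.tail ⟨u, v, e, f, hef, rfl, rfl⟩⟩
      · exact ih t (Multiset.mem_cons_of_mem ht)

theorem irreducible_iff {A : Multiset (ℕ × List (Edge n))} :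
    (∀ A₁ A₂, Relation.ReflTransGen BCommutation A A₁ → ¬ BReduction A₁ A₂) ↔
      ∀ t ∈ A, IsNormalWord t.2 := by
  constructor
  · rintro h ⟨b, w⟩ ht u v ⟨⟨i, j⟩, hij⟩ ⟨⟨j', k⟩, hjk⟩ hef hw
    change j = j' at hef
    subst hef
    obtain ⟨R, rfl⟩ := Multiset.exists_cons_of_mem ht
    exact h _ _ (hw.bCommutation b R) (.mk i j k hij hjk b u v R)
  · rintro h A₁ A₂ h1 h2
    cases h2 with
    | mk i j k hij hjk b u v R =>
      obtain ⟨s, hs, hst⟩ := exists_wordEquiv_of_bCommutation h1 _ (Multiset.mem_cons_self _ _)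
      exact h s hs u v _ _ rfl hst

/-- Every word has a reduced form. -/
theorem exists_bReduction : ∀ (N : ℕ) (w : List (Edge n)) (b : ℕ), complexity (w : Multiset (Edge n)) = N →
    ∃ A, Relation.ReflTransGen BStep {(b, w)} A ∧ ∀ t ∈ A, IsNormalWord t.2 := by
  intro N
  induction N using Nat.strong_induction_on with
  | _ N ih =>
    intro w b hN
    by_cases hw : IsNormalWord w
    · exact ⟨_, .refl, fun t ht => by rw [Multiset.mem_singleton.1 ht]; exact hw⟩
    unfold IsNormalWord at hw
    push Not at hw
    obtain ⟨u, v, ⟨⟨i, j⟩, hij⟩, ⟨⟨j', k⟩, hjk⟩, hef, hww⟩ := hw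
    change j = j' at hef
    subst hef
    have hperm := Multiset.coe_eq_coe.2 hww.perm
    have hmid : ∀ (x : Edge n) (v : List (Edge n)),
        ((u ++ x :: v : List (Edge n)) : Multiset (Edge n)) = x ::ₘ ↑(u ++ v) := fun x v =>
      Multiset.coe_eq_coe.2 List.perm_middle
    have hmid2 : ∀ x y : Edge n, ((u ++ x :: y :: v : List (Edge n)) : Multiset (Edge n)) =
        x ::ₘ y ::ₘ ↑(u ++ v) := fun x y => by rw [hmid, hmid]
    obtain ⟨c1, c2, c3⟩ := complexity_reduct (↑(u ++ v)) (i := i) (j := j) (k := k) hij hjk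
    have h0 := hmid2 (edge i j hij) (edge j k hjk)
    rw [← hmid2, ← h0, ← hperm, hN] at c1
    rw [← hmid2, ← h0, ← hperm, hN] at c2
    rw [← hmid, ← h0, ← hperm, hN] at c3
    obtain ⟨A1, s1, p1⟩ := ih _ c1 _ b rfl
    obtain ⟨A2, s2, p2⟩ := ih _ c2 _ b rfl
    obtain ⟨A3, s3, p3⟩ := ih _ c3 _ (b + 1) rfl
    have hadd : ∀ A B C : Multiset (ℕ × List (Edge n)), BStep A B → BStep (A + C) (B + C) :=
      fun A B C h => h.imp (fun h => h.add C) fun h => h.add C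
    refine ⟨A1 + (A2 + A3), ?_, ?_⟩
    · have t1 : Relation.ReflTransGen BStep {(b, w)}
          {(b, u ++ edge i j hij :: edge j k hjk :: v)} :=
        (hww.bCommutation b 0).lift (p := BStep) (fun A => A) fun _ _ h => Or.inr h
      exact t1.trans (.head (Or.inl (BReduction.mk i j k hij hjk b u v 0))
        (reflTransGen_add hadd s1 (reflTransGen_add hadd s2 s3)))
    · intro t ht
      rcases Multiset.mem_add.1 ht with ht | ht
      · exact p1 t ht
      rcases Multiset.mem_add.1 ht with ht | ht
      exacts [p2 t ht, p3 t ht]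

/-- The commutative image of a noncommutative reduction. -/
theorem sReduction_of_bStep {A B : Multiset (ℕ × List (Edge n))}
    (h : Relation.ReflTransGen BStep A B) :
    Relation.ReflTransGen SReduction (A.map fun t => (t.1, (t.2 : Multiset (Edge n))))
      (B.map fun t => (t.1, (t.2 : Multiset (Edge n)))) := by
  induction h with
  | refl => exact .refl
  | tail _ h ih =>
    rcases h with h | h
    · refine ih.tail ?_
      cases h with
      | mk i j k hij hjk b u v R =>
        have hmid : ∀ (x : Edge n) (v : List (Edge n)),
            ((u ++ x :: v : List (Edge n)) : Multiset (Edge n)) = x ::ₘ ↑(u ++ v) := fun x v =>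
          Multiset.coe_eq_coe.2 List.perm_middle
        simp only [Multiset.map_cons, hmid]
        exact .mk i j k hij hjk b _ _
    · cases h with
      | mk e f hef b u v R =>
        have hswap : ((u ++ e :: f :: v : List (Edge n)) : Multiset (Edge n)) =
            ↑(u ++ f :: e :: v) :=
          Multiset.coe_eq_coe.2 (List.Perm.append_left u (List.Perm.swap f e v))
        simp only [Multiset.map_cons] at ih ⊢
        rwa [hswap] at ih

theorem isGoodWord_of_bStep {T : Finset (Edge n)} {A B : Multiset (ℕ × List (Edge n))}
    (h : Relation.ReflTransGen BStep A B) (hA : ∀ t ∈ A, IsGoodWord T t.2) :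
    ∀ t ∈ B, IsGoodWord T t.2 := by
  induction h with
  | refl => exact hA
  | tail _ h ih =>
    rcases h with h | h
    · cases h with
      | mk i j k hij hjk b u v R =>
        obtain ⟨r1, r2, r3⟩ := (ih _ (Multiset.mem_cons_self _ _)).reduct
        intro t ht
        simp only [Multiset.mem_cons] at ht
        rcases ht with rfl | rfl | rfl | ht
        exacts [r1, r2, r3, ih t (Multiset.mem_cons_of_mem ht)]
    · cases h with
      | mk e f hef b u v R =>
        have r := (ih _ (Multiset.mem_cons_self _ _)).swap hef
        intro t ht
        rcases Multiset.mem_cons.1 ht with rfl | ht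
        exacts [r, ih t (Multiset.mem_cons_of_mem ht)]

/-! ### Irreducible good words -/

theorem IsGoodWord.alternating {T : Finset (Edge n)} {w : List (Edge n)} (h : IsGoodWord T w)
    (hw : IsNormalWord w) : Alternating w.toFinset := by
  intro e he f hf hef
  obtain ⟨u, v, e, f, hef, hww⟩ := exists_adjacent h.before
    ⟨e, List.mem_toFinset.1 he, f, List.mem_toFinset.1 hf, hef⟩
  exact hw u v e f hef hww

theorem IsGoodWord.wordEquiv_lexLabelling {T : Finset (Edge n)} {w : List (Edge n)}
    (h : IsGoodWord T w) (hw : IsNormalWord w) : WordEquiv w (lexLabelling w.toFinset) := by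
  refine wordEquiv_of_perm ?_ h.before (pairwise_before_lexLabelling (h.alternating hw))
  rw [← Multiset.coe_eq_coe, lexLabelling, Finset.sort_eq, List.toFinset_val,
    (nodup_of_pairwise_before h.before).dedup]

/-! ### The noncommutative case -/

theorem bPoly_eq {L : List (Edge n)} (hn : 1 ≤ n) (hL : IsGoodTree L)
    {A : Multiset (ℕ × List (Edge n))} (hA : Relation.ReflTransGen BStep {(0, L)} A)
    (hnorm : ∀ t ∈ A, IsNormalWord t.2) :
    bPoly A = ∑ F ∈ admissibleForests L.toFinset,
      MonoidAlgebra.single (ncMonomial (lexLabelling F))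
        ((Polynomial.X : Polynomial ℚ) ^ (n - F.card)) := by
  have hT := hL.2
  have hN := hL.1.noncrossing
  have hgood : ∀ t ∈ A, IsGoodWord L.toFinset t.2 := by
    refine isGoodWord_of_bStep hA fun t ht => ?_
    rw [Multiset.mem_singleton.1 ht]
    exact ⟨hL.1.pairwise_before, isCoveringForest_self hT hN⟩
  have hS := sReduction_of_bStep hA
  have hcard : ∀ t ∈ A, t.1 + t.2.toFinset.card = n := by
    intro t ht
    have := SReduction.degree (N := n) hS (by
      intro s hs
      rw [Multiset.map_singleton, Multiset.mem_singleton] at hs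
      have := hT.card
      rw [List.toFinset_card_of_nodup hL.1.nodup] at this
      simpa [hs] using this) _ (Multiset.mem_map_of_mem _ ht)
    rw [List.toFinset_card_of_nodup (nodup_of_pairwise_before (hgood t ht).before)]
    simpa using this
  have hval : ∀ t ∈ A, (t.2 : Multiset (Edge n)) = t.2.toFinset.val := fun t ht => by
    rw [List.toFinset_val, (nodup_of_pairwise_before (hgood t ht).before).dedup]
  -- Forgetting the order gives a commutative reduction through noncrossing forests, so the sets of
  -- letters are exactly the admissible forests, each once. The words themselves are then recovered
  -- up to commutation as the lexicographic ones.
  have hadm : A.map (fun t => (t.2 : Multiset (Edge n))) =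
      (admissibleForests L.toFinset).val.map Finset.val := by
    apply map_toFinset_eq_admissibleForests hn hT hN
    · intro m hm
      obtain ⟨t, ht, rfl⟩ := Multiset.mem_map.1 hm
      exact ⟨_, hval t ht, (hgood t ht).forest, (hgood t ht).alternating (hnorm t ht)⟩
    · have h := SReduction.sum_eq hS
      rw [Multiset.map_map, Multiset.map_map] at h
      rw [Multiset.map_map]
      refine h.trans ?_
      rw [Multiset.map_singleton, Multiset.sum_singleton, Finset.prod, List.toFinset_val,
        hL.1.nodup.dedup]
      rfl
  have hterm : (A.map fun t => MonoidAlgebra.single (ncMonomial t.2)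
      ((Polynomial.X : Polynomial ℚ) ^ t.1)) =
      (A.map fun t => (t.2 : Multiset (Edge n))).map fun m =>
        MonoidAlgebra.single (ncMonomial (lexLabelling m.toFinset))
          ((Polynomial.X : Polynomial ℚ) ^ (n - m.toFinset.card)) := by
    rw [Multiset.map_map]
    apply Multiset.map_congr rfl
    intro t ht
    rw [Function.comp_apply,
      ((hgood t ht).wordEquiv_lexLabelling (hnorm t ht)).ncMonomial_eq]
    have := hcard t ht
    have h1 : t.1 = n - t.2.toFinset.card := by omega
    rw [h1]
    rfl
  rw [bPoly, hterm, hadm, Multiset.map_map, Finset.sum]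
  congr 1
  apply Multiset.map_congr rfl
  intro F _
  rw [Function.comp_apply, Finset.val_toFinset]

theorem isBReducedForm_iff {L : List (Edge n)} (hn : 1 ≤ n) (hL : IsGoodTree L)
    (P : NCPoly (Polynomial ℚ) n) : IsBReducedForm L P ↔
      P = ∑ F ∈ admissibleForests L.toFinset,
        MonoidAlgebra.single (ncMonomial (lexLabelling F))
          ((Polynomial.X : Polynomial ℚ) ^ (n - F.card)) := by
  constructor
  · rintro ⟨A, hA, hirr, rfl⟩
    exact bPoly_eq hn hL hA (irreducible_iff.1 hirr)
  · rintro rfl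
    obtain ⟨A, hA, hnorm⟩ := exists_bReduction _ L 0 rfl
    exact ⟨A, hA, irreducible_iff.2 hnorm, (bPoly_eq hn hL hA hnorm).symm⟩

end RootPolytope

theorem theorem2 (n : ℕ) (hn : 1 ≤ n) :
    (∀ T : Finset (RootPolytope.Edge n),
      RootPolytope.IsSpanningTree T → RootPolytope.Noncrossing T →
        (∃ P, RootPolytope.IsSReducedForm T.val P) ∧
        ∀ P, RootPolytope.IsSReducedForm T.val P →
          MvPolynomial.eval (fun _ => 1) P =
            ∑ m ∈ Finset.range n,
              (RootPolytope.numForests T (n - m) : Polynomial ℚ) * Polynomial.X ^ m ∧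
          (MvPolynomial.eval (fun _ => 1) P).eval 0 = ((RootPolytope.ncaTrees T).card : ℚ)) ∧
    (∀ L : List (RootPolytope.Edge n), RootPolytope.IsGoodTree L →
      (∀ P, RootPolytope.IsBReducedForm L P ↔
        P = ∑ F ∈ RootPolytope.admissibleForests L.toFinset,
          MonoidAlgebra.single (RootPolytope.ncMonomial (RootPolytope.lexLabelling F))
            ((Polynomial.X : Polynomial ℚ) ^ (n - F.card))) ∧
      ∀ P, RootPolytope.IsBReducedForm L P →
        MonoidAlgebra.mapRingHom (RootPolytope.NCMonomial n)
            (Polynomial.evalRingHom (0 : ℚ)) P =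
          ∑ F ∈ RootPolytope.ncaTrees L.toFinset,
            MonoidAlgebra.single (RootPolytope.ncMonomial (RootPolytope.lexLabelling F))
              (1 : ℚ)) := by
  refine ⟨fun T hT hN => RootPolytope.commutative_part hn hT hN,
    fun L hL => ⟨RootPolytope.isBReducedForm_iff hn hL, fun P hP => ?_⟩⟩
  rw [(RootPolytope.isBReducedForm_iff hn hL P).1 hP, map_sum,
    ← RootPolytope.sum_zero_pow_admissibleForests hn hL.2 hL.1.noncrossing
      (fun F x => MonoidAlgebra.single (RootPolytope.ncMonomial (RootPolytope.lexLabelling F)) x)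
      fun F => MonoidAlgebra.single_zero _]
  refine Finset.sum_congr rfl fun F _ => ?_
  rw [MonoidAlgebra.mapRingHom_single, map_pow, Polynomial.coe_evalRingHom, Polynomial.eval_X]
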